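/- Let $\Omega\subset\mathbb R/\mathbb Z\times\mathbb R$ be a bounded doubly connected domain whose two boundary components $\partial_{\rm bot}\Omega$, $\partial_{\rm top}\Omega$ are non-contractible. Functions on the double cover of $\Omega$ that change sign when one makes a full turn around the cylinder are called antiperiodic. For $\eta\in\mathbb C$ and $z_1$ on the double cover of $\Omega$, let $f^{[\eta]}_\Omega(z_1,\cdot)$ be the solution of the following boundary value problem: it is an antiperiodic holomorphic function on $\Omega\smallsetminus\{z_1\}$ such that * $f^{[\eta]}_\Omega(z_1,z_2)=\frac1{\pi i}\cdot\frac{\overline\eta}{z_2-z_1}+O(1)$ as $z_2\to z_1$; * $\mathrm{Re}\, f^{[\eta]}_\Omega(z_1,\cdot)$ is continuous up to $\partial_{\rm bot}\Omega$ and vanishes there; * near $\partial_{\rm top}\Omega$ there is a primitive $g$ of $f^{[\eta]}_\Omega(z_1,\cdot)$ such that $\mathrm{Im}\, g$ is continuous up to $\partial_{\rm top}\Omega$ and vanishes there. Put $f_\Omega^{[\pm+]}:=f_\Omega^{[1]}\pm i f_\Omega^{[i]}$ and $f_\Omega^{[\mp-]}:=\overline{f_\Omega^{[\pm+]}}$.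 Let $\phi:T^+\to\Omega$ be a conformal isomorphism of a straight cylinder $T^+=\mathbb R/c\mathbb Z\times(0,\pi)$, $c>0$, onto $\Omega$ that maps the bottom to the bottom and the top to the top. Fix a continuous branch of $(\phi')^{1/2}$ and, with $\phi^{[+]}:=\phi'$, $\phi^{[-]}:=\overline{\phi'}$, $(\phi^{[-]})^{1/2}:=\overline{(\phi')^{1/2}}$, let $$f^{[s_1,s_2]}(z_1,z_2):=f_\Omega^{[s_1,s_2]}(\phi(z_1),\phi(z_2))\,(\phi^{[s_1]}(z_1))^{1/2}(\phi^{[s_2]}(z_2))^{1/2},\qquad s_1,s_2\in\{\pm\}.$$ With $dz^{[+]}:=dz$ and $dz^{[-]}:=d\overline z$, let $$\mathcal A_n(z_1,\dots,z_n):=\frac1{4^n}\sum_{s_1,\dots,s_n\in\{\pm\}}\det\big[\mathbf 1_{j\ne k}f^{[s_j,s_k]}(z_j,z_k)\big]_{j,k=1}^n\prod_{k=1}^n dz_k^{[s_k]},\qquad h_n(z_1,\dots,z_n):=\int_{z_1^0}^{z_1}\!\!\cdots\int_{z_n^0}^{z_n}\mathcal A_n$$ for pairwise distinct $z_1,\dots,z_n\in\overline{T^+}$,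 where $z_1^0,\dots,z_n^0\in\partial_{\rm bot}T^+$ and the integrals are taken along $C^1$ paths in $T^+$ from $z_k^0$ to $z_k$ (only the endpoints may lie on $\partial T^+$) that do not intersect each other. Let $G$ be the positive Green's function of $T^+$ with zero Dirichlet boundary conditions, normalized by $G(z_1,z_2)=-(2\pi)^{-1}\log|z_2-z_1|+O(1)$ as $z_2\to z_1$, and let $\mathrm{hm}_{\rm top}(z)=\pi^{-1}\,\mathrm{Im}\, z$ be the harmonic measure of $\partial_{\rm top}T^+$ in $T^+$. **Proposition.** For $n=2$ and $n=3$ the function $h_n$ is well defined and real-valued: non-intersecting paths exist, the integral converges absolutely along all of them, and its value does not depend on their choice. Moreover, $h_n$ equals a real constant $M_n$ on $n$-tuples of distinct points of $\partial_{\rm top}T^+$, and, for all pairwise distinct $z_1,z_2$ (resp. $z_1,z_2,z_3$) in $T^+$, $$h_2(z_1,z_2)=\pi^{-1}G(z_1,z_2)+M_2\,\mathrm{hm}_{\rm top}(z_1)\,\mathrm{hm}_{\rm top}(z_2),$$ $$h_3(z_1,z_2,z_3)=M_3\,\mathrm{hm}_{\rm top}(z_1)\,\mathrm{hm}_{\rm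 top}(z_2)\,\mathrm{hm}_{\rm top}(z_3).$$ -/

import Mathlib

open Complex Set Filter Topology MeasureTheory Asymptotics

/-! ### Cylindrical domains -/

/-- The infinite cylinder `ℝ/ℤ × ℝ`. -/
abbrev Cylinder : Type := UnitAddCircle × ℝ

/-- The universal covering map `ℂ → ℝ/ℤ × ℝ`, `x + iy ↦ (x mod 1, y)`. -/
def cylProj (z : ℂ) : Cylinder := ((z.re : UnitAddCircle), z.im)

/-- The full preimage in `ℂ` of a subset of the cylinder. Functions on `Ω`, on its double cover, and
multivalued functions on `Ω` are all written as functions on the lift of `Ω`. -/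
def cylLift (Ω : Set Cylinder) : Set ℂ := cylProj ⁻¹' Ω

/-- The part of the complement of `Ω` whose connected components (in the complement) extend to the
lower end of the cylinder. -/
def lowerComplement (Ω : Set Cylinder) : Set Cylinder :=
  {p | p ∈ Ωᶜ ∧ ∀ R : ℝ, ∃ q ∈ connectedComponentIn Ωᶜ p, q.2 < R}

/-- The part of the complement of `Ω` whose connected components (in the complement) extend to the
upper end of the cylinder. -/
def upperComplement (Ω : Set Cylinder) : Set Cylinder :=
  {p | p ∈ Ωᶜ ∧ ∀ R : ℝ, ∃ q ∈ connectedComponentIn Ωᶜ p, R < q.2}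

/-- Bounded doubly connected domains of the cylinder with two non-contractible boundary components:
the complement has exactly two connected components (for bounded `Ω` the lower complement and the
upper complement are connected, as each contains one end of the cylinder), and these separate the
two ends of the cylinder from each other. -/
structure IsCylindricalDomain (Ω : Set Cylinder) : Prop where
  isOpen : IsOpen Ω
  isConnected : IsConnected Ω
  bounded : ∃ R : ℝ, ∀ p ∈ Ω, |p.2| ≤ R
  compl_eq : Ωᶜ = lowerComplement Ω ∪ upperComplement Ω
  disjoint : Disjoint (lowerComplement Ω) (upperComplement Ω)

/-- The bottom boundary component. -/
def bottomBoundary (Ω : Set Cylinder) : Set Cylinder := frontier Ω ∩ lowerComplement Ω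

/-- The top boundary component. -/
def topBoundary (Ω : Set Cylinder) : Set Cylinder := frontier Ω ∩ upperComplement Ω

/-! ### The boundary value problem -/

/-- `F = f^{[η]}(z₁, ·)` solves the boundary value problem in `Ω` with the singularity at `z₁`
(a point of the lift of `Ω`). Antiperiodic functions are functions `F` on the lift of `Ω` with
`F (z + 1) = - F z`; such an `F` also has poles at the other points of the orbit `z₁ + ℤ`. -/
structure SolvesBVP (Ω : Set Cylinder) (η z₁ : ℂ) (F : ℂ → ℂ) : Prop where
  holomorphic : DifferentiableOn ℂ F (cylLift Ω \ {z | ∃ m : ℤ, z = z₁ + m})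
  antiperiodic : ∀ z ∈ cylLift Ω, F (z + 1) = - F z
  /-- `F(z) = (πi)⁻¹ · conj η / (z - z₁) + O(1)` as `z → z₁`. -/
  singularity :
    (fun z => F z - 1 / (Real.pi * I) * (starRingEnd ℂ η / (z - z₁))) =O[𝓝[≠] z₁]
      (fun _ => (1 : ℝ))
  /-- `Re F` is continuous up to the bottom boundary and vanishes there. -/
  bottom : ∀ w, cylProj w ∈ bottomBoundary Ω →
    Tendsto (fun z => (F z).re) (𝓝[cylLift Ω] w) (𝓝 0)
  /-- Near the top boundary there is a primitive `g` of `F` such that `Im g` is continuous up to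
  the top boundary and vanishes there. -/
  top : ∃ (V : Set Cylinder) (g : ℂ → ℂ), IsOpen V ∧ topBoundary Ω ⊆ V ∧
    (∀ z ∈ cylLift (Ω ∩ V), HasDerivAt g (F z) z) ∧
    ∀ w, cylProj w ∈ topBoundary Ω →
      Tendsto (fun z => (g z).im) (𝓝[cylLift Ω] w) (𝓝 0)

/-- Signs `s ∈ {±}` are written as Booleans (`true` is `+`); `z^{[+]} = z` and `z^{[-]} = conj z`. -/
def conjSign (s : Bool) (z : ℂ) : ℂ := if s then z else starRingEnd ℂ z

/-- The functions `f^{[s₁,s₂]}` built from the solutions `f η z₁ z₂ = f^{[η]}(z₁,z₂)`: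
`f^{[±,+]} = f^{[1]} ± i f^{[i]}` and `f^{[∓,-]} = conj f^{[±,+]}`. -/
noncomputable def signedF (f : ℂ → ℂ → ℂ → ℂ) : Bool → Bool → ℂ → ℂ → ℂ
  | true, true, z₁, z₂ => f 1 z₁ z₂ + I * f I z₁ z₂
  | false, true, z₁, z₂ => f 1 z₁ z₂ - I * f I z₁ z₂
  | false, false, z₁, z₂ => starRingEnd ℂ (f 1 z₁ z₂ + I * f I z₁ z₂)
  | true, false, z₁, z₂ => starRingEnd ℂ (f 1 z₁ z₂ - I * f I z₁ z₂)

/-! ### The straight cylinder `T⁺ = ℝ/cℤ × (0,π)` -/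

/-- The lift `ℝ × (0,π)` of `T⁺`. -/
def openStrip : Set ℂ := {z | 0 < z.im ∧ z.im < Real.pi}

/-- The lift `ℝ × [0,π]` of the closure of `T⁺`. -/
def closedStrip : Set ℂ := {z | 0 ≤ z.im ∧ z.im ≤ Real.pi}

/-- The points `z k` represent pairwise distinct points of `ℝ/cℤ × ℝ`. -/
def DistinctMod (c : ℝ) {n : ℕ} (z : Fin n → ℂ) : Prop :=
  ∀ j k, j ≠ k → ∀ m : ℤ, z j ≠ z k + m * c

/-- `φ` is (the lift of) a conformal isomorphism from `T⁺ = ℝ/cℤ × (0,π)` onto `Ω` that maps the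
bottom to the bottom and the top to the top. (A biholomorphism that exchanges the two ends has
lifts with `φ (z + c) = φ z - 1`.) -/
structure IsUniformization (Ω : Set Cylinder) (c : ℝ) (φ : ℂ → ℂ) : Prop where
  holomorphic : DifferentiableOn ℂ φ openStrip
  equivariant : ∀ z ∈ openStrip, φ (z + c) = φ z + 1
  bijOn : BijOn φ openStrip (cylLift Ω)

/-- `r` is a continuous branch of `(φ')^{1/2}` on `T⁺`. -/
def IsSqrtDeriv (φ r : ℂ → ℂ) : Prop :=
  ContinuousOn r openStrip ∧ ∀ z ∈ openStrip, r z ^ 2 = deriv φ z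

/-- The functions
`f^{[s₁,s₂]}(z₁,z₂) = f_Ω^{[s₁,s₂]}(φ z₁, φ z₂) (φ^{[s₁]}(z₁))^{1/2} (φ^{[s₂]}(z₂))^{1/2}`
on `T⁺ × T⁺`, where `φ^{[+]} = φ'`, `φ^{[-]} = conj φ'`, and `r = (φ')^{1/2}`. -/
noncomputable def pulledF (f : ℂ → ℂ → ℂ → ℂ) (φ r : ℂ → ℂ) (s₁ s₂ : Bool) (z₁ z₂ : ℂ) : ℂ :=
  signedF f s₁ s₂ (φ z₁) (φ z₂) * conjSign s₁ (r z₁) * conjSign s₂ (r z₂)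

/-- The multilinear form
`𝒜ₙ(z₁,…,zₙ) = 4⁻ⁿ ∑_{s} det[1_{j≠k} F^{[s_j,s_k]}(z_j,z_k)] ∏_k dz_k^{[s_k]}`
evaluated at the tangent vectors `v₁,…,vₙ` (one in each of the variables). -/
noncomputable def formA (F : Bool → Bool → ℂ → ℂ → ℂ) {n : ℕ} (z v : Fin n → ℂ) : ℂ :=
  1 / 4 ^ n * ∑ s : Fin n → Bool,
    (Matrix.of fun j k => if j = k then 0 else F (s j) (s k) (z j) (z k)).det *
      ∏ k, conjSign (s k) (v k)

/-- Pairwise disjoint (in `ℝ/cℤ × [0,π]`) `C¹` paths `γ k : [0,1] → ℝ × [0,π]` that start on the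
bottom boundary of `T⁺`, end at `z k`, and stay in `T⁺` in between. -/
structure IsPathSystem (c : ℝ) {n : ℕ} (γ : Fin n → ℝ → ℂ) (z : Fin n → ℂ) : Prop where
  smooth : ∀ k, ContDiffOn ℝ 1 (γ k) (Icc 0 1)
  start : ∀ k, (γ k 0).im = 0
  inside : ∀ k, ∀ t ∈ Ioo (0 : ℝ) 1, γ k t ∈ openStrip
  finish : ∀ k, γ k 1 = z k
  disjoint : ∀ j k, j ≠ k → ∀ s ∈ Icc (0 : ℝ) 1, ∀ t ∈ Icc (0 : ℝ) 1, ∀ m : ℤ,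
    γ j s ≠ γ k t + m * c

/-- The multiple integral of `𝒜ₙ` over the product of paths from the bottom boundary to
`z₁,…,zₙ` is well defined and equals `a`: non-intersecting paths exist, and for all such paths the
integral converges absolutely and has the value `a`. -/
def IsCorrelation (c : ℝ) (F : Bool → Bool → ℂ → ℂ → ℂ) {n : ℕ} (z : Fin n → ℂ) (a : ℝ) : Prop :=
  (∃ γ, IsPathSystem c γ z) ∧
  ∀ γ, IsPathSystem c γ z →
    IntegrableOn (fun t : Fin n → ℝ =>
      formA F (fun k => γ k (t k)) (fun k => deriv (γ k) (t k))) (Icc 0 1) ∧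
    ∫ t in Icc (0 : Fin n → ℝ) 1,
      formA F (fun k => γ k (t k)) (fun k => deriv (γ k) (t k)) = (a : ℂ)

/-- The positive Green's function of `T⁺ = ℝ/cℤ × (0,π)` with zero Dirichlet boundary conditions,
normalized by `G(z₁,z₂) = -(2π)⁻¹ log |z₂ - z₁| + O(1)` as `z₂ → z₁`. -/
structure IsDirichletGreen (c : ℝ) (G : ℂ → ℂ → ℝ) : Prop where
  periodic : ∀ z₁ ∈ openStrip, ∀ z₂ ∈ openStrip, G z₁ (z₂ + c) = G z₁ z₂
  positive : ∀ z₁ ∈ openStrip, ∀ z₂ ∈ openStrip, (∀ m : ℤ, z₂ ≠ z₁ + m * c) → 0 < G z₁ z₂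
  harmonic : ∀ z₁ ∈ openStrip,
    InnerProductSpace.HarmonicOnNhd (G z₁) (openStrip \ {z | ∃ m : ℤ, z = z₁ + m * c})
  boundary : ∀ z₁ ∈ openStrip, ∀ w : ℂ, (w.im = 0 ∨ w.im = Real.pi) →
    Tendsto (G z₁) (𝓝[openStrip] w) (𝓝 0)
  singularity : ∀ z₁ ∈ openStrip,
    (fun z₂ => G z₁ z₂ + (2 * Real.pi)⁻¹ * Real.log ‖z₂ - z₁‖) =O[𝓝[≠] z₁] (fun _ => (1 : ℝ))

/-- The harmonic measure of the top boundary of `T⁺`, `hm_top(z) = π⁻¹ Im z`. -/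
noncomputable def hmTop (z : ℂ) : ℝ := Real.pi⁻¹ * z.im

/-! Everything is made explicit on the strip. Let θ = `cylTheta c`, entire with simple zeros on the
lattice cℤ + 2πiℤ, and let K = `ellKernel b c` be a quotient of thetas with multipliers −e^{−bc} and
−1 along c and 2πi, residue one at 0, and K(z̄) the conjugate of K(z). Then e^{bz}(a K(z − z₁) − ā
K(z − z̄₁)) is antiperiodic, purely imaginary on the bottom, and has constant argument bπ modulo π
on the top. Fourier expansion shows that these properties and the pole determine a function
(`strip_uniqueness`, `eq_stripModel`). The condition on the top boundary of Ω involves φ' after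
pulling back. Since φ' has a single-valued logarithm on the cylinder (`exists_log_deriv`), an
additive boundary value problem (`exists_boundary_correction`) yields a real b and a factor ω,
depending neither on the pole nor on η, such that every pulled-back solution is ω times a bracket of
the above type (`exists_isGauge`). Hence f^{[s₁,s₂]} is, up to a sign and the constant 2/(πi),
K(z₂^{[s₂]} − z₁^{[s₁]}) times a quotient of one function at the two points (`pulledF_eq`). That
quotient is a conjugation by a diagonal matrix and disappears from determinants. So only K(z)K(−z)
and K(x)K(y)K(−x−y) + K(−x)K(−y)K(x+y) matter. Both are elliptic. By Liouville the former is (log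
θ)'' + e with e real (`ellKernel_mul_neg`), while the latter has no poles and is a real constant τ
(`exists_kernelTriple_eq`). After summation over the signs, a constant contributes a multiple of the
product of the forms Im dz_k, which integrates to the product of the Im z_k. The (log θ)'' part is
the mixed derivative of log|θ(z₂ − z₁)| − log|θ(z₂ − z̄₁)|, which vanishes on the bottom and the top
and is a multiple of the Green's function by the maximum principle (`eq_logPotential`). The
integrands being exact in each variable, the paths do not matter, and M₂ = −e, M₃ = τ. -/

/-! ### A theta function with zeros on a rectangular lattice -/

/-- The product `∏_{n ≥ 1} (1 - qⁿ w)`. -/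
noncomputable def qProd (q : ℝ) (w : ℂ) : ℂ := ∏' n : ℕ, (1 + -((q : ℂ) ^ (n + 1) * w))

section qProd

variable {q : ℝ}

theorem summable_qProd (hq0 : 0 < q) (hq1 : q < 1) (w : ℂ) :
    Summable fun n : ℕ => -((q : ℂ) ^ (n + 1) * w) := by
  have h : Summable fun n : ℕ => (q : ℂ) ^ (n + 1) := by
    refine (summable_nat_add_iff 1).mpr (summable_geometric_of_norm_lt_one ?_)
    simpa [abs_of_pos hq0] using hq1
  exact (h.mul_right w).neg

theorem qProd_eq_mul (hq0 : 0 < q) (hq1 : q < 1) (w : ℂ) :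
    qProd q w = (1 - q * w) * qProd q (q * w) := by
  have hm : Multipliable fun n : ℕ => (1 + -((q : ℂ) ^ (n + 1) * (q * w))) :=
    multipliable_one_add_of_summable (summable_qProd hq0 hq1 _).norm
  have hm' : Multipliable fun n : ℕ => (1 + -((q : ℂ) ^ (n + 1 + 1) * w)) := by
    refine hm.congr fun n => ?_
    ring
  rw [qProd, tprod_eq_zero_mul' (f := fun n : ℕ => 1 + -((q : ℂ) ^ (n + 1) * w)) hm', qProd]
  congr 1
  · ring
  · refine tprod_congr fun n => ?_
    ring

theorem qProd_conj (hq0 : 0 < q) (hq1 : q < 1) (w : ℂ) :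
    qProd q (starRingEnd ℂ w) = starRingEnd ℂ (qProd q w) := by
  have hm : Multipliable fun n : ℕ => (1 + -((q : ℂ) ^ (n + 1) * w)) :=
    multipliable_one_add_of_summable (summable_qProd hq0 hq1 _).norm
  rw [qProd, qProd, hm.map_tprod (starRingEnd ℂ) Complex.continuous_conj]
  simp

theorem differentiable_qProd (hq0 : 0 < q) (hq1 : q < 1) : Differentiable ℂ (qProd q) := by
  intro w
  set R := ‖w‖ + 1
  have h : HasProdLocallyUniformlyOn (fun (n : ℕ) w => 1 + -((q : ℂ) ^ (n + 1) * w))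
      (qProd q) (Metric.ball (0 : ℂ) R) := by
    apply hasProdLocallyUniformlyOn_of_forall_compact Metric.isOpen_ball
    intro K hK hcK
    have hs : Summable fun n : ℕ => q ^ (n + 1) * R :=
      ((summable_nat_add_iff 1).mpr (summable_geometric_of_lt_one hq0.le hq1)).mul_right R
    refine hs.hasProdUniformlyOn_nat_one_add hcK (.of_forall fun n x hx => ?_)
      (fun _ => by fun_prop)
    have hx' : ‖x‖ < R := by simpa using hK hx
    rw [norm_neg, norm_mul, norm_pow, Complex.norm_real, Real.norm_of_nonneg hq0.le]
    gcongr
  have hd := h.differentiableOn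
    (.of_forall fun _ => by simpa [Finset.prod_fn] using
      DifferentiableOn.finsetProd (fun _ _ => by fun_prop)) Metric.isOpen_ball
  exact hd.differentiableAt (Metric.isOpen_ball.mem_nhds (by simp [R]))

theorem qProd_eq_zero (hq0 : 0 < q) (hq1 : q < 1) {w : ℂ} (h : qProd q w = 0) :
    ∃ n : ℕ, (q : ℂ) ^ (n + 1) * w = 1 := by
  by_contra! hne
  refine tprod_one_add_ne_zero_of_summable (fun n => ?_) (summable_qProd hq0 hq1 w).norm h
  intro h0
  exact hne n (by linear_combination -h0)

end qProd

/-- An entire function with simple zeros exactly at `c ℤ + 2 π i ℤ`. -/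
noncomputable def cylTheta (c : ℝ) (z : ℂ) : ℂ :=
  (exp (z / 2) - exp (-z / 2)) * qProd (Real.exp (-c)) (exp z) * qProd (Real.exp (-c)) (exp (-z))

/-- The lattice `c ℤ + 2 π i ℤ`. -/
def latticePts (c : ℝ) : Set ℂ := {z | ∃ m n : ℤ, z = m * c + n * (2 * Real.pi * I)}

section theta

variable {c : ℝ}

theorem exp_neg_lt_one (hc : 0 < c) : Real.exp (-c) < 1 := by simpa using hc

theorem differentiable_cylTheta (hc : 0 < c) : Differentiable ℂ (cylTheta c) := by
  have := differentiable_qProd (Real.exp_pos (-c)) (exp_neg_lt_one hc)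
  unfold cylTheta
  fun_prop

theorem cylTheta_zero : cylTheta c 0 = 0 := by simp [cylTheta]

theorem cylTheta_conj (hc : 0 < c) (z : ℂ) :
    cylTheta c (starRingEnd ℂ z) = starRingEnd ℂ (cylTheta c z) := by
  have h := qProd_conj (Real.exp_pos (-c)) (exp_neg_lt_one hc)
  simp only [cylTheta, map_mul, map_sub, ← h, ← exp_conj, map_neg, map_div₀, map_ofNat]

theorem cylTheta_add_two_pi_I (z : ℂ) : cylTheta c (z + 2 * Real.pi * I) = -cylTheta c z := by
  have h1 : exp ((z + 2 * Real.pi * I) / 2) = -exp (z / 2) := by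
    rw [show (z + 2 * Real.pi * I) / 2 = z / 2 + Real.pi * I by ring, exp_add, exp_pi_mul_I]
    ring
  have h2 : exp (-(z + 2 * Real.pi * I) / 2) = -exp (-z / 2) := by
    rw [show -(z + 2 * Real.pi * I) / 2 = -z / 2 - Real.pi * I by ring, exp_sub, exp_pi_mul_I]
    ring
  have h3 : exp (z + 2 * Real.pi * I) = exp z := by
    rw [exp_add, exp_two_pi_mul_I, mul_one]
  have h4 : exp (-(z + 2 * Real.pi * I)) = exp (-z) := by
    rw [neg_add, ← sub_eq_add_neg, exp_sub, exp_two_pi_mul_I, div_one]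
  rw [cylTheta, h1, h2, h3, h4, cylTheta]
  ring

/-- The shift adds a factor to one product and removes one from the other; together with the
exponential prefactor they collapse to one exponential. -/
theorem cylTheta_add_period (hc : 0 < c) (z : ℂ) :
    cylTheta c (z + c) = -exp (z + c / 2) * cylTheta c z := by
  have h := qProd_eq_mul (Real.exp_pos (-c)) (exp_neg_lt_one hc)
  have e1 : qProd (Real.exp (-c)) (exp (z + c)) =
      (1 - exp z) * qProd (Real.exp (-c)) (exp z) := by
    rw [h, ofReal_exp, ← exp_add]
    congr 3 <;> push_cast <;> ring
  have e2 : qProd (Real.exp (-c)) (exp (-z)) =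
      (1 - exp (-z - c)) * qProd (Real.exp (-c)) (exp (-(z + c))) := by
    rw [h, ofReal_exp, ← exp_add]
    congr 3 <;> push_cast <;> ring_nf
  have e3 : exp ((z + c) / 2) - exp (-(z + c) / 2) =
      exp ((z + c) / 2) * (1 - exp (-z - c)) := by
    rw [mul_sub, ← exp_add, mul_one]
    congr 2
    ring
  have e4 : exp ((z + c) / 2) * (1 - exp z) =
      -exp (z + c / 2) * (exp (z / 2) - exp (-z / 2)) := by
    rw [mul_sub, neg_mul, mul_sub, ← exp_add, ← exp_add, ← exp_add]
    ring_nf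
  rw [cylTheta, cylTheta, e1, e2, e3]
  linear_combination (1 - exp (-z - c)) * qProd (Real.exp (-c)) (exp z) *
    qProd (Real.exp (-c)) (exp (-(z + c))) * e4

theorem qProd_exp_eq_zero (hc : 0 < c) {z : ℂ} (h : qProd (Real.exp (-c)) (exp z) = 0) :
    ∃ (m : ℕ) (n : ℤ), z = (m + 1) * c + n * (2 * Real.pi * I) := by
  obtain ⟨m, hm⟩ := qProd_eq_zero (Real.exp_pos (-c)) (exp_neg_lt_one hc) h
  rw [ofReal_exp, ← exp_nat_mul, ← exp_add, exp_eq_one_iff] at hm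
  obtain ⟨n, hn⟩ := hm
  refine ⟨m, n, ?_⟩
  push_cast at hn
  linear_combination hn

theorem mem_latticePts_of_cylTheta_eq_zero (hc : 0 < c) {z : ℂ} (h : cylTheta c z = 0) :
    z ∈ latticePts c := by
  rcases mul_eq_zero.mp h with h | h
  · rcases mul_eq_zero.mp h with h | h
    · obtain ⟨n, hn⟩ := exp_eq_exp_iff_exists_int.mp (sub_eq_zero.mp h)
      refine ⟨0, n, ?_⟩
      push_cast
      linear_combination hn
    · obtain ⟨m, n, h⟩ := qProd_exp_eq_zero hc h
      exact ⟨m + 1, n, by push_cast; exact h⟩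
  · obtain ⟨m, n, h⟩ := qProd_exp_eq_zero hc h
    refine ⟨-(m + 1), -n, ?_⟩
    push_cast
    linear_combination -h

/-- The prefactor has derivative 1 at its zero and both products are nonzero there. Simplicity of
this zero is what gives `ellKernel` a simple pole. -/
theorem deriv_cylTheta_zero_ne (hc : 0 < c) : deriv (cylTheta c) 0 ≠ 0 := by
  have hE := differentiable_qProd (Real.exp_pos (-c)) (exp_neg_lt_one hc)
  have h1 : HasDerivAt (fun z : ℂ => exp (z / 2) - exp (-z / 2)) 1 0 := by
    have := (((hasDerivAt_id (0 : ℂ)).div_const 2).cexp).sub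
      (((hasDerivAt_id (0 : ℂ)).neg.div_const 2).cexp)
    exact this.congr_deriv (by norm_num)
  have h2 : DifferentiableAt ℂ
      (fun z => qProd (Real.exp (-c)) (exp z) * qProd (Real.exp (-c)) (exp (-z))) 0 := by
    fun_prop
  have h3 : HasDerivAt (cylTheta c) _ 0 := (h1.mul h2.hasDerivAt).congr_of_eventuallyEq
    (.of_forall fun z => by simp [cylTheta, mul_assoc])
  have h4 : qProd (Real.exp (-c)) 1 ≠ 0 := by
    intro h0
    obtain ⟨m, n, h⟩ := qProd_exp_eq_zero hc (z := 0) (by simpa using h0)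
    have := congrArg re h
    simp at this
    rcases this with h | h
    · linarith [(Nat.cast_nonneg m : (0 : ℝ) ≤ m)]
    · exact hc.ne' h
  rw [h3.deriv]
  simpa using h4

end theta

/-! ### The zero lattice and Liouville's theorem -/

section lattice

variable {c : ℝ}

theorem cylTheta_add_int_mul (hc : 0 < c) (z : ℂ) (m n : ℤ) :
    cylTheta c (z + (m * c + n * (2 * Real.pi * I))) = 0 ↔ cylTheta c z = 0 := by
  have h1 : ∀ z, cylTheta c (z + c) = 0 ↔ cylTheta c z = 0 := fun z => by
    rw [cylTheta_add_period hc]; simp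
  have h2 : ∀ z, cylTheta c (z + 2 * Real.pi * I) = 0 ↔ cylTheta c z = 0 := fun z => by
    rw [cylTheta_add_two_pi_I]; simp
  have h3 : ∀ (n : ℤ) z, cylTheta c (z + n * (2 * Real.pi * I)) = 0 ↔ cylTheta c z = 0 := by
    intro n
    induction n with
    | zero => simp
    | succ n ih =>
      intro z
      rw [← ih z, ← h2 (z + ((n : ℤ) : ℂ) * (2 * Real.pi * I))]
      push_cast; ring_nf
    | pred n ih =>
      intro z
      rw [← ih z, ← h2]
      push_cast; ring_nf
  have h4 : ∀ (n : ℤ) z, cylTheta c (z + n * c) = 0 ↔ cylTheta c z = 0 := by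
    intro n
    induction n with
    | zero => simp
    | succ n ih =>
      intro z
      rw [← ih z, ← h1 (z + ((n : ℤ) : ℂ) * c)]
      push_cast; ring_nf
    | pred n ih =>
      intro z
      rw [← ih z, ← h1]
      push_cast; ring_nf
  rw [← add_assoc, h3, h4]

theorem cylTheta_eq_zero_iff (hc : 0 < c) (z : ℂ) : cylTheta c z = 0 ↔ z ∈ latticePts c := by
  refine ⟨mem_latticePts_of_cylTheta_eq_zero hc, ?_⟩
  rintro ⟨m, n, rfl⟩
  have := (cylTheta_add_int_mul hc 0 m n).mpr cylTheta_zero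
  simpa using this

theorem neg_mem_latticePts {z : ℂ} : -z ∈ latticePts c ↔ z ∈ latticePts c := by
  constructor
  · rintro ⟨m, n, h⟩
    exact ⟨-m, -n, by push_cast; linear_combination -h⟩
  · rintro ⟨m, n, h⟩
    exact ⟨-m, -n, by push_cast; linear_combination -h⟩

theorem isClosed_latticePts (hc : 0 < c) : IsClosed (latticePts c) := by
  have : latticePts c = cylTheta c ⁻¹' {0} := by
    ext z; simp [cylTheta_eq_zero_iff hc]
  rw [this]
  exact isClosed_singleton.preimage (differentiable_cylTheta hc).continuous

theorem cylTheta_eventually_ne (hc : 0 < c) (z : ℂ) : ∀ᶠ w in 𝓝[≠] z, cylTheta c w ≠ 0 := by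
  have ha : AnalyticOnNhd ℂ (cylTheta c) univ := fun z _ =>
    (differentiable_cylTheta hc).analyticAt z
  rcases (ha z (mem_univ z)).eventually_eq_zero_or_eventually_ne_zero with h | h
  · have := ha.eqOn_zero_of_preconnected_of_eventuallyEq_zero isPreconnected_univ (mem_univ z) h
    refine absurd ?_ (deriv_cylTheta_zero_ne hc)
    have h0 : cylTheta c = fun _ => 0 := funext fun w => this (mem_univ w)
    rw [h0]; simp
  · exact h

theorem not_mem_latticePts_eventually (hc : 0 < c) (z : ℂ) :
    ∀ᶠ w in 𝓝[≠] z, w ∉ latticePts c := by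
  filter_upwards [cylTheta_eventually_ne hc z] with w hw
  rwa [← cylTheta_eq_zero_iff hc]

theorem not_mem_latticePts_of_im {z : ℂ} (h0 : 0 < z.im) (h1 : z.im < 2 * Real.pi) :
    z ∉ latticePts c := by
  rintro ⟨m, n, rfl⟩
  simp at h0 h1
  have hp := Real.pi_pos
  have a : (0 : ℝ) < n := by
    by_contra! h
    nlinarith
  have b : (n : ℝ) < 1 := by
    by_contra! h
    nlinarith
  norm_cast at a b
  omega

/-- A function which is bounded near every point, and holomorphic off a discrete set, has a
holomorphic extension. -/
theorem differentiable_limUnder {f : ℂ → ℂ} {U : Set ℂ}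
    (hd : ∀ z ∈ U, ∀ᶠ w in 𝓝[≠] z, DifferentiableAt ℂ f w)
    (hb : ∀ z ∈ U, f =O[𝓝[≠] z] fun _ => (1 : ℝ)) :
    DifferentiableOn ℂ (fun z => limUnder (𝓝[≠] z) f) U ∧
      ∀ z, ContinuousAt f z → limUnder (𝓝[≠] z) f = f z := by
  have key : ∀ z, ContinuousAt f z → limUnder (𝓝[≠] z) f = f z := fun z hz =>
    (hz.tendsto.mono_left nhdsWithin_le_nhds).limUnder_eq
  refine ⟨fun z hz => DifferentiableAt.differentiableWithinAt ?_, key⟩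
  have hd' := hd z hz
  rw [eventually_nhdsWithin_iff] at hd'
  have h1 : DifferentiableOn ℂ f ({w | w ≠ z → DifferentiableAt ℂ f w} \ {z}) := fun w hw =>
    (hw.1 hw.2).differentiableWithinAt
  have h2 := differentiableOn_update_limUnder_of_isLittleO hd' h1
    (IsBoundedUnder.isLittleO_sub_self_inv (by
      have := (hb z hz).sub (isBigO_const_const (f z) (one_ne_zero : (1 : ℝ) ≠ 0) (𝓝[≠] z))
      exact (isBigO_one_iff ℝ).mp this))
  refine (h2.differentiableAt hd').congr_of_eventuallyEq ?_
  filter_upwards [hd'] with w hw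
  rcases eq_or_ne w z with rfl | hne
  · simp
  · rw [Function.update_of_ne hne]
    exact key w (hw hne).continuousAt

/-- Liouville's theorem for elliptic functions. -/
theorem elliptic_const (hc : 0 < c) {f : ℂ → ℂ} (hp1 : ∀ z, f (z + c) = f z)
    (hp2 : ∀ z, f (z + 2 * Real.pi * I) = f z)
    (hd : ∀ z, ∀ᶠ w in 𝓝[≠] z, DifferentiableAt ℂ f w)
    (hb : ∀ z, f =O[𝓝[≠] z] fun _ => (1 : ℝ)) :
    ∃ C, ∀ z, ContinuousAt f z → f z = C := by
  obtain ⟨hg, hgf⟩ := differentiable_limUnder (U := univ) (fun z _ => hd z) (fun z _ => hb z)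
  set g : ℂ → ℂ := fun z => limUnder (𝓝[≠] z) f with hgdef
  have hg' : Differentiable ℂ g := differentiableOn_univ.mp hg
  -- The periods pass from `f` to its extension `g`: the two agree off a discrete set and `g` is
  -- continuous.
  have hper : ∀ a : ℂ, (∀ z, f (z + a) = f z) → ∀ z, g (z + a) = g z := by
    intro a ha
    have h2 : ∀ z, ∀ᶠ w in 𝓝[≠] z, g (w + a) = g w := by
      intro z
      have : Tendsto (fun w => w + a) (𝓝[≠] z) (𝓝[≠] (z + a)) := by
        refine tendsto_nhdsWithin_iff.mpr ⟨?_, ?_⟩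
        · exact ((continuous_id.add continuous_const).tendsto z).mono_left nhdsWithin_le_nhds
        · filter_upwards [self_mem_nhdsWithin] with w hw
          simpa using hw
      filter_upwards [hd z, this.eventually (hd (z + a))] with w h1 h2
      rw [hgdef]
      simp only
      rw [hgf _ h1.continuousAt, hgf _ h2.continuousAt, ha]
    intro z
    have c1 : Tendsto (fun w => g (w + a)) (𝓝[≠] z) (𝓝 (g (z + a))) :=
      ((hg'.continuous.comp (continuous_id.add continuous_const)).tendsto z).mono_left
        nhdsWithin_le_nhds
    have c2 : Tendsto g (𝓝[≠] z) (𝓝 (g z)) := (hg'.continuous.tendsto z).mono_left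
        nhdsWithin_le_nhds
    exact tendsto_nhds_unique c1 (c2.congr' ((h2 z).mono fun w hw => hw.symm))
  have g1 := hper _ hp1
  have g2 := hper _ hp2
  -- All values of `g` are taken on one compact period rectangle.
  have hbd : Bornology.IsBounded (range g) := by
    have hK : IsCompact (g '' ((fun p : ℝ × ℝ => (p.1 : ℂ) + p.2 * I) ''
        (Icc 0 c ×ˢ Icc 0 (2 * Real.pi)))) :=
      ((isCompact_Icc.prod isCompact_Icc).image (by fun_prop)).image hg'.continuous
    refine hK.isBounded.subset ?_
    rintro _ ⟨z, rfl⟩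
    have e1 : ∀ z : ℂ, ∃ x ∈ Icc 0 c, g (x + z.im * I) = g z := by
      intro z
      have hper : Function.Periodic (fun x : ℝ => g (x + z.im * I)) c := fun x => by
        have := g1 (x + z.im * I)
        simp only [← this]; push_cast; ring_nf
      obtain ⟨x, hx, h⟩ := hper.exists_mem_Ico₀ hc z.re
      exact ⟨x, Ico_subset_Icc_self hx, by simpa using h.symm⟩
    have e2 : ∀ x : ℝ, ∀ y : ℝ, ∃ t ∈ Icc 0 (2 * Real.pi), g (x + t * I) = g (x + y * I) := by
      intro x y
      have hper : Function.Periodic (fun t : ℝ => g (x + t * I)) (2 * Real.pi) := fun t => by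
        have := g2 (x + t * I)
        simp only [← this]; push_cast; ring_nf
      obtain ⟨t, ht, h⟩ := hper.exists_mem_Ico₀ Real.two_pi_pos y
      exact ⟨t, Ico_subset_Icc_self ht, h.symm⟩
    obtain ⟨x, hx, h⟩ := e1 z
    obtain ⟨t, ht, h'⟩ := e2 x z.im
    exact ⟨_, ⟨(x, t), ⟨hx, ht⟩, rfl⟩, by rw [← h, ← h']⟩
  refine ⟨g 0, fun z hz => ?_⟩
  rw [← hgf z hz]
  exact hg'.apply_eq_apply_of_bounded hbd z 0

end lattice

/-! ### The elliptic kernel and its product with its reflection -/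

section kernel

variable {b c : ℝ}

theorem isBigO_div_self {N : ℂ → ℂ} (hN : DifferentiableAt ℂ N 0) (h0 : N 0 = 0) :
    (fun z => N z / z) =O[𝓝[≠] 0] fun _ => (1 : ℝ) := by
  have h : (fun z => N z) =O[𝓝 0] fun z => z := by simpa [h0] using hN.isBigO_sub
  have h2 := (h.mono nhdsWithin_le_nhds : N =O[𝓝[≠] 0] fun z => z).mul
    (isBigO_refl (fun z : ℂ => z⁻¹) (𝓝[≠] 0))
  refine (h2.trans ?_).congr_left fun z => by rw [div_eq_mul_inv]
  refine IsBigO.of_bound 1 ?_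
  filter_upwards [self_mem_nhdsWithin] with z hz
  rw [mul_inv_cancel₀ hz]; simp

theorem isBigO_div_sq {N : ℂ → ℂ} (hN : AnalyticAt ℂ N 0) (h0 : N 0 = 0) (h1 : deriv N 0 = 0) :
    (fun z => N z / z ^ 2) =O[𝓝[≠] 0] fun _ => (1 : ℝ) := by
  have hd : DifferentiableAt ℂ (dslope N 0) 0 := by
    obtain ⟨s, hs, h⟩ := hN.exists_mem_nhds_analyticOnNhd
    exact ((differentiableOn_dslope hs).mpr h.differentiableOn).differentiableAt hs
  refine (isBigO_div_self hd (by simpa using h1)).congr' ?_ EventuallyEq.rfl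
  filter_upwards [self_mem_nhdsWithin] with z hz
  rw [dslope_of_ne _ hz, slope_def_field, h0]
  field_simp
  ring

/-- The second logarithmic derivative of `cylTheta`. -/
noncomputable def thetaLogDeriv₂ (c : ℝ) (z : ℂ) : ℂ :=
  (deriv (deriv (cylTheta c)) z * cylTheta c z - deriv (cylTheta c) z ^ 2) / cylTheta c z ^ 2

/-- The shift in the numerator of the elliptic kernel. -/
noncomputable def kernelShift (b c : ℝ) : ℂ := -(b * c) - c / 2 + Real.pi * I

/-- The meromorphic function with multipliers `-e^{-bc}`, `-1` along the periods `c`, `2πi`, and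
with simple poles of residue one at the origin. -/
noncomputable def ellKernel (b c : ℝ) (z : ℂ) : ℂ :=
  exp (z / 2) * deriv (cylTheta c) 0 * cylTheta c (z + kernelShift b c) /
    (cylTheta c z * cylTheta c (kernelShift b c))

theorem cylTheta_kernelShift_ne (hc : 0 < c) : cylTheta c (kernelShift b c) ≠ 0 := by
  rw [Ne, cylTheta_eq_zero_iff hc]
  refine not_mem_latticePts_of_im ?_ ?_ <;> simp [kernelShift] <;> linarith [Real.pi_pos]

/-- This dictates the shift: the quotient of thetas gains the exponential of `kernelShift` and
e^{z/2} gains e^{c/2}, together −e^{−bc}. -/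
theorem ellKernel_add_period (hc : 0 < c) (z : ℂ) :
    ellKernel b c (z + c) = -Real.exp (-(b * c)) * ellKernel b c z := by
  have e1 : exp ((z + c) / 2) * exp (z + kernelShift b c + c / 2) =
      exp (z / 2) * exp (z + c / 2) * -Real.exp (-(b * c)) := by
    rw [kernelShift, ofReal_exp]
    have : -exp ((-(b * c) : ℝ) : ℂ) = exp (-(b * c) + Real.pi * I) := by
      rw [exp_add, exp_pi_mul_I]; push_cast; ring
    rw [this, ← exp_add, ← exp_add, ← exp_add]
    congr 1
    ring
  have e2 := exp_ne_zero (z + c / 2)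
  rw [ellKernel, ellKernel, add_right_comm, cylTheta_add_period hc, cylTheta_add_period hc]
  rcases eq_or_ne (cylTheta c z) 0 with h0 | h0
  · simp [h0]
  have h1 : cylTheta c (kernelShift b c) ≠ 0 := cylTheta_kernelShift_ne hc
  rw [div_eq_iff (mul_ne_zero (mul_ne_zero (neg_ne_zero.mpr e2) h0) h1)]
  field_simp
  rw [show (2 * (z + kernelShift b c) + c) / 2 = z + kernelShift b c + c / 2 by ring,
    show (z * 2 + (c : ℂ)) / 2 = z + c / 2 by ring]
  linear_combination -(deriv (cylTheta c) 0 * cylTheta c (z + kernelShift b c)) * e1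

theorem ellKernel_add_two_pi_I (z : ℂ) :
    ellKernel b c (z + 2 * Real.pi * I) = -ellKernel b c z := by
  have h1 : exp ((z + 2 * Real.pi * I) / 2) = -exp (z / 2) := by
    rw [show (z + 2 * Real.pi * I) / 2 = z / 2 + Real.pi * I by ring, exp_add, exp_pi_mul_I]
    ring
  rw [ellKernel, ellKernel, add_right_comm, cylTheta_add_two_pi_I, cylTheta_add_two_pi_I, h1]
  rw [mul_neg, neg_mul, neg_mul, neg_mul, neg_neg, div_neg]

/-- The imaginary part π keeps the shift off the lattice and makes it self-conjugate up to the
antiperiod 2πi of θ. The resulting signs cancel in `ellKernel_conj`. -/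
theorem conj_kernelShift :
    starRingEnd ℂ (kernelShift b c) = kernelShift b c - 2 * Real.pi * I := by
  simp only [kernelShift, map_add, map_sub, map_neg, map_mul, map_div₀, conj_ofReal, conj_I,
    map_ofNat]
  ring

theorem cylTheta_sub_two_pi_I (z : ℂ) : cylTheta c (z - 2 * Real.pi * I) = -cylTheta c z := by
  rw [← neg_eq_iff_eq_neg, ← cylTheta_add_two_pi_I, sub_add_cancel]

theorem deriv_cylTheta_conj (hc : 0 < c) (z : ℂ) :
    deriv (cylTheta c) (starRingEnd ℂ z) = starRingEnd ℂ (deriv (cylTheta c) z) := by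
  have h := ((differentiable_cylTheta hc z).hasDerivAt).conj_conj
  have h2 : (starRingEnd ℂ ∘ cylTheta c ∘ starRingEnd ℂ) = cylTheta c := by
    ext w
    simp [cylTheta_conj hc]
  rw [h2] at h
  exact h.deriv

theorem differentiable_deriv_cylTheta (hc : 0 < c) : Differentiable ℂ (deriv (cylTheta c)) :=
  fun z => ((differentiable_cylTheta hc).analyticAt z).deriv.differentiableAt

theorem deriv2_cylTheta_conj (hc : 0 < c) (z : ℂ) :
    deriv (deriv (cylTheta c)) (starRingEnd ℂ z) =
      starRingEnd ℂ (deriv (deriv (cylTheta c)) z) := by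
  have h := ((differentiable_deriv_cylTheta hc z).hasDerivAt).conj_conj
  have h2 : (starRingEnd ℂ ∘ deriv (cylTheta c) ∘ starRingEnd ℂ) = deriv (cylTheta c) := by
    ext w
    simp [deriv_cylTheta_conj hc]
  rw [h2] at h
  exact h.deriv

theorem thetaLogDeriv₂_conj (hc : 0 < c) (z : ℂ) :
    thetaLogDeriv₂ c (starRingEnd ℂ z) = starRingEnd ℂ (thetaLogDeriv₂ c z) := by
  simp [thetaLogDeriv₂, cylTheta_conj hc, deriv_cylTheta_conj hc, deriv2_cylTheta_conj hc]

theorem ellKernel_conj (hc : 0 < c) (z : ℂ) :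
    ellKernel b c (starRingEnd ℂ z) = starRingEnd ℂ (ellKernel b c z) := by
  have h1 : starRingEnd ℂ (cylTheta c (kernelShift b c)) = -cylTheta c (kernelShift b c) := by
    rw [← cylTheta_conj hc, conj_kernelShift, cylTheta_sub_two_pi_I]
  have h2 : starRingEnd ℂ (cylTheta c (z + kernelShift b c)) =
      -cylTheta c (starRingEnd ℂ z + kernelShift b c) := by
    rw [← cylTheta_conj hc, map_add, conj_kernelShift, ← add_sub_assoc, cylTheta_sub_two_pi_I]
  have h3 : starRingEnd ℂ (deriv (cylTheta c) 0) = deriv (cylTheta c) 0 := by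
    rw [← deriv_cylTheta_conj hc, map_zero]
  simp only [ellKernel, map_div₀, map_mul, h1, h2, h3, ← exp_conj, cylTheta_conj hc, map_ofNat]
  rw [mul_neg, mul_neg, neg_div_neg_eq]

theorem differentiableAt_ellKernel (hc : 0 < c) {z : ℂ} (hz : z ∉ latticePts c) :
    DifferentiableAt ℂ (ellKernel b c) z := by
  have h := differentiable_cylTheta hc
  have h1 := mul_ne_zero (mt (cylTheta_eq_zero_iff hc z).mp hz)
    (cylTheta_kernelShift_ne (b := b) hc)
  unfold ellKernel
  fun_prop (disch := assumption)

theorem cylTheta_eq_mul_dslope (z : ℂ) : cylTheta c z = z * dslope (cylTheta c) 0 z := by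
  have := sub_smul_dslope (cylTheta c) 0 z
  simpa [cylTheta_zero] using this.symm

theorem analyticAt_dslope_cylTheta (hc : 0 < c) : AnalyticAt ℂ (dslope (cylTheta c) 0) 0 := by
  have : Differentiable ℂ (dslope (cylTheta c) 0) := by
    rw [← differentiableOn_univ, differentiableOn_dslope univ_mem]
    exact (differentiable_cylTheta hc).differentiableOn
  exact this.analyticAt 0

/-- All cancellations of poles below use only that the numerator is analytic with value 1 at the
origin. -/
theorem ellKernel_eq_div (b : ℝ) (hc : 0 < c) :
    ∃ m : ℂ → ℂ, AnalyticAt ℂ m 0 ∧ m 0 = 1 ∧ ∀ z, ellKernel b c z = m z / z := by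
  have h1 := deriv_cylTheta_zero_ne hc
  have h2 : cylTheta c (kernelShift b c) ≠ 0 := cylTheta_kernelShift_ne hc
  refine ⟨fun z => exp (z / 2) * deriv (cylTheta c) 0 * cylTheta c (z + kernelShift b c) /
    (dslope (cylTheta c) 0 z * cylTheta c (kernelShift b c)), ?_, ?_, ?_⟩
  · have ha : AnalyticAt ℂ (fun z => cylTheta c (z + kernelShift b c)) 0 :=
      Differentiable.analyticAt (by have := differentiable_cylTheta hc; fun_prop) 0
    have hb : AnalyticAt ℂ (fun z : ℂ => exp (z / 2)) 0 :=
      Differentiable.analyticAt (by fun_prop) 0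
    refine ((hb.mul analyticAt_const).mul ha).div
      ((analyticAt_dslope_cylTheta hc).mul analyticAt_const) ?_
    simp [h1, h2]
  · simp [h1, h2]
  · intro z
    rw [ellKernel, cylTheta_eq_mul_dslope z, div_div]
    congr 1
    ring

theorem periodic_latticePts {f : ℂ → ℂ} (hp1 : ∀ z, f (z + c) = f z)
    (hp2 : ∀ z, f (z + 2 * Real.pi * I) = f z) {a : ℂ} (ha : a ∈ latticePts c) (z : ℂ) :
    f (z + a) = f z := by
  obtain ⟨m, n, rfl⟩ := ha
  have h1 : Function.Periodic f (c : ℂ) := hp1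
  have h2 : Function.Periodic f (2 * Real.pi * I) := hp2
  exact ((h1.int_mul m).add_period (h2.int_mul n)) z

theorem isBigO_of_periodic {f : ℂ → ℂ} {a : ℂ} (hp : ∀ z, f (z + a) = f z) {z : ℂ}
    (h : f =O[𝓝[≠] z] fun _ => (1 : ℝ)) : f =O[𝓝[≠] (z + a)] fun _ => (1 : ℝ) := by
  have : Tendsto (fun w => w - a) (𝓝[≠] (z + a)) (𝓝[≠] z) := by
    refine tendsto_nhdsWithin_iff.mpr ⟨?_, ?_⟩
    · have := ((continuous_id.sub (continuous_const (y := a))).tendsto (z + a)).mono_left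
        (nhdsWithin_le_nhds (s := {z + a}ᶜ))
      simpa [Function.comp_def, Pi.sub_def] using this
    · filter_upwards [self_mem_nhdsWithin] with w hw
      simpa [sub_eq_iff_eq_add] using hw
  refine (h.comp_tendsto this).congr_left fun w => ?_
  have := hp (w - a)
  simpa using this.symm

theorem thetaLogDeriv₂_add_period (hc : 0 < c) (z : ℂ) :
    thetaLogDeriv₂ c (z + c) = thetaLogDeriv₂ c z := by
  have hθ := differentiable_cylTheta hc
  have hθ' := differentiable_deriv_cylTheta hc
  have he : ∀ z : ℂ, HasDerivAt (fun z : ℂ => exp (z + c / 2)) (exp (z + c / 2)) z := fun z => by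
    simpa using ((hasDerivAt_id z).add_const (c / 2 : ℂ)).cexp
  have h1 : ∀ z, deriv (cylTheta c) (z + c) =
      -exp (z + c / 2) * (cylTheta c z + deriv (cylTheta c) z) := by
    intro z
    rw [← deriv_comp_add_const, funext (cylTheta_add_period hc)]
    rw [((he z).fun_neg.fun_mul (hθ z).hasDerivAt).deriv]
    ring
  have h2 : ∀ z, deriv (deriv (cylTheta c)) (z + c) = -exp (z + c / 2) *
      (cylTheta c z + 2 * deriv (cylTheta c) z + deriv (deriv (cylTheta c)) z) := by
    intro z
    rw [← deriv_comp_add_const, funext h1]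
    rw [((he z).fun_neg.fun_mul ((hθ z).hasDerivAt.fun_add (hθ' z).hasDerivAt)).deriv]
    ring
  have e := exp_ne_zero (z + c / 2)
  rw [thetaLogDeriv₂, thetaLogDeriv₂, h1, h2, cylTheta_add_period hc]
  rcases eq_or_ne (cylTheta c z) 0 with h0 | h0
  · simp [h0]
  field_simp
  ring

theorem thetaLogDeriv₂_add_two_pi_I (z : ℂ) :
    thetaLogDeriv₂ c (z + 2 * Real.pi * I) = thetaLogDeriv₂ c z := by
  have h1 : ∀ z, deriv (cylTheta c) (z + 2 * Real.pi * I) = -deriv (cylTheta c) z := by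
    intro z
    rw [← deriv_comp_add_const, funext cylTheta_add_two_pi_I, deriv.fun_neg]
  have h2 : ∀ z, deriv (deriv (cylTheta c)) (z + 2 * Real.pi * I) =
      -deriv (deriv (cylTheta c)) z := by
    intro z
    rw [← deriv_comp_add_const, funext h1, deriv.fun_neg]
  rw [thetaLogDeriv₂, thetaLogDeriv₂, h1, h2, cylTheta_add_two_pi_I]
  ring

theorem differentiableAt_thetaLogDeriv₂ (hc : 0 < c) {z : ℂ} (hz : z ∉ latticePts c) :
    DifferentiableAt ℂ (thetaLogDeriv₂ c) z := by
  have h := differentiable_cylTheta hc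
  have h' := differentiable_deriv_cylTheta hc
  have h'' : Differentiable ℂ (deriv (deriv (cylTheta c))) := fun z =>
    (h.analyticAt z).deriv.deriv.differentiableAt
  have h1 := pow_ne_zero 2 (mt (cylTheta_eq_zero_iff hc z).mp hz)
  unfold thetaLogDeriv₂
  fun_prop (disch := assumption)

theorem ellKernel_mul_neg_periodic (hc : 0 < c) (z : ℂ) :
    ellKernel b c (z + c) * ellKernel b c (-(z + c)) = ellKernel b c z * ellKernel b c (-z) := by
  have h := ellKernel_add_period (b := b) hc (-(z + c))
  rw [show -(z + c) + (c : ℂ) = -z by ring] at h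
  rw [ellKernel_add_period hc, h]
  ring

theorem ellKernel_mul_neg_periodic' (z : ℂ) :
    ellKernel b c (z + 2 * Real.pi * I) * ellKernel b c (-(z + 2 * Real.pi * I)) =
      ellKernel b c z * ellKernel b c (-z) := by
  have h := ellKernel_add_two_pi_I (b := b) (c := c) (-(z + 2 * Real.pi * I))
  rw [show -(z + 2 * Real.pi * I) + 2 * Real.pi * I = -z by ring] at h
  rw [ellKernel_add_two_pi_I, h]
  ring

/-- With θ(z) = z s(z) and s(0) ≠ 0, the second logarithmic derivative is −1/z² plus that of s,
which is analytic at 0. -/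
theorem thetaLogDeriv₂_near_zero (hc : 0 < c) :
    (fun z => thetaLogDeriv₂ c z + 1 / z ^ 2) =O[𝓝[≠] 0] fun _ => (1 : ℝ) := by
  set s := dslope (cylTheta c) 0 with hs
  have hsa := analyticAt_dslope_cylTheta hc
  have hs0 : s 0 ≠ 0 := by simpa [hs] using deriv_cylTheta_zero_ne hc
  have hsd : Differentiable ℂ s := by
    rw [← differentiableOn_univ, hs, differentiableOn_dslope univ_mem]
    exact (differentiable_cylTheta hc).differentiableOn
  have hsd' : Differentiable ℂ (deriv s) := fun z => (hsd.analyticAt z).deriv.differentiableAt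
  have hsd'' : Differentiable ℂ (deriv (deriv s)) := fun z =>
    (hsd.analyticAt z).deriv.deriv.differentiableAt
  have e0 : cylTheta c = fun z => z * s z := funext cylTheta_eq_mul_dslope
  have e1 : deriv (cylTheta c) = fun z => s z + z * deriv s z := by
    ext z
    rw [e0, ((hasDerivAt_id' z).fun_mul (hsd z).hasDerivAt).deriv]
    ring
  have e2 : deriv (deriv (cylTheta c)) = fun z => 2 * deriv s z + z * deriv (deriv s) z := by
    ext z
    rw [e1, ((hsd z).hasDerivAt.fun_add ((hasDerivAt_id' z).fun_mul (hsd' z).hasDerivAt)).deriv]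
    ring
  have hb : (fun z => (deriv (deriv s) z * s z - deriv s z ^ 2) / s z ^ 2) =O[𝓝[≠] 0]
      fun _ => (1 : ℝ) := by
    have hc' : ContinuousAt (fun z => (deriv (deriv s) z * s z - deriv s z ^ 2) / s z ^ 2) 0 := by
      refine ContinuousAt.div ?_ ?_ (pow_ne_zero 2 hs0)
      · have := hsd.continuous; have := hsd'.continuous; have := hsd''.continuous
        fun_prop
      · have := hsd.continuous
        fun_prop
    exact (hc'.tendsto.isBigO_one ℝ).mono nhdsWithin_le_nhds
  refine hb.congr' ?_ EventuallyEq.rfl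
  have hs1 : ∀ᶠ z in 𝓝[≠] (0 : ℂ), s z ≠ 0 :=
    nhdsWithin_le_nhds (hsd.continuous.continuousAt.eventually_ne hs0)
  filter_upwards [self_mem_nhdsWithin, hs1] with z hz hsz
  have hz : z ≠ 0 := hz
  rw [thetaLogDeriv₂, e2, e1, e0]
  field_simp
  ring

/-- The multipliers at z and −z are reciprocal, so the product is elliptic. Being even, it has
principal part exactly −1/z² at 0, the same as `thetaLogDeriv₂`; the difference is therefore
constant. Comparing the values at πi and −πi, which are conjugate, shows that the constant is real.
-/
theorem ellKernel_mul_neg (b : ℝ) (hc : 0 < c) :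
    ∃ e : ℝ, ∀ z ∉ latticePts c,
      ellKernel b c z * ellKernel b c (-z) = thetaLogDeriv₂ c z + e := by
  set f : ℂ → ℂ := fun z => ellKernel b c z * ellKernel b c (-z) - thetaLogDeriv₂ c z with hf
  have hd : ∀ z ∉ latticePts c, DifferentiableAt ℂ f z := by
    intro z hz
    have h1 := differentiableAt_ellKernel (b := b) hc hz
    have h2 : DifferentiableAt ℂ (fun z => ellKernel b c (-z)) z :=
      (differentiableAt_ellKernel (b := b) hc (mt neg_mem_latticePts.mp hz)).comp z
        differentiableAt_id.neg
    exact (h1.mul h2).sub (differentiableAt_thetaLogDeriv₂ hc hz)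
  have hp1 : ∀ z, f (z + c) = f z := fun z => by
    simp only [hf, ellKernel_mul_neg_periodic hc, thetaLogDeriv₂_add_period hc]
  have hp2 : ∀ z, f (z + 2 * Real.pi * I) = f z := fun z => by
    simp only [hf, ellKernel_mul_neg_periodic', thetaLogDeriv₂_add_two_pi_I]
  have h0 : f =O[𝓝[≠] 0] fun _ => (1 : ℝ) := by
    obtain ⟨m, hm, hm0, hk⟩ := ellKernel_eq_div b hc
    have hmn : AnalyticAt ℂ (fun z => m (-z)) 0 := by
      have : AnalyticAt ℂ m (-(0 : ℂ)) := by simpa using hm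
      exact this.comp_of_eq (analyticAt_id.neg) rfl
    have hN : AnalyticAt ℂ (fun z => 1 - m z * m (-z)) 0 := analyticAt_const.sub (hm.mul hmn)
    have hN' : deriv (fun z => 1 - m z * m (-z)) 0 = 0 := by
      have e1 : HasDerivAt (fun z => m (-z)) (-deriv m 0) 0 := by
        have : HasDerivAt m (deriv m 0) (-(0 : ℂ)) := by
          simpa using hm.differentiableAt.hasDerivAt
        simpa [Function.comp_def] using this.comp (0 : ℂ) (hasDerivAt_neg (0 : ℂ))
      have := ((hm.differentiableAt.hasDerivAt.mul e1).const_sub 1).deriv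
      rw [show (fun z => 1 - m z * m (-z)) = fun z => 1 - (m * fun z => m (-z)) z from rfl, this]
      simp [hm0]
    have := (isBigO_div_sq hN (by simp [hm0]) hN').sub (thetaLogDeriv₂_near_zero hc)
    refine this.congr' ?_ EventuallyEq.rfl
    filter_upwards [self_mem_nhdsWithin] with z hz
    have hz : z ≠ 0 := hz
    simp only [hf, hk]
    field_simp
    ring
  obtain ⟨C, hC⟩ := elliptic_const hc hp1 hp2
    (fun z => (not_mem_latticePts_eventually hc z).mono fun w hw => hd w hw) (fun z => by
      by_cases hz : z ∈ latticePts c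
      · simpa using isBigO_of_periodic (periodic_latticePts hp1 hp2 hz) h0
      · exact ((hd z hz).continuousAt.tendsto.isBigO_one ℝ).mono nhdsWithin_le_nhds)
  have hC' : ∀ z ∉ latticePts c, f z = C := fun z hz => hC z (hd z hz).continuousAt
  have hpi : (Real.pi * I : ℂ) ∉ latticePts c := by
    refine not_mem_latticePts_of_im ?_ ?_ <;> simp <;> linarith [Real.pi_pos]
  have hreal : starRingEnd ℂ C = C := by
    have hconj : ∀ z, f (starRingEnd ℂ z) = starRingEnd ℂ (f z) := fun z => by
      simp only [hf, map_sub, map_mul, ← map_neg, ellKernel_conj hc, thetaLogDeriv₂_conj hc]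
    have h2 := hC' _ (mt neg_mem_latticePts.mp hpi)
    rw [show -(Real.pi * I : ℂ) = starRingEnd ℂ (Real.pi * I) by simp, hconj, hC' _ hpi] at h2
    exact h2
  refine ⟨C.re, fun z hz => ?_⟩
  rw [conj_eq_iff_re.mp hreal, ← hC' z hz]
  simp [hf]

end kernel

/-! ### The cyclic product of three kernels is constant -/

section triple

variable {b c : ℝ}

/-- The symmetrized cyclic product of three kernels. -/
noncomputable def kernelTriple (b c : ℝ) (x y : ℂ) : ℂ :=
  ellKernel b c x * ellKernel b c y * ellKernel b c (-x - y) +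
    ellKernel b c (-x) * ellKernel b c (-y) * ellKernel b c (x + y)

theorem kernelTriple_comm (x y : ℂ) : kernelTriple b c x y = kernelTriple b c y x := by
  rw [kernelTriple, kernelTriple, show -y - x = -x - y by ring, add_comm y x]
  ring

/-- The expression is symmetric in the three numbers x, y, −x−y of sum zero. This carries the
singularity at x = −y to the one at x = 0. -/
theorem kernelTriple_rotate (x y : ℂ) : kernelTriple b c (-x - y) y = kernelTriple b c x y := by
  rw [kernelTriple, kernelTriple, show -(-x - y) - y = x by ring, show -(-x - y) = x + y by ring,
    show -x - y + y = -x by ring]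
  ring

theorem ellKernel_neg_add_period (hc : 0 < c) (z : ℂ) :
    ellKernel b c (-z - c) = -Real.exp (b * c) * ellKernel b c (-z) := by
  have h := ellKernel_add_period (b := b) hc (-z - c)
  rw [sub_add_cancel] at h
  rw [h, Real.exp_neg]
  have := Real.exp_ne_zero (b * c)
  push_cast
  field_simp

theorem ellKernel_sub_two_pi_I (z : ℂ) :
    ellKernel b c (z - 2 * Real.pi * I) = -ellKernel b c z := by
  rw [← neg_eq_iff_eq_neg, ← ellKernel_add_two_pi_I, sub_add_cancel]

theorem kernelTriple_add_period (hc : 0 < c) (x y : ℂ) :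
    kernelTriple b c (x + c) y = kernelTriple b c x y := by
  rw [kernelTriple, kernelTriple, show -(x + c) - y = -(x + y) - c by ring,
    show -(x + c) = -x - c by ring, show x + c + y = x + y + c by ring,
    ellKernel_add_period hc, ellKernel_add_period hc, ellKernel_neg_add_period hc,
    ellKernel_neg_add_period hc, Real.exp_neg, show -(x + y) = -x - y by ring]
  have := Real.exp_ne_zero (b * c)
  push_cast
  field_simp

theorem kernelTriple_add_two_pi_I (x y : ℂ) :
    kernelTriple b c (x + 2 * Real.pi * I) y = kernelTriple b c x y := by
  rw [kernelTriple, kernelTriple, show -(x + 2 * Real.pi * I) - y = -x - y - 2 * Real.pi * I by ring,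
    show -(x + 2 * Real.pi * I) = -x - 2 * Real.pi * I by ring,
    show x + 2 * Real.pi * I + y = x + y + 2 * Real.pi * I by ring,
    ellKernel_add_two_pi_I, ellKernel_add_two_pi_I, ellKernel_sub_two_pi_I,
    ellKernel_sub_two_pi_I]
  ring

theorem differentiableAt_kernelTriple (hc : 0 < c) {x y : ℂ} (hx : x ∉ latticePts c)
    (hxy : x + y ∉ latticePts c) : DifferentiableAt ℂ (fun x => kernelTriple b c x y) x := by
  have h1 := differentiableAt_ellKernel (b := b) hc hx
  have h2 : DifferentiableAt ℂ (fun x => ellKernel b c (-x)) x :=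
    (differentiableAt_ellKernel hc (mt neg_mem_latticePts.mp hx)).comp x differentiableAt_id.neg
  have h3 : DifferentiableAt ℂ (fun x => ellKernel b c (x + y)) x :=
    (differentiableAt_ellKernel hc hxy).comp x (differentiableAt_id.add_const y)
  have h4 : DifferentiableAt ℂ (fun x => ellKernel b c (-x - y)) x := by
    refine (differentiableAt_ellKernel hc ?_).comp x (differentiableAt_id.neg.sub_const y)
    rw [show -x - y = -(x + y) by ring]
    exact mt neg_mem_latticePts.mp hxy
  unfold kernelTriple
  fun_prop

/-- The residues of the two summands at x = 0 are K(y)K(−y) and −K(−y)K(y), so the poles cancel. -/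
theorem kernelTriple_isBigO_zero (hc : 0 < c) {y : ℂ} (hy : y ∉ latticePts c) :
    (fun x => kernelTriple b c x y) =O[𝓝[≠] 0] fun _ => (1 : ℝ) := by
  obtain ⟨m, hm, hm0, hk⟩ := ellKernel_eq_div b hc
  have hmn : DifferentiableAt ℂ (fun z => m (-z)) 0 := by
    have : DifferentiableAt ℂ m (-(0 : ℂ)) := by simpa using hm.differentiableAt
    exact this.comp (0 : ℂ) differentiableAt_id.neg
  have h3 : DifferentiableAt ℂ (fun x => ellKernel b c (x + y)) 0 :=
    (differentiableAt_ellKernel hc (by simpa using hy)).comp (0 : ℂ)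
      (differentiableAt_id.add_const y)
  have h4 : DifferentiableAt ℂ (fun x => ellKernel b c (-x - y)) 0 := by
    refine (differentiableAt_ellKernel hc ?_).comp (0 : ℂ) (differentiableAt_id.neg.sub_const y)
    simpa using mt neg_mem_latticePts.mp hy
  have := isBigO_div_self (N := fun x => m x * ellKernel b c y * ellKernel b c (-x - y) -
    m (-x) * ellKernel b c (-y) * ellKernel b c (x + y))
    (((hm.differentiableAt.mul_const _).mul h4).sub ((hmn.mul_const _).mul h3))
    (by simp [hm0]; ring)
  refine this.congr_left fun x => ?_
  rw [kernelTriple, hk x, hk (-x)]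
  ring

theorem exists_kernelTriple_eq_of_right (hc : 0 < c) {y : ℂ} (hy : y ∉ latticePts c) :
    ∃ C, ∀ x ∉ latticePts c, x + y ∉ latticePts c → kernelTriple b c x y = C := by
  have hd : ∀ x, x ∉ latticePts c → x + y ∉ latticePts c →
      DifferentiableAt ℂ (fun x => kernelTriple b c x y) x := fun x h1 h2 =>
    differentiableAt_kernelTriple hc h1 h2
  have hp1 := fun x => kernelTriple_add_period (b := b) hc x y
  have hp2 := fun x => kernelTriple_add_two_pi_I (b := b) (c := c) x y
  have h0 := kernelTriple_isBigO_zero (b := b) hc hy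
  have h1 : (fun x => kernelTriple b c x y) =O[𝓝[≠] (-y)] fun _ => (1 : ℝ) := by
    have ht : Tendsto (fun x => -x - y) (𝓝[≠] (-y)) (𝓝[≠] 0) := by
      refine tendsto_nhdsWithin_iff.mpr ⟨?_, ?_⟩
      · have h : Continuous fun x : ℂ => -x - y := by fun_prop
        have := (h.tendsto (-y)).mono_left (nhdsWithin_le_nhds (s := {-y}ᶜ))
        simpa using this
      · filter_upwards [self_mem_nhdsWithin] with w hw h
        refine hw ?_
        simp only [mem_singleton_iff] at h ⊢
        linear_combination -h
    exact (h0.comp_tendsto ht).congr_left fun x => kernelTriple_rotate x y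
  obtain ⟨C, hC⟩ := elliptic_const hc hp1 hp2 (fun z => by
      have ht : Tendsto (fun x => x + y) (𝓝[≠] z) (𝓝[≠] (z + y)) := by
        refine tendsto_nhdsWithin_iff.mpr ⟨?_, ?_⟩
        · exact ((continuous_id.add continuous_const).tendsto z).mono_left nhdsWithin_le_nhds
        · filter_upwards [self_mem_nhdsWithin] with w hw
          simpa using hw
      filter_upwards [not_mem_latticePts_eventually hc z,
        ht.eventually (not_mem_latticePts_eventually hc (z + y))] with w h1 h2
      exact hd w h1 h2) (fun z => by
      by_cases hz : z ∈ latticePts c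
      · simpa using isBigO_of_periodic (periodic_latticePts hp1 hp2 hz) h0
      by_cases hz' : z + y ∈ latticePts c
      · simpa using isBigO_of_periodic (periodic_latticePts hp1 hp2 hz') h1
      · exact ((hd z hz hz').continuousAt.tendsto.isBigO_one ℝ).mono nhdsWithin_le_nhds)
  exact ⟨C, fun x h1 h2 => hC x (hd x h1 h2).continuousAt⟩

/-- For fixed y the expression is elliptic in x without poles; its symmetry in x and y then removes
the dependence on y. -/
theorem exists_kernelTriple_eq (b : ℝ) (hc : 0 < c) :
    ∃ τ : ℝ, ∀ x y : ℂ, x ∉ latticePts c → y ∉ latticePts c → x + y ∉ latticePts c →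
      kernelTriple b c x y = τ := by
  have key : ∀ y : {y // y ∉ latticePts c}, ∃ C, ∀ x ∉ latticePts c,
      x + y.1 ∉ latticePts c → kernelTriple b c x y = C := fun y =>
    exists_kernelTriple_eq_of_right hc y.2
  choose C hC using key
  have hCC : ∀ y y', C y = C y' := by
    intro y y'
    -- A point x near 0 for which x, x + y and x + y' all avoid the lattice links the constants of y
    -- and y'.
    have ht : ∀ a : ℂ, Tendsto (fun x => x + a) (𝓝[≠] 0) (𝓝[≠] (0 + a)) := fun a => by
      refine tendsto_nhdsWithin_iff.mpr ⟨?_, ?_⟩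
      · exact ((continuous_id.add continuous_const).tendsto 0).mono_left nhdsWithin_le_nhds
      · filter_upwards [self_mem_nhdsWithin] with w hw
        simpa using hw
    have h3 := ((not_mem_latticePts_eventually hc 0).and
      (((ht y).eventually (not_mem_latticePts_eventually hc (0 + y))).and
      ((ht y').eventually (not_mem_latticePts_eventually hc (0 + y'))))).exists
    obtain ⟨x, hx, hy, hy'⟩ := h3
    rw [← hC y x hx hy, ← hC y' x hx hy', kernelTriple_comm x, kernelTriple_comm x,
      hC ⟨x, hx⟩ y y.2 (by rwa [add_comm]), hC ⟨x, hx⟩ y' y'.2 (by rwa [add_comm])]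
  -- The point x = y = πi/2 is admissible, because x + y = πi also lies between two rows of the
  -- lattice. So is its conjugate, and this forces the constant to be real.
  have hpi : (Real.pi / 2 * I : ℂ) ∉ latticePts c := by
    refine not_mem_latticePts_of_im ?_ ?_ <;> simp <;> linarith [Real.pi_pos]
  have hpi2 : (Real.pi / 2 * I + Real.pi / 2 * I: ℂ) ∉ latticePts c := by
    refine not_mem_latticePts_of_im ?_ ?_ <;> simp <;> linarith [Real.pi_pos]
  set p : ℂ := Real.pi / 2 * I with hp
  have hCx : ∀ x y : ℂ, x ∉ latticePts c → y ∉ latticePts c → x + y ∉ latticePts c →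
      kernelTriple b c x y = C ⟨p, hpi⟩ := fun x y hx hy hxy => by
    rw [hC ⟨y, hy⟩ x hx hxy, hCC]
  have hreal : starRingEnd ℂ (C ⟨p, hpi⟩) = C ⟨p, hpi⟩ := by
    have h1 := hCx p p hpi hpi hpi2
    have h2 := hCx (-p) (-p) (mt neg_mem_latticePts.mp hpi) (mt neg_mem_latticePts.mp hpi)
      (by rw [← neg_add]; exact mt neg_mem_latticePts.mp hpi2)
    have h3 : starRingEnd ℂ p = -p := by
      rw [hp]
      simp only [map_mul, map_div₀, conj_ofReal, conj_I, map_ofNat]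
      ring
    have h4 : starRingEnd ℂ (kernelTriple b c p p) = kernelTriple b c (-p) (-p) := by
      rw [← h3]
      simp only [kernelTriple, map_add, map_mul, ← ellKernel_conj hc, map_neg, map_sub]
    rw [h1, h2] at h4
    exact h4
  refine ⟨(C ⟨p, hpi⟩).re, fun x y hx hy hxy => ?_⟩
  rw [conj_eq_iff_re.mp hreal, hCx x y hx hy hxy]

end triple

/-! ### Laurent expansions in horizontal strips -/

/-- The horizontal strip `a < Im z < d`. -/
def hStrip (a d : ℝ) : Set ℂ := {z | a < z.im ∧ z.im < d}

theorem isOpen_hStrip (a d : ℝ) : IsOpen (hStrip a d) :=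
  (isOpen_lt continuous_const continuous_im).inter (isOpen_lt continuous_im continuous_const)

/-- The exponential `z ↦ exp (2 π i n z / c)`. -/
noncomputable def cexpMode (c : ℝ) (n : ℤ) (z : ℂ) : ℂ := exp (2 * Real.pi * I * n * z / c)

section laurent

variable {c : ℝ}

theorem norm_cexpMode (n : ℤ) (z : ℂ) :
    ‖cexpMode c n z‖ = Real.exp (-(2 * Real.pi * n * z.im / c)) := by
  rw [cexpMode, norm_exp]
  congr 1
  rw [show 2 * Real.pi * I * n * z / c = ((2 * Real.pi * n / c : ℝ) : ℂ) * (I * z) by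
    push_cast; ring, re_ofReal_mul]
  simp
  ring

theorem cexpMode_add_period (hc : 0 < c) (n : ℤ) (z : ℂ) :
    cexpMode c n (z + c) = cexpMode c n z := by
  have : (c : ℂ) ≠ 0 := by exact_mod_cast hc.ne'
  rw [cexpMode, cexpMode, exp_eq_exp_iff_exists_int]
  exact ⟨n, by field_simp⟩

theorem differentiable_cexpMode (n : ℤ) : Differentiable ℂ (cexpMode c n) := by
  unfold cexpMode
  fun_prop

theorem cexpMode_conj (n : ℤ) (z : ℂ) :
    starRingEnd ℂ (cexpMode c n z) = cexpMode c (-n) (starRingEnd ℂ z) := by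
  simp only [cexpMode, ← exp_conj, map_div₀, map_mul, map_ofNat, conj_ofReal, conj_I, map_intCast,
    Int.cast_neg]
  ring_nf

/-- The growth condition on the coefficients of a Laurent series that converges in
`a < Im z < d`. -/
def StripBound (c : ℝ) (A : ℤ → ℂ) (a d : ℝ) : Prop :=
  ∀ y, a < y → y < d → ∃ M, ∀ n : ℤ, ‖A n‖ ≤ M * Real.exp (2 * Real.pi * n * y / c)

theorem summable_exp_abs {r : ℝ} (hr : 0 < r) : Summable fun n : ℤ => Real.exp (-(|(n : ℝ)| * r)) := by
  have h : Summable fun n : ℕ => Real.exp (-((n : ℝ) * r)) := by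
    have : (fun n : ℕ => Real.exp (-((n : ℝ) * r))) = fun n : ℕ => Real.exp (-r) ^ n := by
      ext n
      rw [← Real.exp_nat_mul]
      ring_nf
    rw [this]
    exact summable_geometric_of_lt_one (Real.exp_pos _).le (by simpa using hr)
  exact Summable.of_nat_of_neg (by simpa using h) (by simpa using h)

/-- Take the bound on the coefficients at a height below y₁ for n ≥ 0 and at one above y₂ for n ≤ 0;
the gap in height gives geometric decay. -/
theorem StripBound.exists_summable {A : ℤ → ℂ} {a d : ℝ} (hc : 0 < c) (hA : StripBound c A a d)
    {y₁ y₂ : ℝ} (h1 : a < y₁) (h12 : y₁ ≤ y₂) (h2 : y₂ < d) :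
    ∃ u : ℤ → ℝ, Summable u ∧ ∀ n z, y₁ ≤ z.im → z.im ≤ y₂ → ‖A n * cexpMode c n z‖ ≤ u n := by
  obtain ⟨M₁, hM₁⟩ := hA ((a + y₁) / 2) (by linarith) (by linarith)
  obtain ⟨M₂, hM₂⟩ := hA ((d + y₂) / 2) (by linarith) (by linarith)
  have hp := Real.pi_pos
  have hM₁0 : 0 ≤ M₁ := by simpa using (norm_nonneg _).trans (hM₁ 0)
  have hM₂0 : 0 ≤ M₂ := by simpa using (norm_nonneg _).trans (hM₂ 0)
  refine ⟨fun n => M₁ * Real.exp (-(|(n : ℝ)| * (Real.pi * (y₁ - a) / c))) +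
    M₂ * Real.exp (-(|(n : ℝ)| * (Real.pi * (d - y₂) / c))), ?_, ?_⟩
  · refine ((summable_exp_abs ?_).mul_left _).add ((summable_exp_abs ?_).mul_left _)
    · have : 0 < y₁ - a := by linarith
      positivity
    · have : 0 < d - y₂ := by linarith
      positivity
  intro n z hz1 hz2
  rw [norm_mul, norm_cexpMode]
  rcases le_total 0 n with hn | hn
  · have hn' : (0 : ℝ) ≤ n := by exact_mod_cast hn
    have : ‖A n‖ * Real.exp (-(2 * Real.pi * n * z.im / c)) ≤
        M₁ * Real.exp (-(|(n : ℝ)| * (Real.pi * (y₁ - a) / c))) := by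
      refine (mul_le_mul_of_nonneg_right (hM₁ n) (Real.exp_pos _).le).trans ?_
      rw [mul_assoc, ← Real.exp_add, abs_of_nonneg hn']
      refine mul_le_mul_of_nonneg_left (Real.exp_le_exp.mpr ?_) hM₁0
      rw [← sub_nonneg]
      have : 0 ≤ n * Real.pi * (2 * (z.im - y₁)) / c := by
        have : 0 ≤ z.im - y₁ := by linarith
        positivity
      convert this using 1
      field_simp
      ring
    have h' : 0 ≤ M₂ * Real.exp (-(|(n : ℝ)| * (Real.pi * (d - y₂) / c))) := by positivity
    linarith
  · have hn' : (0 : ℝ) ≤ -n := by exact_mod_cast (neg_nonneg.mpr hn)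
    have : ‖A n‖ * Real.exp (-(2 * Real.pi * n * z.im / c)) ≤
        M₂ * Real.exp (-(|(n : ℝ)| * (Real.pi * (d - y₂) / c))) := by
      refine (mul_le_mul_of_nonneg_right (hM₂ n) (Real.exp_pos _).le).trans ?_
      rw [mul_assoc, ← Real.exp_add, abs_of_nonpos (by linarith)]
      refine mul_le_mul_of_nonneg_left (Real.exp_le_exp.mpr ?_) hM₂0
      rw [← sub_nonneg]
      have : 0 ≤ (-n) * Real.pi * (2 * (y₂ - z.im)) / c := by
        have : 0 ≤ y₂ - z.im := by linarith
        positivity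
      convert this using 1
      field_simp
      ring
    have h' : 0 ≤ M₁ * Real.exp (-(|(n : ℝ)| * (Real.pi * (y₁ - a) / c))) := by positivity
    linarith

theorem StripBound.summable {A : ℤ → ℂ} {a d : ℝ} (hc : 0 < c) (hA : StripBound c A a d) {z : ℂ}
    (hz : z ∈ hStrip a d) : Summable fun n => A n * cexpMode c n z := by
  obtain ⟨u, hu, h⟩ := hA.exists_summable hc hz.1 le_rfl hz.2
  exact Summable.of_norm_bounded hu fun n => h n z le_rfl le_rfl

theorem StripBound.differentiableOn {A : ℤ → ℂ} {a d : ℝ} (hc : 0 < c) (hA : StripBound c A a d) :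
    DifferentiableOn ℂ (fun z => ∑' n, A n * cexpMode c n z) (hStrip a d) := by
  intro z hz
  have h1 := hz.1
  have h2 := hz.2
  obtain ⟨u, hu, h⟩ := hA.exists_summable hc (y₁ := (a + z.im) / 2) (y₂ := (d + z.im) / 2)
    (by linarith) (by linarith) (by linarith)
  have := differentiableOn_tsum_of_summable_norm hu (F := fun n z => A n * cexpMode c n z)
    (U := hStrip ((a + z.im) / 2) ((d + z.im) / 2))
    (fun n => ((differentiable_cexpMode n).const_mul _).differentiableOn) (isOpen_hStrip _ _)
    (fun n w hw => h n w hw.1.le hw.2.le)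
  exact (this.differentiableAt ((isOpen_hStrip _ _).mem_nhds
    ⟨by linarith, by linarith⟩)).differentiableWithinAt

/-- The Laurent coefficients of a periodic function, computed at height `y`. -/
noncomputable def stripCoeff (c : ℝ) (h : ℂ → ℂ) (y : ℝ) (n : ℤ) : ℂ :=
  (1 / c : ℂ) * ∫ x in (0 : ℝ)..c, h (x + y * I) * cexpMode c (-n) (x + y * I)

/-- Cauchy's theorem on a rectangle of width c, whose vertical sides cancel by periodicity. -/
theorem stripCoeff_eq {a d : ℝ} (hc : 0 < c) {h : ℂ → ℂ} (hd : DifferentiableOn ℂ h (hStrip a d))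
    (hp : ∀ z ∈ hStrip a d, h (z + c) = h z) (n : ℤ) {y₁ y₂ : ℝ} (h1 : y₁ ∈ Ioo a d)
    (h2 : y₂ ∈ Ioo a d) : stripCoeff c h y₁ n = stripCoeff c h y₂ n := by
  have hcon := Complex.integral_boundary_rect_eq_zero_of_differentiableOn
    (fun z => h z * cexpMode c (-n) z) (y₁ * I) (c + y₂ * I) ?_
  · have hr : ∀ y : ℝ, y ∈ uIcc y₁ y₂ →
        h (c + y * I) * cexpMode c (-n) (c + y * I) =
          h (0 + y * I) * cexpMode c (-n) (0 + y * I) := by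
      intro y hy
      have hy' : y ∈ Ioo a d := (ordConnected_Ioo.uIcc_subset h1 h2) hy
      rw [add_comm (c : ℂ), cexpMode_add_period hc, hp _ (by simpa [hStrip] using hy'), zero_add]
    have hI : ∫ y in y₁..y₂, h (c + y * I) * cexpMode c (-n) (c + y * I) =
        ∫ y in y₁..y₂, h (0 + y * I) * cexpMode c (-n) (0 + y * I) :=
      intervalIntegral.integral_congr fun y hy => hr y hy
    simp at hcon hI
    rw [hI] at hcon
    rw [stripCoeff, stripCoeff]
    congr 1
    linear_combination hcon
  · intro z hz
    have hz2 : z.im ∈ uIcc y₁ y₂ := by simpa using hz.2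
    have hz' : z ∈ hStrip a d := (ordConnected_Ioo.uIcc_subset h1 h2) hz2
    exact ((hd.differentiableAt ((isOpen_hStrip a d).mem_nhds hz')).mul
      (differentiable_cexpMode _ z)).differentiableWithinAt

theorem continuous_line {a d : ℝ} {h : ℂ → ℂ} (hd : ContinuousOn h (hStrip a d)) {y : ℝ}
    (hy : y ∈ Ioo a d) : Continuous fun x : ℝ => h (x + y * I) :=
  hd.comp_continuous (by fun_prop) fun x => by simpa [hStrip] using hy

theorem exists_norm_line_le (hc : 0 < c) {g : ℝ → ℂ} (hg : Continuous g)
    (hp : ∀ x, g (x + c) = g x) : ∃ M, ∀ x, ‖g x‖ ≤ M := by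
  obtain ⟨M, hM⟩ := (isCompact_Icc (a := (0 : ℝ)) (b := c)).exists_bound_of_continuousOn
    hg.continuousOn
  refine ⟨M, fun x => ?_⟩
  obtain ⟨y, hy, h⟩ := (show Function.Periodic g c from hp).exists_mem_Ico₀ hc x
  rw [h]
  exact hM y (Ico_subset_Icc_self hy)

theorem norm_stripCoeff_le (hc : 0 < c) {h : ℂ → ℂ} {y M : ℝ}
    (hM : ∀ x : ℝ, ‖h (x + y * I)‖ ≤ M) (n : ℤ) :
    ‖stripCoeff c h y n‖ ≤ M * Real.exp (2 * Real.pi * n * y / c) := by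
  have h1 : ‖∫ x in (0 : ℝ)..c, h (x + y * I) * cexpMode c (-n) (x + y * I)‖ ≤
      M * Real.exp (2 * Real.pi * n * y / c) * |c - 0| := by
    refine intervalIntegral.norm_integral_le_of_norm_le_const fun x _ => ?_
    rw [norm_mul, norm_cexpMode]
    refine (mul_le_mul_of_nonneg_right (hM x) (Real.exp_pos _).le).trans (le_of_eq ?_)
    congr 2
    simp
    ring
  rw [stripCoeff, norm_mul]
  have h2 : ‖(1 / c : ℂ)‖ = 1 / c := by simp [abs_of_pos hc]
  rw [h2, sub_zero, abs_of_pos hc] at *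
  calc 1 / c * _ ≤ 1 / c * (M * Real.exp (2 * Real.pi * n * y / c) * c) := by gcongr
    _ = _ := by field_simp

theorem hasSum_stripCoeff (hc : 0 < c) {h : ℂ → ℂ} {y : ℝ}
    (hcont : Continuous fun x : ℝ => h (x + y * I)) (hp : ∀ x : ℝ, h (x + y * I + c) = h (x + y * I))
    (hs : Summable fun n => ‖stripCoeff c h y n‖ * Real.exp (-(2 * Real.pi * n * y / c))) (x : ℝ) :
    HasSum (fun n => stripCoeff c h y n * cexpMode c n (x + y * I)) (h (x + y * I)) := by
  have : Fact (0 < c) := ⟨hc⟩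
  have hper : Function.Periodic (fun x : ℝ => h (x + y * I)) c := fun x => by
    simp only [← hp x]
    push_cast
    ring_nf
  let g : C(AddCircle c, ℂ) := ⟨hper.lift, continuous_coinduced_dom.mpr hcont⟩
  have hcne : (c : ℂ) ≠ 0 := by exact_mod_cast hc.ne'
  have hmode : ∀ (n : ℤ) (x : ℝ), exp (2 * Real.pi * I * n * x / c) =
      cexpMode c n (x + y * I) * exp (2 * Real.pi * n * y / c) := by
    intro n x
    rw [cexpMode, ← exp_add]
    congr 1
    field_simp
    ring_nf
    rw [I_sq]
    ring
  have hcoef : ∀ n, fourierCoeff g n = stripCoeff c h y n * exp (-(2 * Real.pi * n * y / c)) := by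
    intro n
    rw [fourierCoeff_eq_intervalIntegral g n 0, zero_add, stripCoeff, mul_assoc,
      ← intervalIntegral.integral_mul_const, Complex.real_smul]
    push_cast
    congr 1
    refine intervalIntegral.integral_congr fun x _ => ?_
    simp only [fourier_coe_apply, smul_eq_mul]
    rw [show g (x : AddCircle c) = h (x + y * I) from rfl, hmode]
    push_cast
    rw [show (2 * Real.pi * -n * y / c : ℂ) = -(2 * Real.pi * n * y / c) by ring]
    ring
  have hsum : Summable (fourierCoeff g) := by
    refine Summable.of_norm (hs.congr fun n => ?_)
    rw [hcoef, norm_mul, norm_exp]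
    congr 2
    have : -(2 * Real.pi * n * y / c : ℂ) = ((-(2 * Real.pi * n * y / c) : ℝ) : ℂ) := by
      push_cast; ring
    rw [this, ofReal_re]
  have := has_pointwise_sum_fourier_series_of_summable hsum (x : AddCircle c)
  have e : (fun n => stripCoeff c h y n * cexpMode c n (x + y * I)) =
      fun n => fourierCoeff g n • fourier n (x : AddCircle c) := by
    ext n
    rw [hcoef, smul_eq_mul, fourier_coe_apply, hmode, exp_neg]
    have := exp_ne_zero (2 * Real.pi * n * y / c : ℂ)
    field_simp
  rw [e]
  exact this

/-- Since the coefficients do not depend on the height, the maximum of |h| on any line bounds them,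
and the bounds on neighbouring lines make the Fourier series on each line absolutely convergent. -/
theorem strip_laurent {a d : ℝ} (hc : 0 < c) {h : ℂ → ℂ} (hd : DifferentiableOn ℂ h (hStrip a d))
    (hp : ∀ z ∈ hStrip a d, h (z + c) = h z) :
    ∃ A : ℤ → ℂ, (∀ y ∈ Ioo a d, ∀ n, stripCoeff c h y n = A n) ∧ StripBound c A a d ∧
      ∀ z ∈ hStrip a d, HasSum (fun n => A n * cexpMode c n z) (h z) := by
  rcases le_or_gt d a with hda | had
  · exact ⟨0, fun y hy => absurd (hy.1.trans hy.2) (by linarith),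
      fun y h1 h2 => absurd (h1.trans h2) (by linarith),
      fun z hz => absurd (hz.1.trans hz.2) (by linarith)⟩
  have hm : (a + d) / 2 ∈ Ioo a d := ⟨by linarith, by linarith⟩
  have hA : ∀ y ∈ Ioo a d, ∀ n, stripCoeff c h y n = stripCoeff c h ((a + d) / 2) n :=
    fun y hy n => stripCoeff_eq hc hd hp n hy hm
  have hline : ∀ y ∈ Ioo a d, ∀ x : ℝ, h (x + y * I + c) = h (x + y * I) := fun y hy x =>
    hp _ (by simpa [hStrip] using hy)
  have hB : StripBound c (stripCoeff c h ((a + d) / 2)) a d := by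
    intro y h1 h2
    obtain ⟨M, hM⟩ := exists_norm_line_le hc (continuous_line hd.continuousOn ⟨h1, h2⟩)
      (fun x => by simp only [← hline y ⟨h1, h2⟩ x]; push_cast; ring_nf)
    refine ⟨M, fun n => ?_⟩
    rw [← hA y ⟨h1, h2⟩]
    exact norm_stripCoeff_le hc hM n
  refine ⟨_, hA, hB, fun z hz => ?_⟩
  have hz' : z.im ∈ Ioo a d := hz
  have := hasSum_stripCoeff hc (continuous_line hd.continuousOn hz') (hline z.im hz') ?_ z.re
  · simpa only [re_add_im, hA _ hz'] using this
  · obtain ⟨u, hu, hu'⟩ := hB.exists_summable hc hz.1 le_rfl hz.2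
    refine Summable.of_nonneg_of_le (fun n => by positivity) (fun n => ?_) hu
    rw [hA _ hz', ← norm_cexpMode, ← norm_mul]
    exact hu' n z le_rfl le_rfl

end laurent

/-! ### Boundary conditions as relations between Laurent coefficients -/

section boundary

variable {c : ℝ}

/-- The sum is the coefficient of 2 Re(ζh): on the line of height y, conjugation exchanges the modes
n and −n up to the factor e^{4πny/c}. -/
theorem stripCoeff_add_conj_le (hc : 0 < c) {h : ℂ → ℂ} {y ε : ℝ} (ζ : ℂ)
    (hcont : Continuous fun x : ℝ => h (x + y * I))
    (hε : ∀ x : ℝ, |(ζ * h (x + y * I)).re| ≤ ε) (n : ℤ) :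
    ‖ζ * stripCoeff c h y n + starRingEnd ℂ ζ * Real.exp (4 * Real.pi * n * y / c) *
      starRingEnd ℂ (stripCoeff c h y (-n))‖ ≤ 2 * ε * Real.exp (2 * Real.pi * n * y / c) := by
  have hmode : ∀ x : ℝ, starRingEnd ℂ (cexpMode c (-(-n)) (x + y * I)) *
      Real.exp (4 * Real.pi * n * y / c) = cexpMode c (-n) (x + y * I) := by
    intro x
    rw [neg_neg, cexpMode_conj, cexpMode, cexpMode, ofReal_exp, ← exp_add]
    congr 1
    simp only [map_add, map_mul, conj_ofReal, conj_I]
    push_cast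
    field_simp
    ring_nf
    rw [I_sq]
    ring
  have hcm : ∀ m : ℤ, Continuous fun x : ℝ => cexpMode c m (x + y * I) := fun m =>
    (differentiable_cexpMode m).continuous.comp (by fun_prop)
  have hi : ∀ m : ℤ, Continuous fun x : ℝ => h (x + y * I) * cexpMode c m (x + y * I) :=
    fun m => hcont.mul (hcm m)
  have e1 : starRingEnd ℂ (stripCoeff c h y (-n)) = (1 / c : ℂ) * ∫ x in (0 : ℝ)..c,
      starRingEnd ℂ (h (x + y * I) * cexpMode c (-(-n)) (x + y * I)) := by
    rw [stripCoeff, map_mul, intervalIntegral.intervalIntegral_conj]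
    simp
  have e2 : ζ * stripCoeff c h y n + starRingEnd ℂ ζ * Real.exp (4 * Real.pi * n * y / c) *
      starRingEnd ℂ (stripCoeff c h y (-n)) =
      stripCoeff c (fun z => ((2 * (ζ * h z).re : ℝ) : ℂ)) y n := by
    rw [e1, stripCoeff, stripCoeff, mul_left_comm, mul_left_comm _ (1 / c : ℂ), ← mul_add]
    congr 1
    rw [← intervalIntegral.integral_const_mul, ← intervalIntegral.integral_const_mul,
      ← intervalIntegral.integral_add]
    · refine intervalIntegral.integral_congr fun x _ => ?_
      rw [← add_conj, ← hmode x, map_mul, map_mul]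
      ring
    · exact ((hi _).const_mul _).intervalIntegrable _ _
    · exact ((continuous_conj.comp (hi _)).const_mul _).intervalIntegrable _ _
  rw [e2]
  refine norm_stripCoeff_le hc (fun x => ?_) n
  rw [norm_real, Real.norm_eq_abs, abs_mul, abs_two]
  linarith [hε x]

/-- The coefficients are the same at all heights, so the previous estimate can be taken to the limit
at the edge y₀. -/
theorem coeff_boundary {a d y₀ : ℝ} (hc : 0 < c) {h : ℂ → ℂ} {A : ℤ → ℂ}
    (hcont : ContinuousOn h (hStrip a d))
    (hA : ∀ y ∈ Ioo a d, ∀ n, stripCoeff c h y n = A n) (ζ : ℂ) (hl : (𝓝[Ioo a d] y₀).NeBot)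
    (H : ∀ ε > (0 : ℝ), ∀ᶠ y : ℝ in 𝓝[Ioo a d] y₀, ∀ x : ℝ, |(ζ * h (x + y * I)).re| ≤ ε) (n : ℤ) :
    ζ * A n + starRingEnd ℂ ζ * Real.exp (4 * Real.pi * n * y₀ / c) * starRingEnd ℂ (A (-n)) = 0 := by
  rw [← norm_eq_zero]
  have hlim : Tendsto (fun y : ℝ => ‖ζ * A n + starRingEnd ℂ ζ *
      Real.exp (4 * Real.pi * n * y / c) * starRingEnd ℂ (A (-n))‖) (𝓝[Ioo a d] y₀)
      (𝓝 ‖ζ * A n + starRingEnd ℂ ζ *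
      Real.exp (4 * Real.pi * n * y₀ / c) * starRingEnd ℂ (A (-n))‖) :=
    (Continuous.tendsto (by fun_prop) y₀).mono_left nhdsWithin_le_nhds
  refine le_antisymm (le_of_forall_pos_le_add fun ε hε => ?_) (norm_nonneg _)
  set E := Real.exp (2 * Real.pi * n * y₀ / c) with hE
  have hE0 : 0 < E := Real.exp_pos _
  have hlim2 : Tendsto (fun y : ℝ => 2 * (ε / (2 * E)) * Real.exp (2 * Real.pi * n * y / c))
      (𝓝[Ioo a d] y₀) (𝓝 (2 * (ε / (2 * E)) * E)) :=
    (Continuous.tendsto (by fun_prop) y₀).mono_left nhdsWithin_le_nhds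
  refine (le_of_tendsto_of_tendsto hlim hlim2 ?_).trans (le_of_eq ?_)
  · filter_upwards [H (ε / (2 * E)) (by positivity), self_mem_nhdsWithin] with y hy hy'
    have := stripCoeff_add_conj_le hc ζ (continuous_line hcont hy') hy n
    rwa [hA y hy', hA y hy'] at this
  · field_simp
    ring

theorem nhdsWithin_Ioo_left_neBot {a d : ℝ} (h : a < d) : (𝓝[Ioo a d] a).NeBot := by
  rw [nhdsWithin_Ioo_eq_nhdsGT h]; infer_instance

theorem nhdsWithin_Ioo_right_neBot {a d : ℝ} (h : a < d) : (𝓝[Ioo a d] d).NeBot := by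
  rw [nhdsWithin_Ioo_eq_nhdsLT h]; infer_instance

/-- Schwarz reflection for periodic functions whose real part vanishes on the real line. -/
theorem periodic_reflection {δ : ℝ} (hc : 0 < c) (hδ : 0 < δ) {h : ℂ → ℂ}
    (hd : DifferentiableOn ℂ h (hStrip 0 δ)) (hp : ∀ z ∈ hStrip 0 δ, h (z + c) = h z)
    (H : ∀ ε > (0 : ℝ), ∀ᶠ y : ℝ in 𝓝[>] (0 : ℝ), ∀ x : ℝ, |(h (x + y * I)).re| ≤ ε) :
    ∃ g : ℂ → ℂ, DifferentiableOn ℂ g (hStrip (-δ) δ) ∧ EqOn g h (hStrip 0 δ) ∧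
      (∀ x : ℝ, (g x).re = 0) ∧ ∀ z, g (z + c) = g z := by
  obtain ⟨A, hA, hB, hS⟩ := strip_laurent hc hd hp
  -- The coefficients at n and −n have equal modulus, so convergence above the real line implies
  -- convergence below it.
  have hsym : ∀ n, A n = -starRingEnd ℂ (A (-n)) := by
    intro n
    have := coeff_boundary (y₀ := 0) hc hd.continuousOn hA 1 (nhdsWithin_Ioo_left_neBot hδ)
      (by simpa [nhdsWithin_Ioo_eq_nhdsGT hδ] using H) n
    simp at this
    linear_combination this
  have hnorm : ∀ n, ‖A (-n)‖ = ‖A n‖ := fun n => by rw [hsym n]; simp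
  have hB' : StripBound c A (-δ) δ := by
    intro y h1 h2
    rcases lt_trichotomy y 0 with h0 | rfl | h0
    · obtain ⟨M, hM⟩ := hB (-y) (by linarith) (by linarith)
      refine ⟨M, fun n => ?_⟩
      have := hM (-n)
      rw [hnorm] at this
      convert this using 3
      push_cast; ring
    · obtain ⟨M, hM⟩ := hB (δ / 2) (by linarith) (by linarith)
      have hM0 : 0 ≤ M := by simpa using (norm_nonneg _).trans (hM 0)
      have hneg : ∀ n : ℤ, n ≤ 0 → ‖A n‖ ≤ M := fun n hn => by
        refine (hM n).trans (mul_le_of_le_one_right hM0 (Real.exp_le_one_iff.mpr ?_))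
        have hn' : (n : ℝ) ≤ 0 := by exact_mod_cast hn
        refine div_nonpos_of_nonpos_of_nonneg (mul_nonpos_of_nonpos_of_nonneg ?_ (by linarith))
          hc.le
        exact mul_nonpos_of_nonneg_of_nonpos (by positivity) hn'
      refine ⟨M, fun n => ?_⟩
      simp only [mul_zero, zero_div, Real.exp_zero, mul_one]
      rcases le_total n 0 with hn | hn
      · exact hneg n hn
      · rw [← hnorm]; exact hneg _ (by linarith)
    · exact hB y h0 h2
  refine ⟨fun z => ∑' n, A n * cexpMode c n z, hB'.differentiableOn hc,
    fun z hz => (hS z hz).tsum_eq, fun x => ?_, fun z => by simp only [cexpMode_add_period hc]⟩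
  have : starRingEnd ℂ (∑' n, A n * cexpMode c n x) = -∑' n, A n * cexpMode c n x := by
    rw [conj_tsum, ← tsum_neg, ← (Equiv.neg ℤ).tsum_eq]
    refine tsum_congr fun n => ?_
    rw [map_mul, cexpMode_conj, conj_ofReal, Equiv.neg_apply, neg_neg, ← neg_mul, hsym n]
    simp
  have := congrArg re this
  simp at this
  linarith

/-- The additive boundary value problem: the periodic function `L` is corrected by a function `W`
that is real on the bottom, in such a way that the sum is real, up to a constant, on the top. -/
theorem exists_boundary_correction (hc : 0 < c) {L : ℂ → ℂ}
    (hd : DifferentiableOn ℂ L (hStrip 0 Real.pi))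
    (hp : ∀ z ∈ hStrip 0 Real.pi, L (z + c) = L z) :
    ∃ (W Y : ℂ → ℂ) (a₀ : ℂ), DifferentiableOn ℂ W (hStrip (-Real.pi) Real.pi) ∧
      DifferentiableOn ℂ Y (hStrip 0 (2 * Real.pi)) ∧ (∀ z, W (z + c) = W z) ∧
      (∀ z, Y (z + c) = Y z) ∧ (∀ x : ℝ, (W x).im = 0) ∧ (∀ x : ℝ, (Y (x + Real.pi * I)).im = 0) ∧
      ∀ z ∈ hStrip 0 Real.pi, W z + L z = Y z + a₀ := by
  have hpi := Real.pi_pos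
  obtain ⟨a, -, hB, hS⟩ := strip_laurent hc hd hp
  -- The mode n = 0 cannot be corrected, because `E 0 = 1`; it becomes the constant `a₀`.
  set A : ℤ → ℂ := fun n => if n = 0 then 0 else a n with hA
  have hAa : ∀ n, ‖A n‖ ≤ ‖a n‖ := fun n => by
    by_cases h : n = 0 <;> simp [hA, h]
  set E : ℤ → ℝ := fun n => Real.exp (4 * Real.pi ^ 2 * n / c) with hE
  have hE0 : ∀ n, 0 < E n := fun n => Real.exp_pos _
  have hEn : ∀ n, E (-n) = (E n)⁻¹ := fun n => by
    rw [hE]; simp only; rw [← Real.exp_neg]; congr 1; push_cast; ring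
  have hE1 : ∀ n, n ≠ 0 → E n ≠ 1 := fun n hn h => by
    rw [hE] at h
    simp only [Real.exp_eq_one_iff] at h
    have : (n : ℝ) ≠ 0 := by exact_mod_cast hn
    have : 4 * Real.pi ^ 2 * n / c ≠ 0 := by positivity
    contradiction
  -- The solution of two conditions: `B (-n)` is the conjugate of `B n` (real on the bottom), and B
  -- + A satisfies the analogous relation with the factor `E (-n)` (real on the top). Eliminating `B
  -- (-n)` leaves B_n(E_n − 1) = A_n − E_n conj(A_{−n}).
  set B : ℤ → ℂ := fun n => (A n - E n * starRingEnd ℂ (A (-n))) / (E n - 1) with hBdef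
  have hBsym : ∀ n, B (-n) = starRingEnd ℂ (B n) := by
    intro n
    rcases eq_or_ne n 0 with rfl | hn
    · simp [hBdef, hA]
    have h1 : (E n : ℂ) - 1 ≠ 0 := by
      rw [sub_ne_zero]; exact_mod_cast hE1 n hn
    have h0 : (E n : ℂ) ≠ 0 := by exact_mod_cast (hE0 n).ne'
    have h2 : 1 - (E n : ℂ) ≠ 0 := by rw [← neg_sub]; exact neg_ne_zero.mpr h1
    simp only [hBdef, hEn, neg_neg, map_div₀, map_sub, map_mul, conj_ofReal, conj_conj, map_one]
    push_cast
    have h3 : ((E n : ℂ))⁻¹ - 1 ≠ 0 := by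
      rw [show ((E n : ℂ))⁻¹ - 1 = (1 - E n) / E n by field_simp]
      exact div_ne_zero h2 h0
    rw [div_eq_div_iff h3 h1]
    field_simp
    ring
  set C : ℤ → ℂ := fun n => B n + A n with hCdef
  have hCsym : ∀ n, C (-n) = starRingEnd ℂ (C n) * E (-n) := by
    intro n
    rcases eq_or_ne n 0 with rfl | hn
    · simp [hCdef, hBdef, hA]
    have h1 : (E n : ℂ) - 1 ≠ 0 := by
      rw [sub_ne_zero]; exact_mod_cast hE1 n hn
    have h0 : (E n : ℂ) ≠ 0 := by exact_mod_cast (hE0 n).ne'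
    simp only [hCdef, map_add, hBsym, hEn]
    simp only [hBdef, map_div₀, map_sub, map_mul, conj_ofReal, conj_conj, map_one]
    push_cast
    field_simp
    ring
  -- The denominators `E n - 1` are comparable with `E n`, uniformly in n > 0, since `E (-1) * E n`
  -- is `E (n - 1)`, which is at least 1.
  have hk : ∃ k > 0, ∀ n : ℤ, 0 < n → k * E n ≤ E n - 1 := by
    refine ⟨1 - E (-1), ?_, fun n hn => ?_⟩
    · have : E (-1) < 1 := by
        rw [hE]; simp only [Real.exp_lt_one_iff]
        push_cast
        rw [mul_neg_one, neg_div, neg_lt_zero]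
        positivity
      linarith
    · have : E (-1) * E n = Real.exp (4 * Real.pi ^ 2 * (n - 1) / c) := by
        rw [hE]; simp only; rw [← Real.exp_add]; congr 1; push_cast; ring
      have h2 : 1 ≤ Real.exp (4 * Real.pi ^ 2 * (n - 1) / c) := by
        rw [Real.one_le_exp_iff]
        have : (0 : ℝ) ≤ n - 1 := by
          have : (1 : ℝ) ≤ n := by exact_mod_cast hn
          linarith
        positivity
      linarith
  obtain ⟨k, hk0, hk⟩ := hk
  have hden : ∀ n : ℤ, 0 < n → ‖(E n : ℂ) - 1‖ = E n - 1 := fun n hn => by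
    rw [← ofReal_one, ← ofReal_sub, norm_real, Real.norm_of_nonneg]
    have := hk n hn
    nlinarith [hE0 n]
  have hAbd : ∀ y, 0 < y → y < Real.pi → ∃ M, 0 ≤ M ∧ ∀ n,
      ‖A n‖ ≤ M * Real.exp (2 * Real.pi * n * y / c) := by
    intro y h1 h2
    obtain ⟨M, hM⟩ := hB y h1 h2
    exact ⟨M, by simpa using (norm_nonneg _).trans (hM 0), fun n => (hAa n).trans (hM n)⟩
  have expLe : ∀ (n : ℤ) (s t : ℝ), 0 < n → s ≤ t → Real.exp (2 * Real.pi * n * s / c) ≤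
      Real.exp (2 * Real.pi * n * t / c) := by
    intro n s t hn hst
    have : (0 : ℝ) < n := by exact_mod_cast hn
    gcongr
  have hEe : ∀ n : ℤ, (E n)⁻¹ = Real.exp (2 * Real.pi * n * (-(2 * Real.pi)) / c) := fun n => by
    rw [← hEn, hE]; simp only; congr 1; push_cast; ring
  have hBpos : ∀ y, -Real.pi < y → y < Real.pi → ∃ M, 0 ≤ M ∧ ∀ n : ℤ, 0 < n →
      ‖B n‖ ≤ M * Real.exp (2 * Real.pi * n * y / c) := by
    intro y h1 h2
    -- The term with A(−n) needs −y' ≤ y; the one with A(n) needs y' − 2π ≤ y, which is automatic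
    -- since y' < π and −π < y.
    obtain ⟨y', h3, h4, h5⟩ : ∃ y', 0 < y' ∧ y' < Real.pi ∧ -y' ≤ y :=
      ⟨max (-y) (Real.pi / 2), by positivity, max_lt (by linarith) (by linarith),
        by linarith [le_max_left (-y) (Real.pi / 2)]⟩
    obtain ⟨M, hM0, hM⟩ := hAbd y' h3 h4
    refine ⟨2 * M / k, by positivity, fun n hn => ?_⟩
    have e1 : ‖A n‖ ≤ E n * (M * Real.exp (2 * Real.pi * n * y / c)) := by
      refine (hM n).trans ?_
      have : Real.exp (2 * Real.pi * n * y' / c) ≤ E n * Real.exp (2 * Real.pi * n * y / c) := by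
        rw [← div_le_iff₀' (hE0 n), div_eq_mul_inv, hEe, ← Real.exp_add, ← add_div, ← mul_add]
        exact expLe n _ _ hn (by linarith)
      calc _ ≤ M * (E n * Real.exp (2 * Real.pi * n * y / c)) := by gcongr
        _ = _ := by ring
    have e2 : ‖A (-n)‖ ≤ M * Real.exp (2 * Real.pi * n * y / c) := by
      refine (hM (-n)).trans ?_
      have := expLe n (-y') y hn h5
      rw [show 2 * Real.pi * ((-n : ℤ) : ℝ) * y' / c = 2 * Real.pi * n * (-y') / c by
        push_cast; ring]
      gcongr
    have hkE := mul_pos hk0 (hE0 n)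
    have := hE0 n
    simp only [hBdef, norm_div, hden n hn]
    calc ‖A n - E n * starRingEnd ℂ (A (-n))‖ / (E n - 1)
        ≤ (‖A n‖ + E n * ‖A (-n)‖) / (k * E n) := by
          refine div_le_div₀ (by positivity) ?_ hkE (hk n hn)
          refine (norm_sub_le _ _).trans (le_of_eq ?_)
          simp [abs_of_pos (hE0 n)]
      _ ≤ (E n * (M * Real.exp (2 * Real.pi * n * y / c)) +
          E n * (M * Real.exp (2 * Real.pi * n * y / c))) / (k * E n) := by gcongr
      _ = _ := by field_simp; ring
  have hBB : StripBound c B (-Real.pi) Real.pi := by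
    intro y h1 h2
    obtain ⟨M, hM0, hM⟩ := hBpos y h1 h2
    obtain ⟨M', hM0', hM'⟩ := hBpos (-y) (by linarith) (by linarith)
    refine ⟨M + M', fun n => ?_⟩
    have hx := Real.exp_pos (2 * Real.pi * n * y / c)
    rcases lt_trichotomy n 0 with hn | rfl | hn
    · have h3 := hM' (-n) (by linarith)
      rw [hBsym, RCLike.norm_conj, show 2 * Real.pi * ((-n : ℤ) : ℝ) * -y / c =
        2 * Real.pi * n * y / c by push_cast; ring] at h3
      nlinarith
    · simp [hBdef, hA]
      positivity
    · have := hM n hn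
      nlinarith
  have hCC : StripBound c C 0 (2 * Real.pi) := by
    intro y h1 h2
    -- The bound y' ≤ y serves n > 0, and y' ≤ 2π − y serves n < 0 through the symmetry `hCsym`.
    obtain ⟨y', h3, h4, h5, h6⟩ : ∃ y', 0 < y' ∧ y' < Real.pi ∧ y' ≤ y ∧ y' ≤ 2 * Real.pi - y :=
      ⟨min (min y (2 * Real.pi - y)) (Real.pi / 2),
        lt_min (lt_min h1 (by linarith)) (by linarith),
        (min_le_right _ _).trans_lt (by linarith), (min_le_left _ _).trans (min_le_left _ _),
        (min_le_left _ _).trans (min_le_right _ _)⟩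
    obtain ⟨M, hM0, hM⟩ := hAbd y' h3 h4
    have hpos : ∀ n : ℤ, 0 < n → ‖C n‖ ≤ 2 * M / k * Real.exp (2 * Real.pi * n * y' / c) := by
      intro n hn
      have h1 : (E n : ℂ) - 1 ≠ 0 := by
        rw [sub_ne_zero]; exact_mod_cast hE1 n hn.ne'
      -- Adding A(n) to B(n) leaves `E n` as a common factor of the numerator, which the denominator
      -- absorbs.
      have e0 : C n = E n * (A n - starRingEnd ℂ (A (-n))) / (E n - 1) := by
        simp only [hCdef, hBdef]
        field_simp
        ring
      have e2 : ‖A (-n)‖ ≤ M * Real.exp (2 * Real.pi * n * y' / c) := by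
        refine (hM (-n)).trans ?_
        have := expLe n (-y') y' hn (by linarith)
        rw [show 2 * Real.pi * ((-n : ℤ) : ℝ) * y' / c = 2 * Real.pi * n * (-y') / c by
          push_cast; ring]
        gcongr
      have hkE := mul_pos hk0 (hE0 n)
      have := hE0 n
      rw [e0, norm_div, hden n hn]
      calc ‖E n * (A n - starRingEnd ℂ (A (-n)))‖ / (E n - 1)
          ≤ (E n * (‖A n‖ + ‖A (-n)‖)) / (k * E n) := by
            refine div_le_div₀ (by positivity) ?_ hkE (hk n hn)
            rw [norm_mul, norm_real, Real.norm_of_nonneg this.le]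
            gcongr
            refine (norm_sub_le _ _).trans (le_of_eq ?_)
            simp
        _ ≤ (E n * (M * Real.exp (2 * Real.pi * n * y' / c) +
            M * Real.exp (2 * Real.pi * n * y' / c))) / (k * E n) := by
            have := hM n
            gcongr
        _ = _ := by field_simp; ring
    refine ⟨2 * M / k, fun n => ?_⟩
    rcases lt_trichotomy n 0 with hn | rfl | hn
    · have h7 := hpos (-n) (by linarith)
      have h8 := hCsym (-n)
      rw [neg_neg] at h8
      rw [h8, norm_mul, RCLike.norm_conj, norm_real, Real.norm_of_nonneg (hE0 n).le]
      calc ‖C (-n)‖ * E n ≤ 2 * M / k * Real.exp (2 * Real.pi * (-n : ℤ) * y' / c) * E n := by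
            have := hE0 n
            gcongr
        _ = 2 * M / k * Real.exp (2 * Real.pi * (-n : ℤ) * (y' - 2 * Real.pi) / c) := by
            rw [mul_assoc, hE]; simp only; rw [← Real.exp_add]; congr 2; push_cast; ring
        _ ≤ 2 * M / k * Real.exp (2 * Real.pi * (-n : ℤ) * (-y) / c) := by
            have := expLe (-n) (y' - 2 * Real.pi) (-y) (by linarith) (by linarith)
            gcongr
        _ = _ := by congr 2; push_cast; ring
    · simp [hCdef, hBdef, hA]
      positivity
    · refine (hpos n hn).trans ?_
      have := expLe n y' y hn h5
      gcongr
  refine ⟨fun z => ∑' n, B n * cexpMode c n z, fun z => ∑' n, C n * cexpMode c n z, a 0,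
    hBB.differentiableOn hc, hCC.differentiableOn hc,
    fun z => by simp only [cexpMode_add_period hc], fun z => by simp only [cexpMode_add_period hc],
    fun x => ?_, fun x => ?_, fun z hz => ?_⟩
  · rw [← conj_eq_iff_im, conj_tsum, ← (Equiv.neg ℤ).tsum_eq]
    refine tsum_congr fun n => ?_
    rw [map_mul, cexpMode_conj, conj_ofReal, Equiv.neg_apply, neg_neg, hBsym, conj_conj]
  · rw [← conj_eq_iff_im, conj_tsum, ← (Equiv.neg ℤ).tsum_eq]
    refine tsum_congr fun n => ?_
    rw [map_mul, cexpMode_conj, Equiv.neg_apply, neg_neg, hCsym, map_mul, conj_conj, conj_ofReal,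
      mul_assoc]
    congr 1
    rw [hE]
    simp only [map_add, map_mul, conj_ofReal, conj_I, cexpMode]
    rw [ofReal_exp, ← exp_add]
    congr 1
    push_cast
    have : (c : ℂ) ≠ 0 := by exact_mod_cast hc.ne'
    field_simp
    ring_nf
    rw [I_sq]
    ring
  · have s1 := (hS z hz).sub (hasSum_ite_eq (0 : ℤ) (a 0))
    have s2 : HasSum (fun n => A n * cexpMode c n z) (L z - a 0) := by
      have e : (fun n => A n * cexpMode c n z) =
          fun n => a n * cexpMode c n z - if n = 0 then a 0 else 0 := by
        ext n
        by_cases hn : n = 0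
        · simp [hA, hn, cexpMode]
        · simp [hA, hn]
      rw [e]
      exact s1
    have s3 := (hBB.summable hc (z := z) ⟨by linarith [hz.1], hz.2⟩).hasSum.add s2
    have s4 : (∑' n, C n * cexpMode c n z) = (∑' n, B n * cexpMode c n z) + (L z - a 0) := by
      rw [← s3.tsum_eq]
      refine tsum_congr fun n => ?_
      simp only [hCdef]
      ring
    simp only [s4]
    ring

end boundary

/-! ### Vanishing real parts at the two edges of the strip -/

/-- The real part of `h` tends to zero uniformly at the bottom of the strip. -/
def BotRe (h : ℂ → ℂ) : Prop :=
  ∀ ε > (0 : ℝ), ∀ᶠ y : ℝ in 𝓝[>] (0 : ℝ), ∀ x : ℝ, |(h (x + y * I)).re| ≤ ε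

/-- The real part of `h` tends to zero uniformly at the top of the strip. -/
def TopRe (h : ℂ → ℂ) : Prop :=
  ∀ ε > (0 : ℝ), ∀ᶠ y : ℝ in 𝓝[<] Real.pi, ∀ x : ℝ, |(h (x + y * I)).re| ≤ ε

/-- The `p`-periodic function `h` extends across the real line, on which the extension is purely
imaginary. -/
def ReflRe (p : ℝ) (h : ℂ → ℂ) : Prop :=
  ∃ δ > 0, ∃ g : ℂ → ℂ, DifferentiableOn ℂ g (hStrip (-δ) δ) ∧ EqOn g h (hStrip 0 δ) ∧
    (∀ x : ℝ, (g x).re = 0) ∧ ∀ z, g (z + p) = g z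

section refl

variable {p : ℝ} {h : ℂ → ℂ}

theorem hStrip_mono {a a' d d' : ℝ} (h1 : a' ≤ a) (h2 : d ≤ d') : hStrip a d ⊆ hStrip a' d' :=
  fun _ hz => ⟨h1.trans_lt hz.1, hz.2.trans_le h2⟩

theorem BotRe.sub {g : ℂ → ℂ} (hh : BotRe h) (hg : BotRe g) : BotRe fun z => h z - g z := by
  intro ε hε
  filter_upwards [hh (ε / 2) (by positivity), hg (ε / 2) (by positivity)] with y h1 h2 x
  rw [sub_re]
  refine (abs_sub _ _).trans ?_
  linarith [h1 x, h2 x]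

theorem BotRe.congr {g : ℂ → ℂ} {δ : ℝ} (hδ : 0 < δ) (hh : BotRe h) (he : EqOn h g (hStrip 0 δ)) :
    BotRe g := by
  intro ε hε
  filter_upwards [hh ε hε, Ioo_mem_nhdsGT hδ] with y h1 h2 x
  rw [← he (by simpa [hStrip] using h2)]
  exact h1 x

theorem tendsto_pi_sub_nhdsLT : Tendsto (fun y => Real.pi - y) (𝓝[<] Real.pi) (𝓝[>] 0) := by
  refine tendsto_nhdsWithin_iff.mpr ⟨?_, ?_⟩
  · have : Tendsto (fun y => Real.pi - y) (𝓝 Real.pi) (𝓝 (Real.pi - Real.pi)) :=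
      (continuous_const.sub continuous_id).tendsto _
    rw [sub_self] at this
    exact this.mono_left nhdsWithin_le_nhds
  · filter_upwards [self_mem_nhdsWithin] with y hy
    simpa using hy

theorem tendsto_pi_sub_nhdsGT : Tendsto (fun y => Real.pi - y) (𝓝[>] 0) (𝓝[<] Real.pi) := by
  refine tendsto_nhdsWithin_iff.mpr ⟨?_, ?_⟩
  · have : Tendsto (fun y => Real.pi - y) (𝓝 0) (𝓝 (Real.pi - 0)) :=
      (continuous_const.sub continuous_id).tendsto _
    rw [sub_zero] at this
    exact this.mono_left nhdsWithin_le_nhds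
  · filter_upwards [self_mem_nhdsWithin] with y hy
    simpa using hy

/-- The half-turn z ↦ πi − z exchanges the edges, so statements about the top follow from those
about the bottom. -/
theorem BotRe.topRe (hh : BotRe fun z => h (Real.pi * I - z)) : TopRe h := by
  intro ε hε
  filter_upwards [tendsto_pi_sub_nhdsLT.eventually (hh ε hε)] with y h1 x
  have := h1 (-x)
  push_cast at this
  rwa [show Real.pi * I - (-(x : ℂ) + (Real.pi - y) * I) = x + y * I by ring] at this

theorem TopRe.botRe (hh : TopRe h) : BotRe fun z => h (Real.pi * I - z) := by
  intro ε hε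
  filter_upwards [tendsto_pi_sub_nhdsGT.eventually (hh ε hε)] with y h1 x
  have := h1 (-x)
  push_cast at this
  ring_nf at this ⊢
  exact this

theorem BotRe.reflRe {δ : ℝ} (hh : BotRe h) (hp0 : 0 < p) (hδ : 0 < δ)
    (hd : DifferentiableOn ℂ h (hStrip 0 δ)) (hp : ∀ z ∈ hStrip 0 δ, h (z + p) = h z) :
    ReflRe p h := by
  obtain ⟨g, h1, h2, h3, h4⟩ := periodic_reflection hp0 hδ hd hp hh
  exact ⟨δ, hδ, g, h1, h2, h3, h4⟩

theorem ReflRe.congr {h' : ℂ → ℂ} (hh : ReflRe p h) {δ : ℝ} (hδ : 0 < δ)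
    (he : EqOn h h' (hStrip 0 δ)) : ReflRe p h' := by
  obtain ⟨δ', hδ', g, h1, h2, h3, h4⟩ := hh
  refine ⟨min δ δ', lt_min hδ hδ', g,
    h1.mono (hStrip_mono (neg_le_neg (min_le_right _ _)) (min_le_right _ _)), fun z hz => ?_,
    h3, h4⟩
  rw [h2 (hStrip_mono le_rfl (min_le_right _ _) hz), he (hStrip_mono le_rfl (min_le_left _ _) hz)]

theorem ReflRe.mul_real (hh : ReflRe p h) {u : ℂ → ℂ} {δ : ℝ} (hδ : 0 < δ)
    (hu : DifferentiableOn ℂ u (hStrip (-δ) δ)) (hur : ∀ x : ℝ, (u x).im = 0)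
    (hup : ∀ z, u (z + p) = u z) : ReflRe p fun z => h z * u z := by
  obtain ⟨δ', hδ', g, h1, h2, h3, h4⟩ := hh
  refine ⟨min δ δ', lt_min hδ hδ', fun z => g z * u z,
    (h1.mono (hStrip_mono (neg_le_neg (min_le_right _ _)) (min_le_right _ _))).mul
    (hu.mono (hStrip_mono (neg_le_neg (min_le_left _ _)) (min_le_left _ _))), fun z hz => ?_,
    fun x => ?_, fun z => ?_⟩
  · simp only [h2 (hStrip_mono le_rfl (min_le_right _ _) hz)]
  · simp [h3, hur]
  · simp only [h4, hup]

/-- The extension is purely imaginary along the real axis, hence so is its derivative in the real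
direction. -/
theorem ReflRe.deriv {h' : ℂ → ℂ} (hh : ReflRe p h) {δ : ℝ} (hδ : 0 < δ)
    (hd : ∀ z ∈ hStrip 0 δ, HasDerivAt h (h' z) z) : ReflRe p h' := by
  obtain ⟨δ', hδ', g, h1, h2, h3, h4⟩ := hh
  have hopen := isOpen_hStrip (-δ') δ'
  refine ⟨min δ δ', lt_min hδ hδ', _root_.deriv g,
    (h1.deriv hopen).mono (hStrip_mono (neg_le_neg (min_le_right _ _)) (min_le_right _ _)),
    fun z hz => ?_, fun x => ?_, fun z => ?_⟩
  · refine ((hd z (hStrip_mono le_rfl (min_le_left _ _) hz)).congr_of_eventuallyEq ?_).deriv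
    filter_upwards [(isOpen_hStrip 0 δ').mem_nhds (hStrip_mono le_rfl (min_le_right _ _) hz)]
      with w hw
    exact h2 hw
  · have hx : (x : ℂ) ∈ hStrip (-δ') δ' := ⟨by simpa using hδ', by simpa using hδ'⟩
    have e1 : HasDerivAt g (_root_.deriv g x) (x : ℂ) :=
      (h1.differentiableAt (hopen.mem_nhds hx)).hasDerivAt
    have e2 := e1.real_of_complex
    have e3 : (fun y : ℝ => (g y).re) = fun _ => 0 := funext h3
    rw [e3] at e2
    exact e2.unique (hasDerivAt_const x 0)
  · rw [← deriv_comp_add_const, funext h4]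

/-- Uniformity in x comes from compactness of one period. -/
theorem ReflRe.botRe (hh : ReflRe p h) (hp0 : 0 < p) : BotRe h := by
  obtain ⟨δ, hδ, g, h1, h2, h3, h4⟩ := hh
  refine BotRe.congr hδ (h := g) ?_ h2
  intro ε hε
  have key : ∀ᶠ y : ℝ in 𝓝 (0 : ℝ), ∀ x ∈ Icc (0 : ℝ) p, |(g (x + y * I)).re| < ε := by
    refine isCompact_Icc.eventually_forall_of_forall_eventually fun x _ => ?_
    have hc : ContinuousAt (fun q : ℝ × ℝ => |(g (q.2 + q.1 * I)).re|) (0, x) := by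
      have hx : (x : ℂ) + (0 : ℝ) * I ∈ hStrip (-δ) δ := by simp [hStrip, hδ]
      have e1 := (h1.differentiableAt ((isOpen_hStrip _ _).mem_nhds hx)).continuousAt
      have e2 : ContinuousAt (fun q : ℝ × ℝ => (q.2 : ℂ) + q.1 * I) (0, x) := by fun_prop
      have e3 : ContinuousAt (fun q : ℝ × ℝ => g (q.2 + q.1 * I)) (0, x) :=
        ContinuousAt.comp (f := fun q : ℝ × ℝ => (q.2 : ℂ) + q.1 * I) (g := g) e1 e2
      exact (continuous_re.continuousAt.comp e3).abs
    refine hc.eventually_lt continuousAt_const ?_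
    simpa [h3] using hε
  filter_upwards [nhdsWithin_le_nhds key] with y hy x
  have hper : Function.Periodic (fun x : ℝ => g (x + y * I)) p := fun x => by
    simp only [← h4 (x + y * I)]
    push_cast
    ring_nf
  obtain ⟨x', hx', e⟩ := hper.exists_mem_Ico₀ hp0 x
  rw [e]
  exact (hy x' (Ico_subset_Icc_self hx')).le

/-- A holomorphic antiperiodic function in the strip vanishes if its real part vanishes on the
bottom and the imaginary part of a constant multiple vanishes on the top. -/
theorem strip_uniqueness {c : ℝ} (hc : 0 < c) (θ : ℝ) {D : ℂ → ℂ}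
    (hd : DifferentiableOn ℂ D (hStrip 0 Real.pi)) (hp : ∀ z ∈ hStrip 0 Real.pi, D (z + c) = -D z)
    (hbot : BotRe D) (htop : TopRe fun z => I * (exp (θ * I) * D z)) :
    ∀ z ∈ hStrip 0 Real.pi, D z = 0 := by
  have hpi := Real.pi_pos
  have h2c : 0 < 2 * c := by linarith
  have hstrip : ∀ z ∈ hStrip 0 Real.pi, z + c ∈ hStrip 0 Real.pi := fun z hz => by
    simpa [hStrip] using hz
  have hp2 : ∀ z ∈ hStrip 0 Real.pi, D (z + (2 * c : ℝ)) = D z := fun z hz => by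
    rw [show z + ((2 * c : ℝ) : ℂ) = z + c + c by push_cast; ring, hp _ (hstrip z hz), hp z hz,
      neg_neg]
  obtain ⟨A, hA, hB, hS⟩ := strip_laurent h2c hd hp2
  -- Antiperiodicity cancels the two halves of the mean over 2c. This mode needs its own argument:
  -- for n = 0 the factor X below would be 1 and the bracket of `h4` could vanish.
  have hA0 : A 0 = 0 := by
    have hm : Real.pi / 2 ∈ Ioo 0 Real.pi := ⟨by linarith, by linarith⟩
    have hcont := continuous_line hd.continuousOn hm
    rw [← hA _ hm, stripCoeff]
    have e1 : ∀ x : ℝ, D (x + (Real.pi / 2 : ℝ) * I) * cexpMode (2 * c) (-0)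
        (x + (Real.pi / 2 : ℝ) * I) = D (x + (Real.pi / 2 : ℝ) * I) := fun x => by
      simp [cexpMode]
    simp only [e1]
    rw [← intervalIntegral.integral_add_adjacent_intervals (b := c)
      (hcont.intervalIntegrable _ _) (hcont.intervalIntegrable _ _)]
    have e2 : ∫ x in c..2 * c, D (x + (Real.pi / 2 : ℝ) * I) =
        ∫ x in (0 : ℝ)..c, D ((x + c : ℝ) + (Real.pi / 2 : ℝ) * I) := by
      rw [intervalIntegral.integral_comp_add_right
        (fun x : ℝ => D (x + (Real.pi / 2 : ℝ) * I)) c]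
      ring_nf
    have e3 : ∀ x : ℝ, D ((x + c : ℝ) + (Real.pi / 2 : ℝ) * I) =
        -D (x + (Real.pi / 2 : ℝ) * I) := fun x => by
      rw [← hp _ (by simpa [hStrip] using hm)]
      push_cast
      ring_nf
    rw [e2]
    simp only [e3]
    rw [intervalIntegral.integral_neg]
    simp
  have hAn : ∀ n, A n = 0 := by
    intro n
    rcases eq_or_ne n 0 with rfl | hn
    · exact hA0
    have h1 := coeff_boundary (y₀ := 0) h2c hd.continuousOn hA 1 (nhdsWithin_Ioo_left_neBot hpi)
      (by simpa [nhdsWithin_Ioo_eq_nhdsGT hpi, BotRe] using hbot) n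
    have h2 := coeff_boundary (y₀ := Real.pi) h2c hd.continuousOn hA (I * exp (θ * I))
      (nhdsWithin_Ioo_right_neBot hpi)
      (by simpa only [nhdsWithin_Ioo_eq_nhdsLT hpi, TopRe, mul_assoc] using htop) n
    simp only [one_mul, map_one, mul_zero, zero_div, Real.exp_zero, ofReal_one] at h1
    set X := Real.exp (4 * Real.pi * n * Real.pi / (2 * c)) with hX
    have h3 : starRingEnd ℂ (I * exp (θ * I)) = -(I * exp (-(θ * I))) := by
      rw [map_mul, ← exp_conj, map_mul, conj_I, conj_ofReal]
      simp
    rw [h3] at h2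
    -- The conjugate of A(−n) is eliminated from the two boundary relations. The terms of the
    -- bracket have moduli 1 and X, and X ≠ 1 for n ≠ 0.
    have h4 : A n * (exp (θ * I) + X * exp (-(θ * I))) = 0 := by
      have : I * (A n * (exp (θ * I) + X * exp (-(θ * I)))) = 0 := by
        linear_combination h2 + I * exp (-(θ * I)) * X * h1
      simpa using this
    rcases mul_eq_zero.mp h4 with h | h
    · exact h
    exfalso
    have h5 : ‖exp (θ * I)‖ = ‖(X : ℂ) * exp (-(θ * I))‖ := by
      rw [← norm_neg, eq_neg_of_add_eq_zero_left h, neg_neg]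
    rw [norm_mul, ← neg_mul, ← ofReal_neg, norm_exp_ofReal_mul_I, norm_exp_ofReal_mul_I, norm_real,
      Real.norm_of_nonneg (Real.exp_pos _).le, mul_one, eq_comm, Real.exp_eq_one_iff] at h5
    have : (n : ℝ) ≠ 0 := by exact_mod_cast hn
    have : 4 * Real.pi * n * Real.pi / (2 * c) ≠ 0 := by positivity
    contradiction
  intro z hz
  have := hS z hz
  simp only [hAn, zero_mul] at this
  exact this.unique hasSum_zero

end refl

/-! ### Injective holomorphic functions -/

section injective

variable {f : ℂ → ℂ} {U : Set ℂ}

theorem nhds_le_map_of_injOn (hU : IsOpen U) (hf : DifferentiableOn ℂ f U) (hi : InjOn f U)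
    {z : ℂ} (hz : z ∈ U) : 𝓝 (f z) ≤ map f (𝓝 z) := by
  refine ((hf.analyticAt (hU.mem_nhds hz)).eventually_constant_or_nhds_le_map_nhds).resolve_left
    fun h => ?_
  have h1 : ∀ᶠ w in 𝓝[≠] z, f w = f z ∧ w ∈ U :=
    nhdsWithin_le_nhds (h.and (hU.mem_nhds hz))
  obtain ⟨w, ⟨hw1, hw2⟩, hw3⟩ := (h1.and self_mem_nhdsWithin).exists
  exact hw3 (hi hw2 hz hw1)

theorem continuousAt_invFunOn (hU : IsOpen U) (hf : DifferentiableOn ℂ f U) (hi : InjOn f U)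
    {z : ℂ} (hz : z ∈ U) : ContinuousAt (Function.invFunOn f U) (f z) := by
  have hleft : ∀ w ∈ U, Function.invFunOn f U (f w) = w := fun w hw => hi.leftInvOn_invFunOn hw
  rw [ContinuousAt, hleft z hz]
  intro N hN
  have h1 : f '' (N ∩ U) ∈ 𝓝 (f z) :=
    nhds_le_map_of_injOn hU hf hi hz (image_mem_map (inter_mem hN (hU.mem_nhds hz)))
  rw [mem_map]
  filter_upwards [h1]
  rintro _ ⟨w, ⟨hw1, hw2⟩, rfl⟩
  rwa [mem_preimage, hleft w hw2]

/-- Critical points are isolated, so the inverse is differentiable near f(z) except possibly at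
f(z); being continuous, it is holomorphic there as well. The chain rule g'(f(z)) f'(z) = 1 then
excludes f'(z) = 0. -/
theorem deriv_ne_zero_of_injOn (hU : IsOpen U) (hf : DifferentiableOn ℂ f U) (hi : InjOn f U)
    {z : ℂ} (hz : z ∈ U) : deriv f z ≠ 0 := by
  have hleft : ∀ w ∈ U, Function.invFunOn f U (f w) = w := fun w hw => hi.leftInvOn_invFunOn hw
  set g := Function.invFunOn f U with hg
  have hinv : ∀ w ∈ U, ∀ᶠ y in 𝓝 (f w), f (g y) = y := fun w hw => by
    have h1 : f '' U ∈ 𝓝 (f w) :=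
      nhds_le_map_of_injOn hU hf hi hw (image_mem_map (hU.mem_nhds hw))
    filter_upwards [h1]
    rintro _ ⟨v, hv, rfl⟩
    rw [hleft v hv]
  have hcrit : ∀ᶠ w in 𝓝[≠] z, deriv f w ≠ 0 := by
    rcases (hf.analyticAt (hU.mem_nhds hz)).deriv.eventually_eq_zero_or_eventually_ne_zero
      with h | h
    · exfalso
      have h0 : ∀ᶠ w in 𝓝 z, deriv f w = 0 ∧ w ∈ U := h.and (hU.mem_nhds hz)
      obtain ⟨r, hr, hball⟩ := Metric.eventually_nhds_iff_ball.mp h0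
      have h1 : z + (r / 2 : ℝ) ∈ Metric.ball z r := by
        simp [abs_of_pos hr]
        exact hr
      have hconst : f (z + (r / 2 : ℝ)) = f z :=
        (convex_ball z r).is_const_of_fderivWithin_eq_zero (𝕜 := ℂ) (f := f)
          (hf.mono fun w hw => (hball w hw).2) (fun w hw => by
            rw [fderivWithin_of_isOpen Metric.isOpen_ball hw]
            ext
            simpa using (hball w hw).1) h1 (Metric.mem_ball_self hr)
      have h2 := hi (hball _ h1).2 hz hconst
      have h3 : ((r / 2 : ℝ) : ℂ) = 0 := by linear_combination h2
      rw [ofReal_eq_zero] at h3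
      linarith
    · exact h
  have hgd : ∀ᶠ y in 𝓝[≠] (f z), DifferentiableAt ℂ g y := by
    rw [eventually_nhdsWithin_iff] at hcrit ⊢
    have h1 : f '' ({w | w ∈ ({z}ᶜ : Set ℂ) → deriv f w ≠ 0} ∩ U) ∈ 𝓝 (f z) :=
      nhds_le_map_of_injOn hU hf hi hz (image_mem_map (inter_mem hcrit (hU.mem_nhds hz)))
    filter_upwards [h1]
    rintro _ ⟨w, ⟨hw1, hw2⟩, rfl⟩ hne
    have hwz : w ∈ ({z}ᶜ : Set ℂ) := fun h => hne (by rw [mem_singleton_iff.mp h]; rfl)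
    have hd : HasDerivAt f (deriv f w) (g (f w)) := by
      rw [hleft w hw2]
      exact (hf.differentiableAt (hU.mem_nhds hw2)).hasDerivAt
    exact (HasDerivAt.of_local_left_inverse (continuousAt_invFunOn hU hf hi hw2) hd (hw1 hwz)
      (hinv w hw2)).differentiableAt
  have hga := analyticAt_of_differentiable_on_punctured_nhds_of_continuousAt hgd
    (continuousAt_invFunOn hU hf hi hz)
  have h1 : HasDerivAt (g ∘ f) (deriv g (f z) * deriv f z) z :=
    hga.differentiableAt.hasDerivAt.comp z
      (hf.differentiableAt (hU.mem_nhds hz)).hasDerivAt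
  have h2 : HasDerivAt (g ∘ f) 1 z := by
    refine (hasDerivAt_id z).congr_of_eventuallyEq ?_
    filter_upwards [hU.mem_nhds hz] with w hw
    exact hleft w hw
  intro h0
  rw [h0, mul_zero] at h1
  exact zero_ne_one (h1.unique h2)

end injective

/-! ### A single-valued logarithm of the derivative of the uniformization -/

theorem eqOn_const_of_exp_eq_one {X : Type*} [TopologicalSpace X] {s : Set X}
    (hs : IsPreconnected s) {f : X → ℂ} (hf : ContinuousOn f s) (he : ∀ x ∈ s, exp (f x) = 1) {x y : X}
    (hx : x ∈ s) (hy : y ∈ s) : f x = f y := by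
  have hT : IsDiscrete (AddSubgroup.zmultiples (2 * Real.pi * I : ℂ) : Set ℂ) := by
    rw [isDiscrete_iff_discreteTopology]
    exact NormedSpace.discreteTopology_zmultiples _
  refine hs.constant_of_mapsTo hT hf (fun x hx => ?_) hx hy
  obtain ⟨n, hn⟩ := exp_eq_one_iff.mp (he x hx)
  rw [SetLike.mem_coe, AddSubgroup.mem_zmultiples_iff]
  exact ⟨n, by rw [hn]; simp⟩

theorem isOpen_openStrip : IsOpen openStrip := isOpen_hStrip 0 Real.pi

theorem convex_hStrip (a d : ℝ) : Convex ℝ (hStrip a d) := by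
  have : hStrip a d = imLm ⁻¹' Ioo a d := rfl
  rw [this]
  exact (convex_Ioo a d).linear_preimage imLm

theorem add_ofReal_mem_openStrip {z : ℂ} (hz : z ∈ openStrip) (t : ℝ) : z + t ∈ openStrip := by
  simpa [openStrip] using hz

/-- Near z the increment of L has imaginary part smaller than π, so it is the principal logarithm of
g(w)/g(z). -/
theorem hasDerivAt_of_exp {L g : ℂ → ℂ} {z : ℂ} (hL : ContinuousAt L z)
    (hg : DifferentiableAt ℂ g z) (he : ∀ᶠ w in 𝓝 z, exp (L w) = g w) : DifferentiableAt ℂ L z := by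
  have hz := he.self_of_nhds
  have h1 : ∀ᶠ w in 𝓝 z, L w = L z + log (g w / g z) := by
    have h2 : ∀ᶠ w in 𝓝 z, |(L w - L z).im| < Real.pi := by
      have : ContinuousAt (fun w => |(L w - L z).im|) z :=
        (continuous_im.continuousAt.comp (hL.sub continuousAt_const)).abs
      refine this.eventually_lt continuousAt_const ?_
      simpa using Real.pi_pos
    filter_upwards [he, h2] with w hw1 hw2
    rw [← hw1, ← hz, ← exp_sub, log_exp]
    · ring
    · linarith [(abs_lt.mp hw2).1]
    · linarith [(abs_lt.mp hw2).2]
  have hgz : g z ≠ 0 := by rw [← hz]; exact exp_ne_zero _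
  have h3 : DifferentiableAt ℂ (fun w => L z + log (g w / g z)) z := by
    refine (((hg.div_const _).clog ?_)).const_add _
    rw [div_self hgz]
    exact one_mem_slitPlane
  exact h3.congr_of_eventuallyEq h1

section uniformization

variable {Ω : Set Cylinder} {c : ℝ} {φ : ℂ → ℂ}

theorem IsUniformization.deriv_ne_zero (hφ : IsUniformization Ω c φ) {z : ℂ}
    (hz : z ∈ openStrip) : deriv φ z ≠ 0 :=
  deriv_ne_zero_of_injOn isOpen_openStrip hφ.holomorphic hφ.bijOn.injOn hz

theorem IsUniformization.deriv_add_period (hφ : IsUniformization Ω c φ) {z : ℂ}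
    (hz : z ∈ openStrip) : deriv φ (z + c) = deriv φ z := by
  rw [← deriv_comp_add_const]
  have : (fun w => φ (w + c)) =ᶠ[𝓝 z] fun w => φ w + 1 := by
    filter_upwards [isOpen_openStrip.mem_nhds hz] with w hw
    exact hφ.equivariant w hw
  rw [this.deriv_eq, deriv_add_const]

/-- The difference quotient of `φ` in the horizontal direction. -/
noncomputable def horizontalSlope (φ : ℂ → ℂ) (p : ℂ × ℝ) : ℂ :=
  if p.2 = 0 then deriv φ p.1 else (φ (p.1 + p.2) - φ p.1) / p.2

theorem continuousOn_horizontalSlope (hφ : DifferentiableOn ℂ φ openStrip) :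
    ContinuousOn (horizontalSlope φ) (openStrip ×ˢ univ) := by
  rintro ⟨z, t⟩ ⟨hz, -⟩
  refine ContinuousAt.continuousWithinAt ?_
  have hz : z ∈ openStrip := hz
  have hd : ∀ w ∈ openStrip, DifferentiableAt ℂ φ w := fun w hw =>
    hφ.differentiableAt (isOpen_openStrip.mem_nhds hw)
  rcases eq_or_ne t 0 with rfl | ht
  · have hs : HasStrictDerivAt φ (deriv φ z) z :=
      (hφ.analyticAt (isOpen_openStrip.mem_nhds hz)).hasStrictDerivAt
    have hc : ContinuousAt (deriv φ) z :=
      (hφ.analyticAt (isOpen_openStrip.mem_nhds hz)).deriv.continuousAt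
    have hval : horizontalSlope φ (z, 0) = deriv φ z := by simp [horizontalSlope]
    rw [Metric.continuousAt_iff', hval]
    intro ε hε
    have h1 : ∀ᶠ p : ℂ × ℝ in 𝓝 (z, 0), dist (deriv φ p.1) (deriv φ z) < ε :=
      (continuous_fst.tendsto (z, (0 : ℝ))).eventually (Metric.continuousAt_iff'.mp hc ε hε)
    have h2 : ∀ᶠ q : ℂ × ℂ in 𝓝 (z, z), ‖φ q.1 - φ q.2 - (q.1 - q.2) * deriv φ z‖ ≤
        ε / 2 * ‖q.1 - q.2‖ := by
      have := hs.hasStrictFDerivAt.isLittleO.def (half_pos hε)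
      filter_upwards [this] with q hq
      simpa using hq
    have h3 : Tendsto (fun p : ℂ × ℝ => (p.1 + p.2, p.1)) (𝓝 (z, 0)) (𝓝 (z, z)) := by
      have : Continuous fun p : ℂ × ℝ => (p.1 + p.2, p.1) := by fun_prop
      simpa using this.tendsto (z, (0 : ℝ))
    filter_upwards [h1, h3.eventually h2] with p hp1 hp2
    rw [horizontalSlope]
    split_ifs with h0
    · exact hp1
    · have h0' : (p.2 : ℂ) ≠ 0 := by exact_mod_cast h0
      have h4 : 0 < ‖(p.2 : ℂ)‖ := norm_pos_iff.mpr h0'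
      simp only [add_sub_cancel_left] at hp2
      rw [dist_eq_norm, show (φ (p.1 + p.2) - φ p.1) / p.2 - deriv φ z =
        (φ (p.1 + p.2) - φ p.1 - p.2 * deriv φ z) / p.2 by field_simp, norm_div, div_lt_iff₀ h4]
      nlinarith
  · have h1 : ContinuousAt (fun p : ℂ × ℝ => (φ (p.1 + p.2) - φ p.1) / p.2) (z, t) := by
      have ht' : (t : ℂ) ≠ 0 := by exact_mod_cast ht
      have e1 : ContinuousAt (fun p : ℂ × ℝ => φ (p.1 + p.2)) (z, t) :=
        ContinuousAt.comp (f := fun p : ℂ × ℝ => p.1 + p.2) (g := φ)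
          (hd _ (add_ofReal_mem_openStrip hz t)).continuousAt (by fun_prop)
      have e2 : ContinuousAt (fun p : ℂ × ℝ => φ p.1) (z, t) :=
        ContinuousAt.comp (f := fun p : ℂ × ℝ => p.1) (g := φ)
          (hd _ hz).continuousAt (by fun_prop)
      exact (e1.sub e2).div (by fun_prop) ht'
    refine h1.congr ?_
    have h2 : ∀ᶠ p : ℂ × ℝ in 𝓝 (z, t), p.2 ≠ 0 :=
      (continuous_snd.tendsto (z, t)).eventually (eventually_ne_nhds ht)
    filter_upwards [h2] with p hp
    rw [horizontalSlope, if_neg hp]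

/-- The derivative of the uniformization map has a single-valued logarithm on the cylinder. -/
theorem IsUniformization.exists_log_deriv (hc : 0 < c) (hφ : IsUniformization Ω c φ) :
    ∃ L : ℂ → ℂ, DifferentiableOn ℂ L openStrip ∧ (∀ z ∈ openStrip, exp (L z) = deriv φ z) ∧
      ∀ z ∈ openStrip, L (z + c) = L z := by
  have hcne : (c : ℂ) ≠ 0 := by exact_mod_cast hc.ne'
  have hconv : Convex ℝ (openStrip ×ˢ (univ : Set ℝ)) := (convex_hStrip _ _).prod convex_univ
  have hne : openStrip.Nonempty := ⟨Real.pi / 2 * I, by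
    simp [openStrip, Real.pi_pos, half_lt_self Real.pi_pos]⟩
  have hsc : IsSimplyConnected (openStrip ×ˢ (univ : Set ℝ)) := by
    have := hconv.contractibleSpace (hne.prod univ_nonempty)
    exact SimplyConnectedSpace.ofContractible _
  have hopen : IsOpen (openStrip ×ˢ (univ : Set ℝ)) := isOpen_openStrip.prod isOpen_univ
  -- For t ≠ 0 this is injectivity on the lift, for t = 0 it is the nonvanishing of φ'. A continuous
  -- logarithm exists because the strip times ℝ is simply connected.
  have hnz : (0 : ℂ) ∉ horizontalSlope φ '' (openStrip ×ˢ univ) := by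
    rintro ⟨⟨z, t⟩, ⟨hz, -⟩, h0⟩
    have hz : z ∈ openStrip := hz
    rw [horizontalSlope] at h0
    split_ifs at h0 with ht
    · exact hφ.deriv_ne_zero hz h0
    · have ht' : (t : ℂ) ≠ 0 := by exact_mod_cast ht
      rw [div_eq_zero_iff, or_iff_left ht', sub_eq_zero] at h0
      have := hφ.bijOn.injOn (add_ofReal_mem_openStrip hz t) hz h0
      exact ht' (by linear_combination this)
  obtain ⟨l, hl, he⟩ := exists_continuousOn_eqOn_exp_comp hsc hopen
    (continuousOn_horizontalSlope hφ.holomorphic) hnz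
  have he : ∀ z ∈ openStrip, ∀ t : ℝ, exp (l (z, t)) = horizontalSlope φ (z, t) := fun z hz t =>
    he ⟨hz, mem_univ _⟩
  have hl1 : ∀ t : ℝ, ContinuousOn (fun z => l (z, t)) openStrip := fun t =>
    hl.comp (f := fun z : ℂ => (z, t)) (by fun_prop) fun z hz => ⟨hz, mem_univ _⟩
  have hl2 : ∀ z ∈ openStrip, Continuous fun t : ℝ => l (z, t) := fun z hz =>
    hl.comp_continuous (f := fun t : ℝ => (z, t)) (by fun_prop) fun t => ⟨hz, mem_univ _⟩
  have hper : ∀ z ∈ openStrip, ∀ t : ℝ,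
      horizontalSlope φ (z + c, t) = horizontalSlope φ (z, t) := by
    intro z hz t
    rw [horizontalSlope, horizontalSlope]
    simp only [hφ.deriv_add_period hz]
    rw [add_right_comm, hφ.equivariant _ (add_ofReal_mem_openStrip hz t), hφ.equivariant _ hz,
      add_sub_add_right_eq_sub]
  have hmul : ∀ z ∈ openStrip, ∀ t : ℝ, exp (l (z + c, t) - l (z, t)) = 1 := by
    intro z hz t
    rw [exp_sub, he _ (add_ofReal_mem_openStrip hz c), hper z hz, ← he z hz,
      div_self (exp_ne_zero _)]
  -- At t = c the slope is the constant 1/c, so its logarithm has no monodromy around the cylinder.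
  -- The monodromy is an integer multiple of 2πi depending continuously on t, so it is also zero at
  -- t = 0, where the slope is φ'.
  have hend : ∀ z ∈ openStrip, l (z + c, c) = l (z, c) := by
    intro z hz
    have hslope : ∀ w ∈ openStrip, horizontalSlope φ (w, c) = 1 / c := fun w hw => by
      rw [horizontalSlope, if_neg hc.ne', hφ.equivariant w hw, add_sub_cancel_left]
    have := eqOn_const_of_exp_eq_one (s := openStrip) (convex_hStrip _ _).isPreconnected
      (f := fun w => l (w, c) - l (z, c)) ((hl1 c).sub continuousOn_const) (fun w hw => by
        rw [exp_sub, he w hw, he z hz, hslope w hw, hslope z hz, div_self (by simp [hcne])])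
      (add_ofReal_mem_openStrip hz c) hz
    simp only [sub_self] at this
    exact sub_eq_zero.mp this
  refine ⟨fun z => l (z, 0), fun z hz => ?_, fun z hz => ?_, fun z hz => ?_⟩
  · refine DifferentiableAt.differentiableWithinAt ?_
    have hnb := isOpen_openStrip.mem_nhds hz
    refine hasDerivAt_of_exp ((hl1 0).continuousAt hnb)
      (hφ.holomorphic.analyticAt hnb).deriv.differentiableAt ?_
    filter_upwards [hnb] with w hw
    rw [he w hw, horizontalSlope, if_pos rfl]
  · rw [he z hz, horizontalSlope, if_pos rfl]
  · have := eqOn_const_of_exp_eq_one (s := (univ : Set ℝ)) isPreconnected_univ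
      (f := fun t => l (z + c, t) - l (z, t))
      ((hl2 _ (add_ofReal_mem_openStrip hz c)).sub (hl2 z hz)).continuousOn
      (fun t _ => hmul z hz t) (mem_univ 0) (mem_univ c)
    simp only [hend z hz, sub_self] at this
    exact sub_eq_zero.mp this

end uniformization

/-! ### The covering map of the cylinder -/

theorem continuous_cylProj : Continuous cylProj := by
  unfold cylProj
  fun_prop

theorem isOpenMap_cylProj : IsOpenMap cylProj := by
  have h1 : IsOpenMap (fun x : ℝ => (x : UnitAddCircle)) := QuotientAddGroup.isOpenMap_coe
  have h2 := h1.prodMap (IsOpenMap.id (X := ℝ))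
  have h3 := equivRealProdCLM.toHomeomorph.isOpenMap
  exact h2.comp h3

theorem cylProj_eq_iff {w w' : ℂ} : cylProj w = cylProj w' ↔ ∃ m : ℤ, w' = w + m := by
  unfold cylProj
  rw [Prod.mk.injEq, eq_comm, ← sub_eq_zero, ← AddCircle.coe_sub, AddCircle.coe_eq_zero_iff]
  constructor
  · rintro ⟨⟨m, hm⟩, h⟩
    refine ⟨m, Complex.ext ?_ ?_⟩
    · simp only [zsmul_eq_mul, mul_one] at hm
      simp [hm]
    · simp [h]
  · rintro ⟨m, rfl⟩
    exact ⟨⟨m, by simp⟩, by simp⟩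

theorem cylProj_add_int (w : ℂ) (m : ℤ) : cylProj (w + m) = cylProj w :=
  (cylProj_eq_iff.mpr ⟨m, rfl⟩).symm

theorem cylProj_surjective : Function.Surjective cylProj := by
  rintro ⟨x, y⟩
  obtain ⟨x, rfl⟩ := QuotientAddGroup.mk_surjective x
  exact ⟨⟨x, y⟩, rfl⟩

theorem mem_cylLift_add_int {Ω : Set Cylinder} {w : ℂ} (m : ℤ) :
    w + m ∈ cylLift Ω ↔ w ∈ cylLift Ω := by
  simp only [cylLift, mem_preimage, cylProj_add_int]

/-! ### The complement of a cylindrical domain -/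

section ends

variable {Ω : Set Cylinder} {c : ℝ} {φ : ℂ → ℂ}

theorem isClosed_connectedComponentIn {X : Type*} [TopologicalSpace X] {F : Set X}
    (hF : IsClosed F) (x : X) : IsClosed (connectedComponentIn F x) := by
  by_cases hx : x ∈ F
  · refine closure_subset_iff_isClosed.mp ?_
    exact isPreconnected_connectedComponentIn.closure.subset_connectedComponentIn
      (subset_closure (mem_connectedComponentIn hx))
      (closure_minimal (connectedComponentIn_subset F x) hF)
  · rw [connectedComponentIn_eq_empty hx]
    exact isClosed_empty

/-- Boundedness of Ω puts a whole half-cylinder into one component of the complement, and every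
component reaching arbitrarily low meets it. -/
theorem IsCylindricalDomain.lowerComplement_eq (hΩ : IsCylindricalDomain Ω) :
    ∃ q ∈ Ωᶜ, lowerComplement Ω = connectedComponentIn Ωᶜ q := by
  obtain ⟨R, hR⟩ := hΩ.bounded
  set B : Set Cylinder := univ ×ˢ Iio (-R) with hB
  have hBc : IsPreconnected B := isPreconnected_univ.prod isPreconnected_Iio
  have hBΩ : B ⊆ Ωᶜ := fun p hp hpΩ => by
    have h1 : p.2 < -R := hp.2
    linarith [(abs_le.mp (hR p hpΩ)).1]
  have hq : ((0, -R - 1) : Cylinder) ∈ B := ⟨mem_univ _, by simp⟩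
  have hsub := hBc.subset_connectedComponentIn hq hBΩ
  refine ⟨(0, -R - 1), hBΩ hq, Subset.antisymm (fun p hp => ?_) fun p hp => ?_⟩
  · obtain ⟨hp1, hp2⟩ := hp
    obtain ⟨q, hq1, hq2⟩ := hp2 (-R)
    have hqB : q ∈ B := ⟨mem_univ _, hq2⟩
    rw [connectedComponentIn_eq (hsub hqB), ← connectedComponentIn_eq hq1]
    exact mem_connectedComponentIn hp1
  · refine ⟨connectedComponentIn_subset _ _ hp, fun S => ?_⟩
    rw [← connectedComponentIn_eq hp]
    refine ⟨(0, min S (-R) - 1), hsub ⟨mem_univ _, ?_⟩, ?_⟩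
    · show min S (-R) - 1 < -R
      linarith [min_le_right S (-R)]
    · show min S (-R) - 1 < S
      linarith [min_le_left S (-R)]

theorem IsCylindricalDomain.upperComplement_eq (hΩ : IsCylindricalDomain Ω) :
    ∃ q ∈ Ωᶜ, upperComplement Ω = connectedComponentIn Ωᶜ q := by
  obtain ⟨R, hR⟩ := hΩ.bounded
  set B : Set Cylinder := univ ×ˢ Ioi R with hB
  have hBc : IsPreconnected B := isPreconnected_univ.prod isPreconnected_Ioi
  have hBΩ : B ⊆ Ωᶜ := fun p hp hpΩ => by
    have h1 : R < p.2 := hp.2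
    linarith [(abs_le.mp (hR p hpΩ)).2]
  have hq : ((0, R + 1) : Cylinder) ∈ B := ⟨mem_univ _, by simp⟩
  have hsub := hBc.subset_connectedComponentIn hq hBΩ
  refine ⟨(0, R + 1), hBΩ hq, Subset.antisymm (fun p hp => ?_) fun p hp => ?_⟩
  · obtain ⟨hp1, hp2⟩ := hp
    obtain ⟨q, hq1, hq2⟩ := hp2 R
    have hqB : q ∈ B := ⟨mem_univ _, hq2⟩
    rw [connectedComponentIn_eq (hsub hqB), ← connectedComponentIn_eq hq1]
    exact mem_connectedComponentIn hp1
  · refine ⟨connectedComponentIn_subset _ _ hp, fun S => ?_⟩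
    rw [← connectedComponentIn_eq hp]
    refine ⟨(0, max S R + 1), hsub ⟨mem_univ _, ?_⟩, ?_⟩
    · show R < max S R + 1
      linarith [le_max_right S R]
    · show S < max S R + 1
      linarith [le_max_left S R]

theorem IsCylindricalDomain.isClosed_lowerComplement (hΩ : IsCylindricalDomain Ω) :
    IsClosed (lowerComplement Ω) := by
  obtain ⟨q, -, h⟩ := hΩ.lowerComplement_eq
  rw [h]
  exact isClosed_connectedComponentIn hΩ.isOpen.isClosed_compl q

theorem IsCylindricalDomain.isClosed_upperComplement (hΩ : IsCylindricalDomain Ω) :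
    IsClosed (upperComplement Ω) := by
  obtain ⟨q, -, h⟩ := hΩ.upperComplement_eq
  rw [h]
  exact isClosed_connectedComponentIn hΩ.isOpen.isClosed_compl q

theorem IsCylindricalDomain.lowerComplement_nonempty (hΩ : IsCylindricalDomain Ω) :
    (lowerComplement Ω).Nonempty := by
  obtain ⟨q, hq, h⟩ := hΩ.lowerComplement_eq
  rw [h]
  exact ⟨q, mem_connectedComponentIn hq⟩

theorem IsCylindricalDomain.upperComplement_nonempty (hΩ : IsCylindricalDomain Ω) :
    (upperComplement Ω).Nonempty := by
  obtain ⟨q, hq, h⟩ := hΩ.upperComplement_eq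
  rw [h]
  exact ⟨q, mem_connectedComponentIn hq⟩

theorem IsUniformization.equivariant_int (hφ : IsUniformization Ω c φ) {z : ℂ}
    (hz : z ∈ openStrip) (m : ℤ) : φ (z + m * c) = φ z + m := by
  have hmem : ∀ m : ℤ, z + m * c ∈ openStrip := fun m => by
    have := add_ofReal_mem_openStrip hz (m * c)
    push_cast at this
    exact this
  induction m with
  | zero => simp
  | succ k ih =>
    rw [show z + ((k + 1 : ℤ) : ℂ) * c = z + (k : ℤ) * c + c by push_cast; ring,
      hφ.equivariant _ (hmem _), ih]
    push_cast
    ring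
  | pred k ih =>
    have := hφ.equivariant _ (hmem (-k - 1))
    rw [show z + ((-k - 1 : ℤ) : ℂ) * c + c = z + (-k : ℤ) * c by push_cast; ring, ih] at this
    rw [← sub_eq_iff_eq_add] at this
    rw [← this]
    push_cast
    ring

/-- Points of the strip close to its boundary are mapped close to the complement. -/
theorem IsUniformization.exists_near_boundary (hΩ : IsCylindricalDomain Ω)
    (hφ : IsUniformization Ω c φ) {V : Set Cylinder} (hV : IsOpen V) (hVΩ : Ωᶜ ⊆ V) :
    ∃ δ > 0, ∀ z ∈ openStrip, (z.im < δ ∨ Real.pi - δ < z.im) → cylProj (φ z) ∈ V := by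
  obtain ⟨R, hR⟩ := hΩ.bounded
  -- Up to integer translations, the points of Ω outside V form a compact set, on which the height
  -- of the preimage attains its bounds strictly inside (0, π).
  set K : Set ℂ := {w | w.re ∈ Icc (0 : ℝ) 1 ∧ cylProj w ∉ V} with hK
  have hKlift : K ⊆ cylLift Ω := fun w hw => by
    by_contra h
    exact hw.2 (hVΩ h)
  have hKc : IsCompact K := by
    refine Metric.isCompact_of_isClosed_isBounded ?_ ?_
    · exact (isClosed_Icc.preimage continuous_re).inter
        (hV.isClosed_compl.preimage continuous_cylProj)
    · refine (Metric.isBounded_Icc (0 : ℝ) 1).reProdIm (Metric.isBounded_Icc (-R) R) |>.subset ?_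
      intro w hw
      exact ⟨hw.1, abs_le.mp (hR _ (hKlift hw))⟩
  set ψ := Function.invFunOn φ openStrip
  have hψ : ∀ z ∈ openStrip, ψ (φ z) = z := fun z hz => hφ.bijOn.injOn.leftInvOn_invFunOn hz
  have hψc : ContinuousOn (fun w => (ψ w).im) K := by
    intro w hw
    obtain ⟨z, hz, rfl⟩ := hφ.bijOn.surjOn (hKlift hw)
    exact (continuous_im.continuousAt.comp
      (continuousAt_invFunOn isOpen_openStrip hφ.holomorphic hφ.bijOn.injOn hz)).continuousWithinAt
  have hbound : ∃ δ > 0, ∀ w ∈ K, δ ≤ (ψ w).im ∧ (ψ w).im ≤ Real.pi - δ := by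
    rcases K.eq_empty_or_nonempty with h | h
    · exact ⟨1, one_pos, by simp [h]⟩
    obtain ⟨a, ha, ha'⟩ := hKc.exists_isMinOn h hψc
    obtain ⟨b, hb, hb'⟩ := hKc.exists_isMaxOn h hψc
    have hs : ∀ w ∈ K, ψ w ∈ openStrip := fun w hw => by
      obtain ⟨z, hz, rfl⟩ := hφ.bijOn.surjOn (hKlift hw)
      rwa [hψ z hz]
    have h1 := (hs a ha).1
    have h2 := (hs b hb).2
    refine ⟨min (ψ a).im (Real.pi - (ψ b).im), lt_min h1 (by linarith), fun w hw => ?_⟩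
    have h3 : (ψ a).im ≤ (ψ w).im := ha' hw
    have h4 : (ψ w).im ≤ (ψ b).im := hb' hw
    exact ⟨(min_le_left _ _).trans h3, by linarith [min_le_right (ψ a).im (Real.pi - (ψ b).im)]⟩
  obtain ⟨δ, hδ, hb⟩ := hbound
  refine ⟨δ, hδ, fun z hz hzδ => ?_⟩
  by_contra hzV
  set m : ℤ := -⌊(φ z).re⌋ with hm
  have hmz : z + m * c ∈ openStrip := by
    have := add_ofReal_mem_openStrip hz (m * c)
    push_cast at this
    exact this
  have hk : φ (z + m * c) ∈ K := by
    rw [hφ.equivariant_int hz]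
    refine ⟨?_, by rwa [cylProj_add_int]⟩
    rw [add_re, intCast_re, hm]
    push_cast
    exact ⟨by linarith [Int.floor_le (φ z).re], by linarith [Int.lt_floor_add_one (φ z).re]⟩
  have h1 := hb _ hk
  rw [hψ _ hmz] at h1
  have h2 : (z + m * c).im = z.im := by simp
  rw [h2] at h1
  rcases hzδ with h | h <;> linarith

/-- Along the end `l` of the strip, `φ` approaches the set `X`. -/
def EndsIn (φ : ℂ → ℂ) (l : Filter ℝ) (X : Set Cylinder) : Prop :=
  ∀ V : Set Cylinder, IsOpen V → X ⊆ V →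
    ∀ᶠ y : ℝ in l, ∀ x : ℝ, cylProj (φ (x + y * I)) ∈ V

/-- A rough localization improves itself: close to the edge the image lies in (V ∩ V₁) ∪ V₂, and
being already in V₁ it avoids V₂. -/
theorem EndsIn.of_eventually {l : Filter ℝ} {X₁ X₂ V₁ V₂ : Set Cylinder}
    (hΩ : IsCylindricalDomain Ω) (hφ : IsUniformization Ω c φ)
    (hl : ∀ δ > 0, ∀ᶠ y : ℝ in l, (0 < y ∧ y < Real.pi) ∧ (y < δ ∨ Real.pi - δ < y))
    (hX : Ωᶜ ⊆ X₁ ∪ X₂) (hV₁ : IsOpen V₁) (hV₂ : IsOpen V₂) (h1 : X₁ ⊆ V₁) (h2 : X₂ ⊆ V₂)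
    (hd : Disjoint V₁ V₂) (hev : ∀ᶠ y : ℝ in l, ∀ x : ℝ, cylProj (φ (x + y * I)) ∈ V₁) :
    EndsIn φ l X₁ := by
  intro V hV hXV
  obtain ⟨δ, hδ, hb⟩ := hφ.exists_near_boundary hΩ ((hV.inter hV₁).union hV₂)
    (hX.trans (union_subset_union (subset_inter hXV h1) h2))
  filter_upwards [hl δ hδ, hev] with y hy1 hy2 x
  have := hb (x + y * I) (by simpa [openStrip] using hy1.1) (by simpa using hy1.2)
  rcases this with h | h
  · exact h.1
  · exact absurd h (disjoint_left.mp hd (hy2 x))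

/-- If both ends approached X₁, then X₂ would be V₂ minus the image of a compact set, hence open as
well as closed in the connected cylinder. -/
theorem IsUniformization.not_both_ends {X₁ X₂ V₁ V₂ : Set Cylinder} (hc : 0 < c)
    (hφ : IsUniformization Ω c φ) (hX : Ωᶜ = X₁ ∪ X₂) (hX₂ : IsClosed X₂) (hn₁ : X₁.Nonempty)
    (hn₂ : X₂.Nonempty) (hV₂ : IsOpen V₂) (h1 : X₁ ⊆ V₁) (h2 : X₂ ⊆ V₂) (hd : Disjoint V₁ V₂)
    {δ : ℝ} (hδ : 0 < δ)
    (hb : ∀ z ∈ openStrip, (z.im < δ ∨ Real.pi - δ < z.im) → cylProj (φ z) ∈ V₁) : False := by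
  set K : Set ℂ := Icc 0 c ×ℂ Icc δ (Real.pi - δ) with hK
  have hKs : K ⊆ openStrip := fun z hz =>
    ⟨hδ.trans_le hz.2.1, hz.2.2.trans_lt (by linarith)⟩
  have hKc : IsCompact K := isCompact_Icc.reProdIm isCompact_Icc
  have hcont : ContinuousOn (fun z => cylProj (φ z)) K :=
    continuous_cylProj.comp_continuousOn (hφ.holomorphic.continuousOn.mono hKs)
  have hZ := (hKc.image_of_continuousOn hcont).isClosed
  have hX₂Ω : X₂ ⊆ Ωᶜ := hX ▸ subset_union_right
  have heq : X₂ = V₂ \ (fun z => cylProj (φ z)) '' K := by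
    refine Subset.antisymm (fun p hp => ⟨h2 hp, ?_⟩) fun p hp => ?_
    · rintro ⟨z, hz, rfl⟩
      exact hX₂Ω hp (hφ.bijOn.mapsTo (hKs hz))
    · by_contra hp2
      have hpΩ : p ∈ Ω := by
        by_contra h
        have : p ∈ X₁ ∪ X₂ := hX ▸ h
        rcases this with h | h
        · exact disjoint_left.mp hd (h1 h) hp.1
        · exact hp2 h
      obtain ⟨w, rfl⟩ := cylProj_surjective p
      obtain ⟨z, hz, rfl⟩ := hφ.bijOn.surjOn (show w ∈ cylLift Ω from hpΩ)
      set m : ℤ := -⌊z.re / c⌋ with hm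
      have hmz : z + m * c ∈ openStrip := by
        have := add_ofReal_mem_openStrip hz (m * c)
        push_cast at this
        exact this
      have hpz : cylProj (φ (z + m * c)) = cylProj (φ z) := by
        rw [hφ.equivariant_int hz, cylProj_add_int]
      refine hp.2 ⟨z + m * c, ⟨?_, ?_⟩, hpz⟩
      · have e : (z + m * c).re = z.re - ⌊z.re / c⌋ * c := by
          rw [hm]; simp; ring
        have h3 := Int.floor_le (z.re / c)
        have h4 := Int.lt_floor_add_one (z.re / c)
        rw [le_div_iff₀ hc] at h3
        rw [div_lt_iff₀ hc] at h4
        rw [mem_preimage, e]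
        exact ⟨by linarith, by linarith⟩
      · have e : (z + m * c).im = z.im := by simp
        rw [mem_preimage, e]
        by_contra hcon
        rw [mem_Icc, not_and_or, not_le, not_le] at hcon
        exact disjoint_left.mp hd (hb z hz hcon) hp.1
  have hclopen : IsClopen X₂ := ⟨hX₂, heq ▸ hV₂.sdiff hZ⟩
  rcases isClopen_iff.mp hclopen with h | h
  · exact hn₂.ne_empty h
  · obtain ⟨p, hp⟩ := hn₁
    exact disjoint_left.mp hd (h1 hp) (h2 (h ▸ mem_univ p))

theorem eventually_bottom_end : ∀ δ > 0, ∀ᶠ y : ℝ in 𝓝[>] (0 : ℝ),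
    (0 < y ∧ y < Real.pi) ∧ (y < δ ∨ Real.pi - δ < y) := fun δ hδ => by
  filter_upwards [Ioo_mem_nhdsGT Real.pi_pos, Ioo_mem_nhdsGT hδ] with y h1 h2
  exact ⟨h1, Or.inl h2.2⟩

theorem eventually_top_end : ∀ δ > 0, ∀ᶠ y : ℝ in 𝓝[<] Real.pi,
    (0 < y ∧ y < Real.pi) ∧ (y < δ ∨ Real.pi - δ < y) := fun δ hδ => by
  filter_upwards [Ioo_mem_nhdsLT Real.pi_pos,
    Ioo_mem_nhdsLT (show Real.pi - δ < Real.pi by linarith)] with y h1 h2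
  exact ⟨h1, Or.inr h2.1⟩

/-- Each of the two ends of the strip corresponds to one of the boundary components. -/
theorem IsUniformization.endsIn (hΩ : IsCylindricalDomain Ω) (hφ : IsUniformization Ω c φ)
    (hc : 0 < c) :
    (EndsIn φ (𝓝[>] 0) (lowerComplement Ω) ∧ EndsIn φ (𝓝[<] Real.pi) (upperComplement Ω)) ∨
    (EndsIn φ (𝓝[>] 0) (upperComplement Ω) ∧ EndsIn φ (𝓝[<] Real.pi) (lowerComplement Ω)) := by
  have hpi := Real.pi_pos
  obtain ⟨V₁, V₂, hV₁, hV₂, hl, hu, hd⟩ := normal_separation hΩ.isClosed_lowerComplement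
    hΩ.isClosed_upperComplement hΩ.disjoint
  have hX := hΩ.compl_eq
  have hX' : Ωᶜ = upperComplement Ω ∪ lowerComplement Ω := by rw [hX, union_comm]
  obtain ⟨δ, hδ, hb⟩ := hφ.exists_near_boundary hΩ (hV₁.union hV₂)
    (hX ▸ union_subset_union hl hu)
  -- The image of a collar is connected and covered by disjoint open sets, so it lies in one of
  -- them.
  have hend : ∀ a d, 0 ≤ a → d ≤ Real.pi → (d ≤ δ ∨ Real.pi - δ ≤ a) →
      (∀ z ∈ hStrip a d, cylProj (φ z) ∈ V₁) ∨ (∀ z ∈ hStrip a d, cylProj (φ z) ∈ V₂) := by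
    intro a d ha hd' had
    have hsub : hStrip a d ⊆ openStrip := hStrip_mono ha hd'
    have hB : IsPreconnected ((fun z => cylProj (φ z)) '' hStrip a d) :=
      (convex_hStrip a d).isPreconnected.image _
        (continuous_cylProj.comp_continuousOn (hφ.holomorphic.continuousOn.mono hsub))
    have hBV : (fun z => cylProj (φ z)) '' hStrip a d ⊆ V₁ ∪ V₂ := by
      rintro _ ⟨z, hz, rfl⟩
      exact hb z (hsub hz) (had.imp (fun h => hz.2.trans_le h) fun h => h.trans_lt hz.1)
    have := isPreconnected_iff_subset_of_disjoint.mp hB V₁ V₂ hV₁ hV₂ hBV (by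
      rw [hd.inter_eq, inter_empty])
    exact this.imp image_subset_iff.mp image_subset_iff.mp
  have hevb : ∀ V : Set Cylinder, (∀ z ∈ hStrip 0 (min δ Real.pi), cylProj (φ z) ∈ V) →
      ∀ᶠ y : ℝ in 𝓝[>] (0 : ℝ), ∀ x : ℝ, cylProj (φ (x + y * I)) ∈ V := fun V hV => by
    filter_upwards [Ioo_mem_nhdsGT (lt_min hδ hpi)] with y hy x
    exact hV _ (by simpa [hStrip] using hy)
  have hevt : ∀ V : Set Cylinder, (∀ z ∈ hStrip (max (Real.pi - δ) 0) Real.pi,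
      cylProj (φ z) ∈ V) →
      ∀ᶠ y : ℝ in 𝓝[<] Real.pi, ∀ x : ℝ, cylProj (φ (x + y * I)) ∈ V := fun V hV => by
    filter_upwards [Ioo_mem_nhdsLT (max_lt (show Real.pi - δ < Real.pi by linarith) hpi)]
      with y hy x
    exact hV _ (by simpa [hStrip] using hy)
  have hboth : ∀ V : Set Cylinder, (∀ z ∈ hStrip 0 (min δ Real.pi), cylProj (φ z) ∈ V) →
      (∀ z ∈ hStrip (max (Real.pi - δ) 0) Real.pi, cylProj (φ z) ∈ V) →
      ∀ z ∈ openStrip, (z.im < δ ∨ Real.pi - δ < z.im) → cylProj (φ z) ∈ V := by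
    intro V h1 h2 z hz h
    rcases h with h | h
    · exact h1 z ⟨hz.1, lt_min h hz.2⟩
    · exact h2 z ⟨max_lt h hz.1, hz.2⟩
  rcases hend 0 (min δ Real.pi) le_rfl (min_le_right _ _) (Or.inl (min_le_left _ _)) with h1 | h1 <;>
  rcases hend (max (Real.pi - δ) 0) Real.pi (le_max_right _ _) le_rfl (Or.inr (le_max_left _ _))
    with h2 | h2
  · exact (hφ.not_both_ends hc hX hΩ.isClosed_upperComplement hΩ.lowerComplement_nonempty
      hΩ.upperComplement_nonempty hV₂ hl hu hd hδ (hboth _ h1 h2)).elim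
  · exact Or.inl ⟨.of_eventually hΩ hφ eventually_bottom_end hX.subset hV₁ hV₂ hl hu hd (hevb _ h1),
      .of_eventually hΩ hφ eventually_top_end hX'.subset hV₂ hV₁ hu hl hd.symm (hevt _ h2)⟩
  · exact Or.inr ⟨.of_eventually hΩ hφ eventually_bottom_end hX'.subset hV₂ hV₁ hu hl hd.symm
      (hevb _ h1), .of_eventually hΩ hφ eventually_top_end hX.subset hV₁ hV₂ hl hu hd (hevt _ h2)⟩
  · exact (hφ.not_both_ends hc hX' hΩ.isClosed_lowerComplement hΩ.upperComplement_nonempty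
      hΩ.lowerComplement_nonempty hV₁ hu hl hd.symm hδ (hboth _ h1 h2)).elim

/-- A function on the twofold covering that vanishes on the boundary in the sense of limits is
uniformly small near the boundary. -/
theorem exists_nhds_boundary_small {X : Set Cylinder} (hΩ : IsOpen Ω) (hX : X ⊆ Ωᶜ) {h : ℂ → ℝ}
    (hper : ∀ w ∈ cylLift Ω, h (w + 2) = h w)
    (hlim : ∀ w, cylProj w ∈ frontier Ω ∩ X → Tendsto h (𝓝[cylLift Ω] w) (𝓝 0))
    {ε : ℝ} (hε : 0 < ε) :
    ∃ V : Set Cylinder, IsOpen V ∧ X ⊆ V ∧ ∀ w ∈ cylLift Ω, cylProj w ∈ V → |h w| ≤ ε := by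
  have hper' : ∀ w ∈ cylLift Ω, ∀ m : ℤ, h (w + 2 * m) = h w := by
    intro w hw m
    have hmem : ∀ m : ℤ, w + 2 * m ∈ cylLift Ω := fun m => by
      have := (mem_cylLift_add_int (2 * m)).mpr hw
      push_cast at this
      exact this
    induction m with
    | zero => simp
    | succ k ih =>
      rw [← ih, ← hper _ (hmem k)]
      push_cast
      ring_nf
    | pred k ih =>
      rw [← ih, ← hper _ (hmem (-k - 1))]
      push_cast
      ring_nf
  set Gd : Set Cylinder := {p | ∀ w, cylProj w = p → w ∈ cylLift Ω → |h w| ≤ ε} with hGd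
  refine ⟨interior Gd, isOpen_interior, fun p hp => ?_, fun w hw hwV =>
    interior_subset hwV w rfl hw⟩
  rw [mem_interior_iff_mem_nhds]
  by_cases hcl : p ∈ closure Ω
  · have hfr : p ∈ frontier Ω ∩ X := ⟨⟨hcl, by rw [hΩ.interior_eq]; exact hX hp⟩, hp⟩
    obtain ⟨w₀, rfl⟩ := cylProj_surjective p
    have hsmall : ∀ w₁, cylProj w₁ ∈ frontier Ω ∩ X →
        ∀ᶠ w in 𝓝 w₁, w ∈ cylLift Ω → |h w| ≤ ε := fun w₁ hw₁ => by
      rw [← eventually_nhdsWithin_iff]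
      have := (hlim w₁ hw₁).abs
      rw [abs_zero] at this
      filter_upwards [this.eventually (gt_mem_nhds hε)] with w hw using hw.le
    have e1 := hsmall w₀ hfr
    -- Since h has period 2 on the lift, the neighbourhoods of two consecutive lifts of a boundary
    -- point control all of them.
    have e2 : ∀ᶠ w in 𝓝 w₀, w + 1 ∈ cylLift Ω → |h (w + 1)| ≤ ε := by
      have := hsmall (w₀ + 1) (by
        have := cylProj_add_int w₀ 1
        rw [Int.cast_one] at this
        rwa [this])
      exact ((continuous_add_const (1 : ℂ)).tendsto w₀).eventually this
    refine mem_of_superset (isOpenMap_cylProj.image_mem_nhds (e1.and e2)) ?_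
    rintro _ ⟨w, ⟨hw1, hw2⟩, rfl⟩ w' hw' hwΩ
    obtain ⟨m, rfl⟩ := cylProj_eq_iff.mp hw'.symm
    rw [mem_cylLift_add_int] at hwΩ
    rcases Int.even_or_odd' m with ⟨k, rfl | rfl⟩
    · push_cast
      rw [hper' w hwΩ]
      exact hw1 hwΩ
    · have hw1' : w + 1 ∈ cylLift Ω := by
        have := (mem_cylLift_add_int 1).mpr hwΩ
        rwa [Int.cast_one] at this
      push_cast
      rw [show w + (2 * (k : ℂ) + 1) = w + 1 + 2 * k by ring, hper' _ hw1']
      exact hw2 hw1'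
  · refine mem_of_superset (isClosed_closure.isOpen_compl.mem_nhds hcl) ?_
    intro q hq w hw hwΩ
    exact absurd (subset_closure (show q ∈ Ω from hw ▸ hwΩ)) hq

theorem EndsIn.eventually_small {X : Set Cylinder} {l : Filter ℝ} (hE : EndsIn φ l X)
    (hl : ∀ᶠ y : ℝ in l, 0 < y ∧ y < Real.pi) (hφ : IsUniformization Ω c φ)
    (hΩ : IsOpen Ω) (hX : X ⊆ Ωᶜ) {h : ℂ → ℝ}
    (hper : ∀ w ∈ cylLift Ω, h (w + 2) = h w)
    (hlim : ∀ w, cylProj w ∈ frontier Ω ∩ X → Tendsto h (𝓝[cylLift Ω] w) (𝓝 0)) :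
    ∀ ε > (0 : ℝ), ∀ᶠ y : ℝ in l, ∀ x : ℝ, |h (φ (x + y * I))| ≤ ε := by
  intro ε hε
  obtain ⟨V, hV, hXV, hVs⟩ := exists_nhds_boundary_small hΩ hX hper hlim hε
  filter_upwards [hE V hV hXV, hl] with y h1 h2 x
  exact hVs _ (hφ.bijOn.mapsTo (by simpa [openStrip] using h2)) (h1 x)

/-- Near the end of the strip that is mapped to the top boundary component, the solution of the
boundary value problem has a periodic primitive with vanishing imaginary part on the boundary. -/
theorem SolvesBVP.exists_primitive {η z₁ : ℂ} {F : ℂ → ℂ} (hF : SolvesBVP Ω η z₁ F)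
    {l : Filter ℝ} (hE : EndsIn φ l (upperComplement Ω))
    (hΩ : IsCylindricalDomain Ω) (hφ : IsUniformization Ω c φ)
    (hl : ∀ P : ℝ → Prop, (∀ᶠ y in l, P y) → ∃ a d, 0 ≤ a ∧ d ≤ Real.pi ∧ a < d ∧
      (∀ᶠ y in l, y ∈ Ioo a d) ∧ ∀ y ∈ Ioo a d, P y) :
    ∃ (a d : ℝ) (g : ℂ → ℂ), 0 ≤ a ∧ d ≤ Real.pi ∧ a < d ∧ (∀ᶠ y in l, y ∈ Ioo a d) ∧
      (∀ z ∈ hStrip a d, HasDerivAt g (F (φ z) * deriv φ z) z ∧ g (z + (2 * c : ℝ)) = g z) ∧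
      ∀ ε > (0 : ℝ), ∀ᶠ y : ℝ in l, ∀ x : ℝ, |(g (x + y * I)).im| ≤ ε := by
  obtain ⟨V, g, hV, hXV, hg, hlim⟩ := hF.top
  have hXc : upperComplement Ω ⊆ Ωᶜ := hΩ.compl_eq ▸ subset_union_right
  have hfr : ∀ p ∈ upperComplement Ω, p ∈ V ∪ (closure Ω)ᶜ := fun p hp => by
    by_cases h : p ∈ closure Ω
    · exact Or.inl (hXV ⟨⟨h, by rw [hΩ.isOpen.interior_eq]; exact hXc hp⟩, hp⟩)
    · exact Or.inr h
  obtain ⟨a, d, ha, hd, had, hev, hP⟩ := hl _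
    (hE _ (hV.union isClosed_closure.isOpen_compl) hfr)
  have hsub : hStrip a d ⊆ openStrip := hStrip_mono ha hd
  have hΩmem : ∀ z ∈ hStrip a d, φ z ∈ cylLift Ω := fun z hz => hφ.bijOn.mapsTo (hsub hz)
  have hmem : ∀ z ∈ hStrip a d, φ z ∈ cylLift (Ω ∩ V) := fun z hz => by
    have h1 := hΩmem z hz
    refine ⟨h1, ?_⟩
    have h2 := hP z.im hz z.re
    rw [re_add_im] at h2
    exact h2.resolve_right fun h => h (subset_closure h1)
  have hsh : ∀ (t : ℝ), ∀ z ∈ hStrip a d, z + t ∈ hStrip a d := fun t z hz => by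
    simpa [hStrip] using hz
  have hder : ∀ z ∈ hStrip a d, HasDerivAt (fun z => g (φ z)) (F (φ z) * deriv φ z) z :=
    fun z hz => (hg _ (hmem z hz)).comp z
      (hφ.holomorphic.differentiableAt (isOpen_openStrip.mem_nhds (hsub hz))).hasDerivAt
  -- By antiperiodicity of F the sum of g∘φ at z + c and at z has zero derivative. Comparing this
  -- constant at z and at z + c yields the period 2c.
  have hsum : ∀ z ∈ hStrip a d, ∀ w ∈ hStrip a d,
      g (φ (z + c)) + g (φ z) = g (φ (w + c)) + g (φ w) := by
    intro z hz w hw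
    have hder2 : ∀ z ∈ hStrip a d,
        HasDerivAt (fun z => g (φ (z + c)) + g (φ z)) 0 z := fun z hz => by
      have h1 := (hder _ (hsh c z hz)).comp_add_const z c
      refine (h1.fun_add (hder z hz)).congr_deriv ?_
      rw [hφ.deriv_add_period (hsub hz), hφ.equivariant z (hsub hz),
        hF.antiperiodic _ (hΩmem z hz)]
      ring
    refine (convex_hStrip a d).is_const_of_fderivWithin_eq_zero (𝕜 := ℂ)
      (f := fun z => g (φ (z + c)) + g (φ z))
      (fun z hz => (hder2 z hz).differentiableAt.differentiableWithinAt) (fun z hz => ?_) hz hw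
    rw [fderivWithin_of_isOpen (isOpen_hStrip a d) hz]
    ext
    simp [(hder2 z hz).deriv]
  have hper : ∀ z ∈ hStrip a d, g (φ (z + (2 * c : ℝ))) = g (φ z) := fun z hz => by
    have := hsum _ (hsh c z hz) z hz
    rw [add_comm] at this
    rw [show z + ((2 * c : ℝ) : ℂ) = z + c + c by push_cast; ring]
    exact add_left_cancel this
  have hφ2 : ∀ z ∈ openStrip, φ (z + (2 * c : ℝ)) = φ z + 2 := fun z hz => by
    have := hφ.equivariant_int hz 2
    push_cast at this ⊢
    exact this
  classical
  -- Truncation is needed because the periodicity of g is known only on the image of the collar.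
  set h : ℂ → ℝ := fun w => if w ∈ φ '' hStrip a d then (g w).im else 0 with hh
  refine ⟨a, d, fun z => g (φ z), ha, hd, had, hev, fun z hz => ⟨hder z hz, hper z hz⟩,
    fun ε hε => ?_⟩
  have hl0 : ∀ᶠ y : ℝ in l, 0 < y ∧ y < Real.pi := by
    filter_upwards [hev] with y hy
    exact ⟨ha.trans_lt hy.1, hy.2.trans_le hd⟩
  have := hE.eventually_small hl0 hφ hΩ.isOpen hXc (h := h) (fun w hw => ?_) (fun w hw => ?_) ε hε
  · filter_upwards [this, hev] with y h1 h2 x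
    have h3 := h1 x
    rw [hh] at h3
    simp only at h3
    rwa [if_pos ⟨_, by simpa [hStrip] using h2, rfl⟩] at h3
  · obtain ⟨z, hz, rfl⟩ := hφ.bijOn.surjOn hw
    have hiff : φ z + 2 ∈ φ '' hStrip a d ↔ φ z ∈ φ '' hStrip a d := by
      have hz2 : z + (2 * c : ℝ) ∈ openStrip := add_ofReal_mem_openStrip hz _
      rw [← hφ2 z hz, hφ.bijOn.injOn.mem_image_iff hsub hz2, hφ.bijOn.injOn.mem_image_iff hsub hz]
      simp [hStrip]
    simp only [hh, hiff]
    split_ifs with h4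
    · rw [hφ.bijOn.injOn.mem_image_iff hsub hz] at h4
      rw [← hφ2 z hz, hper z h4]
    · rfl
  · refine squeeze_zero_norm (fun z => ?_) (a := fun z => |(g z).im|) ?_
    · simp only [hh]
      split_ifs
      · exact le_rfl
      · simp
    · simpa using (hlim w hw).abs

theorem SolvesBVP.eventually_re_small {η z₁ : ℂ} {F : ℂ → ℂ} (hF : SolvesBVP Ω η z₁ F)
    {l : Filter ℝ} (hE : EndsIn φ l (lowerComplement Ω))
    (hΩ : IsCylindricalDomain Ω) (hφ : IsUniformization Ω c φ)
    (hl : ∀ᶠ y : ℝ in l, 0 < y ∧ y < Real.pi) :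
    ∀ ε > (0 : ℝ), ∀ᶠ y : ℝ in l, ∀ x : ℝ, |(F (φ (x + y * I))).re| ≤ ε := by
  refine hE.eventually_small hl hφ hΩ.isOpen (hΩ.compl_eq ▸ subset_union_left)
    (h := fun w => (F w).re) (fun w hw => ?_) hF.bottom
  have h1 := (mem_cylLift_add_int 1).mpr hw
  rw [Int.cast_one] at h1
  rw [show w + 2 = w + 1 + 1 by ring, hF.antiperiodic _ h1, hF.antiperiodic _ hw, neg_neg]

theorem exists_bottom_interval (P : ℝ → Prop) (h : ∀ᶠ y in 𝓝[>] (0 : ℝ), P y) :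
    ∃ a d, 0 ≤ a ∧ d ≤ Real.pi ∧ a < d ∧ (∀ᶠ y in 𝓝[>] (0 : ℝ), y ∈ Ioo a d) ∧
      ∀ y ∈ Ioo a d, P y := by
  obtain ⟨d, hd, hP⟩ := mem_nhdsGT_iff_exists_Ioo_subset.mp h
  have hd' : (0 : ℝ) < min d Real.pi := lt_min hd Real.pi_pos
  exact ⟨0, min d Real.pi, le_rfl, min_le_right _ _, hd', Ioo_mem_nhdsGT hd',
    fun y hy => hP ⟨hy.1, hy.2.trans_le (min_le_left _ _)⟩⟩

theorem exists_top_interval (P : ℝ → Prop) (h : ∀ᶠ y in 𝓝[<] Real.pi, P y) :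
    ∃ a d, 0 ≤ a ∧ d ≤ Real.pi ∧ a < d ∧ (∀ᶠ y in 𝓝[<] Real.pi, y ∈ Ioo a d) ∧
      ∀ y ∈ Ioo a d, P y := by
  obtain ⟨a, ha, hP⟩ := mem_nhdsLT_iff_exists_Ioo_subset.mp h
  have ha' : max a 0 < Real.pi := max_lt ha Real.pi_pos
  exact ⟨max a 0, Real.pi, le_max_right _ _, le_rfl, ha', Ioo_mem_nhdsLT ha',
    fun y hy => hP ⟨(le_max_left _ _).trans_lt hy.1, hy.2⟩⟩

end ends

/-! ### The model solution in the strip and its uniqueness -/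

theorem isBigO_slope {q : ℂ → ℂ} {a : ℂ} (hq : DifferentiableAt ℂ q a) :
    (fun z => (q z - q a) / (z - a)) =O[𝓝[≠] a] fun _ => (1 : ℝ) := by
  have h1 : Tendsto (fun z => (q z - q a) / (z - a)) (𝓝[≠] a) (𝓝 (deriv q a)) := by
    have := hasDerivAt_iff_tendsto_slope.mp hq.hasDerivAt
    exact this.congr fun z => slope_def_field q a z
  exact h1.isBigO_one ℝ

theorem DifferentiableAt.comp_sub_right {f : ℂ → ℂ} {z a : ℂ} (h : DifferentiableAt ℂ f (z - a)) :
    DifferentiableAt ℂ (fun z => f (z - a)) z :=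
  h.comp z (differentiableAt_id.sub_const a)

theorem tendsto_sub_nhdsNE (z a : ℂ) : Tendsto (fun w => w - a) (𝓝[≠] (z + a)) (𝓝[≠] z) := by
  refine tendsto_nhdsWithin_iff.mpr ⟨?_, ?_⟩
  · have := ((continuous_id.sub (continuous_const (y := a))).tendsto (z + a)).mono_left
      (nhdsWithin_le_nhds (s := {z + a}ᶜ))
    simpa [Function.comp_def, Pi.sub_def] using this
  · filter_upwards [self_mem_nhdsWithin] with w hw
    simpa [sub_eq_iff_eq_add] using hw

theorem TopRe.congr {h g : ℂ → ℂ} {a : ℝ} (ha : a < Real.pi) (hh : TopRe h)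
    (he : EqOn h g (hStrip a Real.pi)) : TopRe g := by
  intro ε hε
  filter_upwards [hh ε hε, Ioo_mem_nhdsLT ha] with y h1 h2 x
  rw [← he (by simpa [hStrip] using h2)]
  exact h1 x

theorem TopRe.sub {h g : ℂ → ℂ} (hh : TopRe h) (hg : TopRe g) : TopRe fun z => h z - g z := by
  intro ε hε
  filter_upwards [hh (ε / 2) (by positivity), hg (ε / 2) (by positivity)] with y h1 h2 x
  rw [sub_re]
  refine (abs_sub _ _).trans ?_
  linarith [h1 x, h2 x]

section model

variable {c b : ℝ}

/-- The antiperiodic function in the strip with a simple pole at `z₁`, with vanishing real part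
on the bottom and constant argument (up to sign) on the top of the strip. -/
noncomputable def stripModel (b c : ℝ) (z₁ a z : ℂ) : ℂ :=
  exp (b * z) * (a * ellKernel b c (z - z₁) -
    starRingEnd ℂ a * ellKernel b c (z - starRingEnd ℂ z₁))

theorem stripModel_add_period (hc : 0 < c) (z₁ a z : ℂ) :
    stripModel b c z₁ a (z + c) = -stripModel b c z₁ a z := by
  rw [stripModel, stripModel, show z + c - z₁ = z - z₁ + c by ring,
    show z + c - starRingEnd ℂ z₁ = z - starRingEnd ℂ z₁ + c by ring, ellKernel_add_period hc,
    ellKernel_add_period hc, mul_add, exp_add, ofReal_exp]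
  have : exp (b * c) * exp (((-(b * c) : ℝ)) : ℂ) = 1 := by
    rw [← exp_add]; push_cast; simp
  linear_combination (-exp (b * z) * (a * ellKernel b c (z - z₁) -
    starRingEnd ℂ a * ellKernel b c (z - starRingEnd ℂ z₁))) * this

theorem stripModel_add_two_period (hc : 0 < c) (z₁ a z : ℂ) :
    stripModel b c z₁ a (z + (2 * c : ℝ)) = stripModel b c z₁ a z := by
  rw [show z + ((2 * c : ℝ) : ℂ) = z + c + c by push_cast; ring, stripModel_add_period hc,
    stripModel_add_period hc, neg_neg]

theorem mem_latticePts_of_abs_im_lt {z : ℂ} (hz : z ∈ latticePts c) (h : |z.im| < 2 * Real.pi) :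
    ∃ m : ℤ, z = m * c := by
  obtain ⟨m, n, rfl⟩ := hz
  have e : ((m : ℂ) * c + n * (2 * Real.pi * I)).im = n * (2 * Real.pi) := by simp
  rw [e, abs_mul, abs_of_pos Real.two_pi_pos, mul_lt_iff_lt_one_left Real.two_pi_pos] at h
  have : n = 0 := by
    have : |n| < 1 := by exact_mod_cast h
    exact Int.abs_lt_one_iff.mp this
  exact ⟨m, by simp [this]⟩

theorem differentiableAt_stripModel (hc : 0 < c) {z₁ a z : ℂ} (h1 : z - z₁ ∉ latticePts c)
    (h2 : z - starRingEnd ℂ z₁ ∉ latticePts c) :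
    DifferentiableAt ℂ (stripModel b c z₁ a) z := by
  have e1 : DifferentiableAt ℂ (fun z => ellKernel b c (z - z₁)) z :=
    (differentiableAt_ellKernel hc h1).comp_sub_right
  have e2 : DifferentiableAt ℂ (fun z => ellKernel b c (z - starRingEnd ℂ z₁)) z :=
    (differentiableAt_ellKernel hc h2).comp_sub_right
  unfold stripModel
  exact (by fun_prop : DifferentiableAt ℂ (fun z => exp (b * z)) z).mul
    ((e1.const_mul _).sub (e2.const_mul _))

theorem not_mem_latticePts_of_im_lt {z : ℂ} (h1 : z.im ≠ 0) (h2 : |z.im| < 2 * Real.pi) :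
    z ∉ latticePts c := fun h => by
  obtain ⟨m, rfl⟩ := mem_latticePts_of_abs_im_lt h h2
  simp at h1

/-- At a real point the two terms of the bracket are conjugate, and e^{bx} is real. -/
theorem stripModel_re_of_real (hc : 0 < c) (z₁ a : ℂ) (x : ℝ) :
    (stripModel b c z₁ a x).re = 0 := by
  have h : starRingEnd ℂ (a * ellKernel b c (x - z₁)) =
      starRingEnd ℂ a * ellKernel b c (x - starRingEnd ℂ z₁) := by
    rw [map_mul, ← ellKernel_conj hc, map_sub, conj_ofReal]
  rw [stripModel, ← h, ← ofReal_mul, ← ofReal_exp, re_ofReal_mul]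
  simp

/-- On the top line conjugation meets the antiperiod 2πi of K, so the difference becomes a sum of
conjugates, which is real; e^{bz} contributes the argument bπ. -/
theorem stripModel_im_of_top (hc : 0 < c) (z₁ a : ℂ) (x : ℝ) :
    (I * (exp ((-(b * Real.pi) : ℝ) * I) * stripModel b c z₁ a (x + Real.pi * I))).re = 0 := by
  have h : starRingEnd ℂ (a * ellKernel b c (x + Real.pi * I - z₁)) =
      -(starRingEnd ℂ a * ellKernel b c (x + Real.pi * I - starRingEnd ℂ z₁)) := by
    have e : starRingEnd ℂ (x + Real.pi * I - z₁) + 2 * Real.pi * I =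
        x + Real.pi * I - starRingEnd ℂ z₁ := by
      simp only [map_sub, map_add, map_mul, conj_ofReal, conj_I]
      ring
    rw [map_mul, ← ellKernel_conj hc, ← e, ellKernel_add_two_pi_I, mul_neg, neg_neg]
  rw [stripModel, ← neg_neg (starRingEnd ℂ a * _), ← h, sub_neg_eq_add, add_conj,
    ← mul_assoc (exp _) (exp _), ← exp_add, show ((-(b * Real.pi) : ℝ) : ℂ) * I + b * (x + Real.pi * I) = ((b * x : ℝ) : ℂ) by
      push_cast; ring, ← ofReal_exp, ← ofReal_mul]
  exact I_mul_re _ |>.trans (by rw [ofReal_im, neg_zero])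

theorem stripModel_botRe (hc : 0 < c) {z₁ : ℂ} (hz₁ : z₁ ∈ openStrip) (a : ℂ) :
    BotRe (stripModel b c z₁ a) := by
  have hpi := Real.pi_pos
  have h2c : 0 < 2 * c := by linarith
  refine ReflRe.botRe (p := 2 * c) ⟨z₁.im, hz₁.1, stripModel b c z₁ a, fun z hz => ?_,
    fun _ _ => rfl, stripModel_re_of_real hc z₁ a, stripModel_add_two_period hc z₁ a⟩ h2c
  refine (differentiableAt_stripModel hc ?_ ?_).differentiableWithinAt <;>
  · obtain ⟨h1, h2⟩ := hz
    obtain ⟨h3, h4⟩ := hz₁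
    refine not_mem_latticePts_of_im_lt ?_ ?_
    · simp only [sub_im, conj_im]
      intro h
      linarith
    · simp only [sub_im, conj_im]
      rw [abs_lt]
      constructor <;> linarith

theorem stripModel_topRe (hc : 0 < c) {z₁ : ℂ} (hz₁ : z₁ ∈ openStrip) (a : ℂ) :
    TopRe fun z => I * (exp ((-(b * Real.pi) : ℝ) * I) * stripModel b c z₁ a z) := by
  have hpi := Real.pi_pos
  have h2c : 0 < 2 * c := by linarith
  refine BotRe.topRe ?_
  refine ReflRe.botRe (p := 2 * c) ⟨Real.pi - z₁.im, sub_pos.mpr hz₁.2, _, fun z hz => ?_,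
    fun _ _ => rfl, fun x => ?_, fun z => ?_⟩ h2c
  · have h : DifferentiableAt ℂ (stripModel b c z₁ a) (Real.pi * I - z) := by
      refine differentiableAt_stripModel hc ?_ ?_ <;>
      · obtain ⟨h1, h2⟩ := hz
        obtain ⟨h3, h4⟩ := hz₁
        refine not_mem_latticePts_of_im_lt ?_ ?_
        · simp only [sub_im, conj_im, mul_im, ofReal_re, I_im, ofReal_im, I_re]
          intro h
          linarith
        · simp only [sub_im, conj_im, mul_im, ofReal_re, I_im, ofReal_im, I_re]
          rw [abs_lt]
          constructor <;> linarith
    have h2 : DifferentiableAt ℂ (fun z : ℂ => Real.pi * I - z) z := by fun_prop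
    exact (((h.comp z h2).const_mul _).const_mul _).differentiableWithinAt
  · have := stripModel_im_of_top (b := b) hc z₁ a (-x)
    rwa [show ((-x : ℝ) : ℂ) + Real.pi * I = Real.pi * I - x by push_cast; ring] at this
  · have := stripModel_add_two_period (b := b) hc z₁ a (Real.pi * I - (z + (2 * c : ℝ)))
    rw [show Real.pi * I - (z + ((2 * c : ℝ) : ℂ)) + ((2 * c : ℝ) : ℂ) = Real.pi * I - z by ring]
      at this
    simp only [this]

/-- The factor e^{−bz₁} in the coefficient compensates e^{bz} at the pole, which gives residue A.
The reflected term is regular at z₁. -/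
theorem isBigO_stripModel (hc : 0 < c) {z₁ : ℂ} (hz₁ : z₁ ∈ openStrip) (A : ℂ) :
    (fun z => stripModel b c z₁ (A * exp (-(b * z₁))) z - A / (z - z₁)) =O[𝓝[≠] z₁]
      fun _ => (1 : ℝ) := by
  obtain ⟨m, hm, hm1, hk⟩ := ellKernel_eq_div b hc
  set a := A * exp (-(b * z₁)) with ha
  set q : ℂ → ℂ := fun z => exp (b * z) * (a * m (z - z₁)) with hq
  have hqz : q z₁ = A := by
    simp only [hq, ha, sub_self, hm1, mul_one]
    rw [mul_left_comm, ← exp_add, add_neg_cancel, exp_zero, mul_one]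
  have hmd : DifferentiableAt ℂ (fun z => m (z - z₁)) z₁ := by
    have : DifferentiableAt ℂ m (z₁ - z₁) := by rw [sub_self]; exact hm.differentiableAt
    exact this.comp_sub_right
  have hqd : DifferentiableAt ℂ q z₁ :=
    (by fun_prop : DifferentiableAt ℂ (fun z => exp (b * z)) z₁).mul (hmd.const_mul a)
  have h2 : DifferentiableAt ℂ (fun z => exp (b * z) *
      (starRingEnd ℂ a * ellKernel b c (z - starRingEnd ℂ z₁))) z₁ := by
    have : z₁ - starRingEnd ℂ z₁ ∉ latticePts c := by
      obtain ⟨h3, h4⟩ := hz₁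
      refine not_mem_latticePts_of_im_lt ?_ ?_
      · simp only [sub_im, conj_im]; intro h; linarith
      · simp only [sub_im, conj_im]; rw [abs_lt]; constructor <;> linarith
    have e2 : DifferentiableAt ℂ (fun z => ellKernel b c (z - starRingEnd ℂ z₁)) z₁ :=
      (differentiableAt_ellKernel hc this).comp_sub_right
    exact (by fun_prop : DifferentiableAt ℂ (fun z => exp (b * z)) z₁).mul (e2.const_mul _)
  have h3 := (h2.continuousAt.tendsto.mono_left nhdsWithin_le_nhds :
    Tendsto _ (𝓝[≠] z₁) _).isBigO_one ℝ
  refine ((isBigO_slope hqd).sub h3).congr_left fun z => ?_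
  rw [hqz, stripModel, hk (z - z₁)]
  simp only [hq]
  ring

theorem eq_zero_of_eventually {f : ℂ → ℂ} {z : ℂ} (hf : ContinuousAt f z)
    (h : ∀ᶠ w in 𝓝[≠] z, f w = 0) : f z = 0 := by
  refine tendsto_nhds_unique (f := f) (l := 𝓝[≠] z)
    (hf.tendsto.mono_left nhdsWithin_le_nhds) ?_
  exact (tendsto_congr' h).mpr tendsto_const_nhds

/-- An antiperiodic function in the strip with a simple pole is determined by its boundary
values. -/
theorem eq_stripModel (hc : 0 < c) {z₁ : ℂ} (hz₁ : z₁ ∈ openStrip) {H : ℂ → ℂ} {A : ℂ}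
    (hd : DifferentiableOn ℂ H (openStrip \ {z | ∃ m : ℤ, z = z₁ + m * c}))
    (hp : ∀ z ∈ openStrip, H (z + c) = -H z)
    (hs : (fun z => H z - A / (z - z₁)) =O[𝓝[≠] z₁] fun _ => (1 : ℝ))
    (hbot : BotRe H) (htop : TopRe fun z => I * (exp ((-(b * Real.pi) : ℝ) * I) * H z)) :
    ∀ z ∈ openStrip, (∀ m : ℤ, z ≠ z₁ + m * c) →
      H z = stripModel b c z₁ (A * exp (-(b * z₁))) z := by
  set M := stripModel b c z₁ (A * exp (-(b * z₁))) with hM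
  set D : ℂ → ℂ := fun z => H z - M z with hD
  have hor : ∀ z ∈ openStrip, (∀ m : ℤ, z ≠ z₁ + m * c) → z - z₁ ∉ latticePts c := by
    intro z hz hne hl
    obtain ⟨h1, h2⟩ := hz
    obtain ⟨h3, h4⟩ := hz₁
    obtain ⟨m, hm⟩ := mem_latticePts_of_abs_im_lt hl (by
      rw [sub_im, abs_lt]; constructor <;> linarith)
    exact hne m (by rw [← hm]; ring)
  have hclosed : IsOpen {z : ℂ | z - z₁ ∉ latticePts c} :=
    (isClosed_latticePts hc).isOpen_compl.preimage (continuous_sub_right z₁)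
  have hDd : ∀ z ∈ openStrip, z - z₁ ∉ latticePts c → DifferentiableAt ℂ D z := by
    intro z hz hl
    have h1 : DifferentiableAt ℂ H z := by
      refine (hd.mono (fun w hw => ⟨hw.1, ?_⟩)).differentiableAt
        ((isOpen_openStrip.inter hclosed).mem_nhds ⟨hz, hl⟩)
      rintro ⟨m, rfl⟩
      exact hw.2 ⟨m, 0, by simp⟩
    refine h1.sub (differentiableAt_stripModel hc hl ?_)
    obtain ⟨h1, h2⟩ := hz
    obtain ⟨h3, h4⟩ := hz₁
    refine not_mem_latticePts_of_im_lt ?_ ?_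
    · simp only [sub_im, conj_im]; intro h; linarith
    · simp only [sub_im, conj_im]; rw [abs_lt]; constructor <;> linarith
  have hDp : ∀ z ∈ openStrip, D (z + c) = -D z := fun z hz => by
    simp only [hD, hp z hz, hM, stripModel_add_period hc]
    ring
  -- Boundedness of the difference is known near z₁; antiperiodicity transports it to the whole
  -- orbit, so every singularity is removable.
  have hDn : ∀ (m : ℤ), ∀ z ∈ openStrip, ‖D (z - m * c)‖ = ‖D z‖ := by
    intro m z hz
    have hmem : ∀ m : ℤ, z - m * c ∈ openStrip := fun m => by
      have := add_ofReal_mem_openStrip hz (-m * c)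
      push_cast at this
      rwa [neg_mul, ← sub_eq_add_neg] at this
    induction m with
    | zero => simp
    | succ k ih =>
      rw [← ih, ← norm_neg, ← hDp _ (hmem _)]
      push_cast
      ring_nf
    | pred k ih =>
      rw [← ih, ← norm_neg (D (z - ((-k : ℤ) : ℂ) * c)), ← hDp _ (hmem (-k))]
      push_cast
      ring_nf
  have hDO : (fun z => D z) =O[𝓝[≠] z₁] fun _ => (1 : ℝ) :=
    (hs.sub (isBigO_stripModel (b := b) hc hz₁ A)).congr_left fun z => by
      simp only [hD, hM]; ring
  have hev : ∀ z ∈ openStrip, ∀ᶠ w in 𝓝[≠] z, w ∈ openStrip ∧ w - z₁ ∉ latticePts c := by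
    intro z hz
    have h0 : ∀ᶠ w in 𝓝[≠] z, w ∈ openStrip :=
      nhdsWithin_le_nhds (isOpen_openStrip.mem_nhds hz)
    refine h0.and ?_
    have := tendsto_sub_nhdsNE (z - z₁) z₁
    rw [sub_add_cancel] at this
    exact this.eventually (not_mem_latticePts_eventually hc _)
  obtain ⟨hE, hEeq⟩ := differentiable_limUnder (f := D) (U := openStrip)
    (fun z hz => by
      filter_upwards [hev z hz] with w hw using hDd w hw.1 hw.2)
    (fun z hz => by
      by_cases hl : z - z₁ ∈ latticePts c
      · obtain ⟨m, hm⟩ : ∃ m : ℤ, z = z₁ + m * c := by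
          by_contra h
          push Not at h
          exact hor z hz h hl
        subst hm
        refine IsBigO.of_norm_left ?_
        refine ((hDO.norm_left.comp_tendsto (tendsto_sub_nhdsNE z₁ (m * c)))).congr' ?_
          (Eventually.of_forall fun _ => rfl)
        filter_upwards [hev _ hz] with w hw
        exact hDn m w hw.1
      · exact ((hDd z hz hl).continuousAt.tendsto.mono_left nhdsWithin_le_nhds).isBigO_one ℝ)
  set E : ℂ → ℂ := fun z => limUnder (𝓝[≠] z) D with hEdef
  have hED : ∀ z ∈ openStrip, z - z₁ ∉ latticePts c → E z = D z := fun z hz hl =>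
    hEeq z (hDd z hz hl).continuousAt
  have hEc : ∀ z ∈ openStrip, ContinuousAt E z := fun z hz =>
    (hE.differentiableAt (isOpen_openStrip.mem_nhds hz)).continuousAt
  have hEp : ∀ z ∈ openStrip, E (z + c) = -E z := by
    intro z hz
    have hzc := add_ofReal_mem_openStrip hz c
    have hcont : ContinuousAt (fun z => E (z + c) + E z) z :=
      (ContinuousAt.comp (f := fun z : ℂ => z + c) (g := E) (hEc _ hzc) (by fun_prop)).add
        (hEc z hz)
    refine eq_neg_of_add_eq_zero_left
      (eq_zero_of_eventually (f := fun z => E (z + c) + E z) hcont ?_)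
    filter_upwards [hev z hz] with w hw
    have : w + c - z₁ ∉ latticePts c := by
      rintro ⟨m, n, h⟩
      exact hw.2 ⟨m - 1, n, by push_cast; linear_combination h⟩
    rw [hED _ (add_ofReal_mem_openStrip hw.1 c) this, hED _ hw.1 hw.2, hDp _ hw.1]
    ring
  have hne : ∀ z ∈ openStrip, z.im ≠ z₁.im → z - z₁ ∉ latticePts c := fun z hz hne =>
    hor z hz fun m h => hne (by rw [h]; simp)
  -- Below the height of the pole the extension equals H minus the model, so it inherits their
  -- boundary behaviour; the top is similar.
  have hbotE : BotRe E := by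
    refine (hbot.sub (stripModel_botRe (b := b) hc hz₁ (A * exp (-(b * z₁))))).congr hz₁.1
      (g := E) fun z hz => ?_
    have hzs : z ∈ openStrip := ⟨hz.1, hz.2.trans hz₁.2⟩
    exact (hED z hzs (hne z hzs hz.2.ne)).symm
  have htopE : TopRe fun z => I * (exp ((-(b * Real.pi) : ℝ) * I) * E z) := by
    refine (htop.sub (stripModel_topRe (b := b) hc hz₁ (A * exp (-(b * z₁))))).congr hz₁.2
      fun z hz => ?_
    have hzs : z ∈ openStrip := ⟨hz₁.1.trans hz.1, hz.2⟩
    simp only [hED z hzs (hne z hzs hz.1.ne'), hD]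
    ring
  intro z hz hzm
  have h0 := strip_uniqueness hc _ hE hEp hbotE htopE z hz
  have : D z = 0 := by rw [← hED z hz (hor z hz hzm)]; exact h0
  exact sub_eq_zero.mp this

end model

/-! ### All solutions in terms of one common factor -/

section gauge

variable {Ω : Set Cylinder} {c b : ℝ} {φ : ℂ → ℂ}

/-- The map φ divides the residue by φ'(z₁) and v multiplies it by its value there. With `dslope`
the remainder becomes a difference quotient. -/
theorem isBigO_comp_singularity {F φ v : ℂ → ℂ} {C z₁ : ℂ} (hφ : AnalyticAt ℂ φ z₁)
    (hφ' : deriv φ z₁ ≠ 0) (hv : DifferentiableAt ℂ v z₁)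
    (hF : (fun w => F w - C / (w - φ z₁)) =O[𝓝[≠] φ z₁] fun _ => (1 : ℝ)) :
    (fun z => F (φ z) * v z - C * v z₁ / deriv φ z₁ / (z - z₁)) =O[𝓝[≠] z₁]
      fun _ => (1 : ℝ) := by
  have hφd := hφ.differentiableAt.hasDerivAt
  have ht : Tendsto φ (𝓝[≠] z₁) (𝓝[≠] φ z₁) := hφd.tendsto_nhdsNE hφ'
  have h1 := (hF.comp_tendsto ht).mul
    ((hv.continuousAt.tendsto.mono_left nhdsWithin_le_nhds : Tendsto v (𝓝[≠] z₁) _).isBigO_one ℝ)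
  simp only [Function.comp_def, mul_one] at h1
  have hs : DifferentiableAt ℂ (dslope φ z₁) z₁ := by
    obtain ⟨s, hs, h⟩ := hφ.exists_mem_nhds_analyticOnNhd
    exact ((differentiableOn_dslope hs).mpr h.differentiableOn).differentiableAt hs
  have hq : DifferentiableAt ℂ (fun z => C * v z / dslope φ z₁ z) z₁ :=
    (hv.const_mul C).div hs (by rwa [dslope_same])
  refine (h1.add (isBigO_slope hq)).congr' ?_ (by simp)
  filter_upwards [self_mem_nhdsWithin, ht.eventually self_mem_nhdsWithin] with z hz hz'
  have hz0 : z - z₁ ≠ 0 := sub_ne_zero.mpr hz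
  have hz1 : φ z - φ z₁ ≠ 0 := sub_ne_zero.mpr hz'
  simp only [dslope_same, dslope_of_ne _ hz, slope_def_field]
  field_simp
  ring

/-- `ω` is the common factor of all solutions of the boundary value problem, pulled back to the
strip by `φ`. -/
def IsGauge (Ω : Set Cylinder) (c b : ℝ) (φ ω : ℂ → ℂ) : Prop :=
  (∀ z ∈ openStrip, ω z ≠ 0) ∧
  ∀ (η : ℂ), ∀ z₁ ∈ openStrip, ∀ F : ℂ → ℂ, SolvesBVP Ω η (φ z₁) F →
    ∀ z ∈ openStrip, (∀ m : ℤ, z ≠ z₁ + m * c) →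
      F (φ z) = ω z *
        (starRingEnd ℂ η / (Real.pi * I * (deriv φ z₁ * ω z₁)) * ellKernel b c (z - z₁) -
          starRingEnd ℂ (starRingEnd ℂ η / (Real.pi * I * (deriv φ z₁ * ω z₁))) *
            ellKernel b c (z - starRingEnd ℂ z₁))

theorem SolvesBVP.differentiableOn_comp (hφ : IsUniformization Ω c φ) {η z₁ : ℂ}
    (hz₁ : z₁ ∈ openStrip) {F : ℂ → ℂ} (hF : SolvesBVP Ω η (φ z₁) F) :
    DifferentiableOn ℂ (fun z => F (φ z)) (openStrip \ {z | ∃ m : ℤ, z = z₁ + m * c}) := by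
  refine hF.holomorphic.comp (hφ.holomorphic.mono sdiff_subset) fun z hz => ?_
  refine ⟨hφ.bijOn.mapsTo hz.1, ?_⟩
  rintro ⟨m, hm⟩
  rw [← hφ.equivariant_int hz₁] at hm
  have := add_ofReal_mem_openStrip hz₁ (m * c)
  push_cast at this
  exact hz.2 ⟨m, hφ.bijOn.injOn hz.1 this hm⟩

theorem SolvesBVP.comp_add_period (hφ : IsUniformization Ω c φ) {η w : ℂ} {F : ℂ → ℂ}
    (hF : SolvesBVP Ω η w F) {z : ℂ} (hz : z ∈ openStrip) :
    F (φ (z + c)) = -F (φ z) := by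
  rw [hφ.equivariant z hz, hF.antiperiodic _ (hφ.bijOn.mapsTo hz)]

/-- Dividing by ω₀ gives F∘φ the boundary behaviour of `stripModel`, and uniqueness together with
the residue at z₁ does the rest. -/
theorem isGauge_of_boundary (hc : 0 < c) (hφ : IsUniformization Ω c φ) {ω₀ : ℂ → ℂ}
    (hd : DifferentiableOn ℂ ω₀ openStrip) (hne : ∀ z ∈ openStrip, ω₀ z ≠ 0)
    (hp : ∀ z ∈ openStrip, ω₀ (z + c) = ω₀ z)
    (hbd : ∀ (η : ℂ), ∀ z₁ ∈ openStrip, ∀ F : ℂ → ℂ, SolvesBVP Ω η (φ z₁) F →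
      (BotRe fun z => F (φ z) * (ω₀ z)⁻¹) ∧
      TopRe fun z => I * (exp ((-(b * Real.pi) : ℝ) * I) * (F (φ z) * (ω₀ z)⁻¹))) :
    IsGauge Ω c b φ fun z => exp (b * z) * ω₀ z := by
  refine ⟨fun z hz => mul_ne_zero (exp_ne_zero _) (hne z hz), fun η z₁ hz₁ F hF z hz hzm => ?_⟩
  obtain ⟨hbot, htop⟩ := hbd η z₁ hz₁ F hF
  have hnb := isOpen_openStrip.mem_nhds hz₁
  have hvd : DifferentiableOn ℂ (fun z => (ω₀ z)⁻¹) openStrip := hd.inv hne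
  have hsing := isBigO_comp_singularity (C := 1 / (Real.pi * I) * starRingEnd ℂ η)
    (hφ.holomorphic.analyticAt hnb) (hφ.deriv_ne_zero hz₁) (hvd.differentiableAt hnb)
    (by simpa only [mul_div_assoc] using hF.singularity)
  have key := eq_stripModel (b := b) (H := fun z => F (φ z) * (ω₀ z)⁻¹) hc hz₁
    ((hF.differentiableOn_comp hφ hz₁).mul (hvd.mono sdiff_subset))
    (fun z hz => by rw [hF.comp_add_period hφ hz, hp z hz, neg_mul]) hsing hbot htop z hz hzm
  have h0 := hne z hz
  have ha : 1 / (Real.pi * I) * starRingEnd ℂ η * (ω₀ z₁)⁻¹ / deriv φ z₁ * exp (-(b * z₁)) =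
      starRingEnd ℂ η / (Real.pi * I * (deriv φ z₁ * (exp (b * z₁) * ω₀ z₁))) := by
    rw [exp_neg]
    ring
  rw [ha, stripModel] at key
  rw [mul_inv_eq_iff_eq_mul₀ h0] at key
  rw [key]
  ring

/-- Smallness of Re h alone does not suffice: the product also involves Im h · Im u. Reflection
controls Im h up to the edge. -/
theorem BotRe.mul_real (hc : 0 < c) {h : ℂ → ℂ} {δ : ℝ} (hb : BotRe h) (hδ : 0 < δ)
    (hd : DifferentiableOn ℂ h (hStrip 0 δ)) (hp : ∀ z ∈ hStrip 0 δ, h (z + (2 * c : ℝ)) = h z)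
    {u : ℂ → ℂ} (hu : DifferentiableOn ℂ u (hStrip (-Real.pi) Real.pi))
    (hur : ∀ x : ℝ, (u x).im = 0) (hup : ∀ z, u (z + c) = u z) : BotRe fun z => h z * u z := by
  have h2c : 0 < 2 * c := by linarith
  refine ((BotRe.reflRe hb h2c hδ hd hp).mul_real Real.pi_pos hu hur fun z => ?_).botRe h2c
  rw [show z + ((2 * c : ℝ) : ℂ) = z + c + c by push_cast; ring, hup, hup]

theorem comp_pi_sub_mem_hStrip {a d : ℝ} {z : ℂ} :
    Real.pi * I - z ∈ hStrip a d ↔ z ∈ hStrip (Real.pi - d) (Real.pi - a) := by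
  simp only [hStrip, mem_ofPred_eq, sub_im, mul_im, ofReal_re, I_im, ofReal_im, I_re, mul_one,
    zero_mul, add_zero]
  constructor <;> rintro ⟨h1, h2⟩ <;> constructor <;> linarith

theorem differentiableOn_comp_pi_sub {a d : ℝ} {h : ℂ → ℂ} (hd : DifferentiableOn ℂ h (hStrip a d)) :
    DifferentiableOn ℂ (fun z => h (Real.pi * I - z)) (hStrip (Real.pi - d) (Real.pi - a)) :=
  hd.comp (by fun_prop) fun _ hz => comp_pi_sub_mem_hStrip.mpr hz

theorem periodic_comp_pi_sub {a d p : ℝ} {h : ℂ → ℂ} (hp : ∀ z ∈ hStrip a d, h (z + p) = h z) :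
    ∀ z ∈ hStrip (Real.pi - d) (Real.pi - a),
      h (Real.pi * I - (z + p)) = h (Real.pi * I - z) := fun z hz => by
  have h1 : Real.pi * I - (z + p) ∈ hStrip a d := by
    rw [comp_pi_sub_mem_hStrip]
    simpa [hStrip] using hz
  rw [← hp _ h1]
  ring_nf

theorem TopRe.mul_real (hc : 0 < c) {h : ℂ → ℂ} {a : ℝ} (hb : TopRe h) (ha : a < Real.pi)
    (hd : DifferentiableOn ℂ h (hStrip a Real.pi))
    (hp : ∀ z ∈ hStrip a Real.pi, h (z + (2 * c : ℝ)) = h z)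
    {u : ℂ → ℂ} (hu : DifferentiableOn ℂ u (hStrip 0 (2 * Real.pi)))
    (hur : ∀ x : ℝ, (u (x + Real.pi * I)).im = 0) (hup : ∀ z, u (z + c) = u z) :
    TopRe fun z => h z * u z := by
  have h1 := differentiableOn_comp_pi_sub hd
  have h2 := periodic_comp_pi_sub hp
  have h3 := differentiableOn_comp_pi_sub hu
  rw [sub_self] at h1 h2
  rw [sub_zero, show Real.pi - 2 * Real.pi = -Real.pi by ring] at h3
  refine BotRe.topRe (BotRe.mul_real hc hb.botRe (sub_pos.mpr ha) h1 h2 h3 (fun x => ?_) fun z => ?_)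
  · have := hur (-x)
    rwa [show ((-x : ℝ) : ℂ) + Real.pi * I = Real.pi * I - x by push_cast; ring] at this
  · rw [← hup (Real.pi * I - (z + c))]
    ring_nf

/-- The real part of −ig is Im g. After reflection across the edge the boundary condition on g may
be differentiated. -/
theorem botRe_deriv (hc : 0 < c) {g g' : ℂ → ℂ} {δ : ℝ} (hδ : 0 < δ)
    (hg : ∀ z ∈ hStrip 0 δ, HasDerivAt g (g' z) z ∧ g (z + (2 * c : ℝ)) = g z)
    (hb : BotRe fun z => -I * g z) : BotRe fun z => -I * g' z := by
  have h2c : 0 < 2 * c := by linarith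
  have h1 := BotRe.reflRe (p := 2 * c) hb h2c hδ
    (fun z hz => ((hg z hz).1.const_mul _).differentiableAt.differentiableWithinAt)
    (fun z hz => by rw [(hg z hz).2])
  exact (h1.deriv hδ fun z hz => (hg z hz).1.const_mul _).botRe h2c

theorem topRe_deriv (hc : 0 < c) {g g' : ℂ → ℂ} {a : ℝ} (ha : a < Real.pi)
    (hg : ∀ z ∈ hStrip a Real.pi, HasDerivAt g (g' z) z ∧ g (z + (2 * c : ℝ)) = g z)
    (hb : TopRe fun z => -I * g z) : TopRe fun z => I * g' z := by
  have h2 := periodic_comp_pi_sub fun z hz => (hg z hz).2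
  rw [sub_self] at h2
  have h3 := botRe_deriv hc (g := fun z => g (Real.pi * I - z))
    (g' := fun z => -g' (Real.pi * I - z)) (sub_pos.mpr ha) (fun z hz => ⟨?_, h2 z hz⟩) hb.botRe
  · refine BotRe.topRe ?_
    simpa using h3
  · have h4 := (hg (Real.pi * I - z) (comp_pi_sub_mem_hStrip.mpr (by rwa [sub_self]))).1
    refine (h4.comp z ((hasDerivAt_id' z).const_sub _)).congr_deriv ?_
    ring

theorem SolvesBVP.botRe_mul_deriv {η z₁ : ℂ} {F : ℂ → ℂ} (hF : SolvesBVP Ω η z₁ F)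
    (hE : EndsIn φ (𝓝[>] 0) (upperComplement Ω))
    (hΩ : IsCylindricalDomain Ω) (hφ : IsUniformization Ω c φ) (hc : 0 < c) :
    BotRe fun z => -I * (F (φ z) * deriv φ z) := by
  obtain ⟨a, d, g, ha, hd, had, hev, hg, hs⟩ :=
    hF.exists_primitive hE hΩ hφ exists_bottom_interval
  obtain ⟨d', hd', hI⟩ := mem_nhdsGT_iff_exists_Ioo_subset.mp hev
  refine botRe_deriv hc hd' (fun z hz => hg z (hI hz)) fun ε hε => ?_
  filter_upwards [hs ε hε] with y hy x
  simpa using hy x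

theorem SolvesBVP.topRe_mul_deriv {η z₁ : ℂ} {F : ℂ → ℂ} (hF : SolvesBVP Ω η z₁ F)
    (hE : EndsIn φ (𝓝[<] Real.pi) (upperComplement Ω))
    (hΩ : IsCylindricalDomain Ω) (hφ : IsUniformization Ω c φ) (hc : 0 < c) :
    TopRe fun z => I * (F (φ z) * deriv φ z) := by
  obtain ⟨a, d, g, ha, hd, had, hev, hg, hs⟩ :=
    hF.exists_primitive hE hΩ hφ exists_top_interval
  obtain ⟨a', ha', hI⟩ := mem_nhdsLT_iff_exists_Ioo_subset.mp hev
  refine topRe_deriv hc ha' (fun z hz => hg z (hI hz)) fun ε hε => ?_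
  filter_upwards [hs ε hε] with y hy x
  simpa using hy x

theorem hStrip_bottom_subset {z₁ : ℂ} (hz₁ : z₁ ∈ openStrip) :
    hStrip 0 z₁.im ⊆ openStrip \ {z | ∃ m : ℤ, z = z₁ + m * c} := fun z hz => by
  refine ⟨⟨hz.1, hz.2.trans hz₁.2⟩, ?_⟩
  rintro ⟨m, rfl⟩
  simpa using hz.2

theorem hStrip_top_subset {z₁ : ℂ} (hz₁ : z₁ ∈ openStrip) :
    hStrip z₁.im Real.pi ⊆ openStrip \ {z | ∃ m : ℤ, z = z₁ + m * c} := fun z hz => by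
  refine ⟨⟨hz₁.1.trans hz.1, hz.2⟩, ?_⟩
  rintro ⟨m, rfl⟩
  simpa using hz.1

/-- The solutions of the boundary value problem are explicit up to a common factor. -/
theorem exists_isGauge (hΩ : IsCylindricalDomain Ω) (hφ : IsUniformization Ω c φ) (hc : 0 < c) :
    ∃ (b : ℝ) (ω : ℂ → ℂ), IsGauge Ω c b φ ω := by
  have hpi := Real.pi_pos
  obtain ⟨L, hLd, hLe, hLp⟩ := hφ.exists_log_deriv hc
  have hφd : DifferentiableOn ℂ (deriv φ) openStrip := hφ.holomorphic.deriv isOpen_openStrip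
  have hFper : ∀ {η z₁ F}, SolvesBVP Ω η z₁ F → ∀ z ∈ openStrip,
      F (φ (z + (2 * c : ℝ))) = F (φ z) := fun hF z hz => by
    rw [show z + ((2 * c : ℝ) : ℂ) = z + c + c by push_cast; ring,
      hF.comp_add_period hφ (add_ofReal_mem_openStrip hz c), hF.comp_add_period hφ hz, neg_neg]
  have hφper : ∀ z ∈ openStrip, deriv φ (z + (2 * c : ℝ)) = deriv φ z := fun z hz => by
    rw [show z + ((2 * c : ℝ) : ℂ) = z + c + c by push_cast; ring,
      hφ.deriv_add_period (add_ofReal_mem_openStrip hz c), hφ.deriv_add_period hz]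
  rcases hφ.endsIn hΩ hc with ⟨hbotE, htopE⟩ | ⟨hbotE, htopE⟩
  -- With ω₀ = e^W, real on the bottom, the condition Re F = 0 is preserved there. On the top
  -- (F∘φ)/ω₀ is (F∘φ)φ' times e^{−Y−a₀}, where Y is real and (F∘φ)φ' is real in the limit, so the
  -- argument is −Im a₀. This is why b = −Im a₀/π.
  · obtain ⟨W, Y, a₀, hW, hY, hWp, hYp, hWr, hYr, hWY⟩ := exists_boundary_correction hc hLd hLp
    have hWs : DifferentiableOn ℂ W openStrip := hW.mono (hStrip_mono (by linarith) le_rfl)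
    refine ⟨-(a₀.im / Real.pi), _, isGauge_of_boundary (ω₀ := fun z => exp (W z)) hc hφ
      (hWs.cexp) (fun z _ => exp_ne_zero _) (fun z _ => by simp only [hWp])
      fun η z₁ hz₁ F hF => ⟨?_, ?_⟩⟩
    · have hb : BotRe fun z => F (φ z) := hF.eventually_re_small hbotE hΩ hφ
        (Ioo_mem_nhdsGT hpi)
      have := hb.mul_real hc hz₁.1 ((hF.differentiableOn_comp hφ hz₁).mono
        (hStrip_bottom_subset hz₁)) (fun z hz => hFper hF z (hStrip_bottom_subset (c := c) hz₁ hz).1)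
        (u := fun z => exp (-W z)) hW.neg.cexp (fun x => by
          rw [exp_im, neg_im, hWr, neg_zero, Real.sin_zero, mul_zero]) (fun z => by simp only [hWp])
      simpa only [exp_neg] using this
    · have hb := hF.topRe_mul_deriv htopE hΩ hφ hc
      have hd := (((hF.differentiableOn_comp hφ hz₁).mono (hStrip_top_subset hz₁)).mul
        (hφd.mono ((hStrip_top_subset (c := c) hz₁).trans sdiff_subset))).const_mul I
      have := hb.mul_real hc hz₁.2 hd (fun z hz => by
          have hzs := (hStrip_top_subset (c := c) hz₁ hz).1
          rw [hFper hF z hzs, hφper z hzs])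
        (u := fun z => exp (-Y z - a₀.re)) (hY.neg.sub_const _).cexp (fun x => by
          rw [exp_im, sub_im, neg_im, hYr, ofReal_im]; simp) (fun z => by simp only [hYp])
      refine this.congr (a := 0) hpi fun z hz => ?_
      have e1 : deriv φ z * exp (-Y z - a₀.re) = exp (a₀.im * I) * (exp (W z))⁻¹ := by
        rw [← hLe z hz, ← exp_neg, ← exp_add, ← exp_add]
        congr 1
        linear_combination hWY z hz - re_add_im a₀
      have e2 : (-(-(a₀.im / Real.pi) * Real.pi) : ℝ) = a₀.im := by field_simp
      simp only [e2]
      linear_combination I * F (φ z) * e1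
  -- If the ends are exchanged, the derivative of φ enters at the bottom instead. The correction is
  -- applied to −L, and the factor i turns a real limit into an imaginary one, so the same model
  -- results.
  · obtain ⟨W, Y, a₀, hW, hY, hWp, hYp, hWr, hYr, hWY⟩ := exists_boundary_correction hc
      (L := fun z => -L z) hLd.neg (fun z hz => by rw [hLp z hz])
    have hWs : DifferentiableOn ℂ W openStrip := hW.mono (hStrip_mono (by linarith) le_rfl)
    refine ⟨-(a₀.im / Real.pi), _, isGauge_of_boundary (ω₀ := fun z => I * exp (W z - L z)) hc hφ
      ((hWs.sub hLd).cexp.const_mul I) (fun z _ => mul_ne_zero I_ne_zero (exp_ne_zero _))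
      (fun z hz => by simp only [hWp, hLp z hz]) fun η z₁ hz₁ F hF => ⟨?_, ?_⟩⟩
    · have hb := hF.botRe_mul_deriv hbotE hΩ hφ hc
      have hd := (((hF.differentiableOn_comp hφ hz₁).mono (hStrip_bottom_subset hz₁)).mul
        (hφd.mono ((hStrip_bottom_subset (c := c) hz₁).trans sdiff_subset))).const_mul (-I)
      have := hb.mul_real hc hz₁.1 hd (fun z hz => by
          have hzs := (hStrip_bottom_subset (c := c) hz₁ hz).1
          rw [hFper hF z hzs, hφper z hzs])
        (u := fun z => exp (-W z)) hW.neg.cexp (fun x => by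
          rw [exp_im, neg_im, hWr, neg_zero, Real.sin_zero, mul_zero]) (fun z => by simp only [hWp])
      refine this.congr (δ := Real.pi) hpi fun z hz => ?_
      rw [mul_inv, inv_I, ← exp_neg, neg_sub, sub_eq_add_neg, exp_add, hLe z hz]
      ring
    · have hb : TopRe fun z => F (φ z) := hF.eventually_re_small htopE hΩ hφ
        (Ioo_mem_nhdsLT hpi)
      have := hb.mul_real hc hz₁.2 ((hF.differentiableOn_comp hφ hz₁).mono
        (hStrip_top_subset hz₁)) (fun z hz => hFper hF z (hStrip_top_subset (c := c) hz₁ hz).1)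
        (u := fun z => exp (-Y z - a₀.re)) (hY.neg.sub_const _).cexp (fun x => by
          rw [exp_im, sub_im, neg_im, hYr, ofReal_im]; simp) (fun z => by simp only [hYp])
      refine this.congr (a := 0) hpi fun z hz => ?_
      have e1 : exp (-Y z - a₀.re) = exp (a₀.im * I) * exp (-(W z - L z)) := by
        rw [← exp_add]
        congr 1
        linear_combination hWY z hz - re_add_im a₀
      have e2 : (-(-(a₀.im / Real.pi) * Real.pi) : ℝ) = a₀.im := by field_simp
      simp only [e2, e1, mul_inv, inv_I, ← exp_neg]
      linear_combination F (φ z) * exp (a₀.im * I) * exp (-(W z - L z)) * I_mul_I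

end gauge

/-! ### Explicit two- and three-point forms -/

section forms

variable {Ω : Set Cylinder} {c b : ℝ} {φ ω r : ℂ → ℂ} {f : ℂ → ℂ → ℂ → ℂ}

/-- The sign `1` or `-1`. -/
def boolSign (s : Bool) : ℂ := if s then 1 else -1

theorem conjSign_im (s : Bool) (z : ℂ) :
    (conjSign s z).im = z.im ∨ (conjSign s z).im = -z.im := by
  cases s <;> simp [conjSign]

theorem conjSign_ne_zero {s : Bool} {z : ℂ} (hz : z ≠ 0) : conjSign s z ≠ 0 := by
  cases s <;> simpa [conjSign] using hz

/-- Differences of distinct points of the closed strip and of their reflections avoid the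
lattice. -/
theorem conjSign_sub_not_mem_latticePts {z₁ z₂ : ℂ} (h1 : z₁ ∈ closedStrip)
    (h2 : z₂ ∈ closedStrip) (hne : ∀ m : ℤ, z₂ ≠ z₁ + m * c) (s₁ s₂ : Bool) :
    conjSign s₂ z₂ - conjSign s₁ z₁ ∉ latticePts c := by
  have hpi := Real.pi_pos
  obtain ⟨a1, a2⟩ := h1
  obtain ⟨b1, b2⟩ := h2
  rintro ⟨m, n, h⟩
  have hre : z₂.re - z₁.re = m * c := by
    have := congrArg re h
    cases s₁ <;> cases s₂ <;> simpa [conjSign] using this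
  have him : (conjSign s₂ z₂).im - (conjSign s₁ z₁).im = n * (2 * Real.pi) := by
    have := congrArg im h
    simpa using this
  have heq : z₂.im = z₁.im := by
    have hn : n = 0 ∨ n = 1 ∨ n = -1 := by
      have h3 : |(n : ℝ) * (2 * Real.pi)| ≤ 1 * (2 * Real.pi) := by
        rw [← him, abs_le]
        rcases conjSign_im s₁ z₁ with e1 | e1 <;> rcases conjSign_im s₂ z₂ with e2 | e2 <;>
          rw [e1, e2] <;> constructor <;> linarith
      rw [abs_mul, abs_of_pos Real.two_pi_pos, mul_le_mul_iff_left₀ Real.two_pi_pos] at h3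
      have h4 : |n| ≤ 1 := by exact_mod_cast h3
      rw [abs_le] at h4
      omega
    rcases conjSign_im s₁ z₁ with e1 | e1 <;> rcases conjSign_im s₂ z₂ with e2 | e2 <;>
    rw [e1, e2] at him <;> rcases hn with rfl | rfl | rfl <;> push_cast at him <;> linarith
  refine hne m (Complex.ext ?_ ?_)
  · simp; linarith
  · simpa using heq

/-- The square roots of φ' and the gauge combine into one function ρ = ωr, entering only through a
quotient of its values; such quotients cancel in every cyclic product. -/
theorem IsGauge.pulledF_eq (hg : IsGauge Ω c b φ ω) (hc : 0 < c) (hφ : IsUniformization Ω c φ)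
    (hr : IsSqrtDeriv φ r) (hf : ∀ η : ℂ, ∀ z₁ ∈ cylLift Ω, SolvesBVP Ω η z₁ (f η z₁))
    {z₁ z₂ : ℂ} (h1 : z₁ ∈ openStrip) (h2 : z₂ ∈ openStrip) (hne : ∀ m : ℤ, z₂ ≠ z₁ + m * c)
    (s₁ s₂ : Bool) :
    pulledF f φ r s₁ s₂ z₁ z₂ = boolSign s₂ * (2 / (Real.pi * I)) *
      ellKernel b c (conjSign s₂ z₂ - conjSign s₁ z₁) *
      (conjSign s₂ (ω z₂ * r z₂) / conjSign s₁ (ω z₁ * r z₁)) := by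
  have hpi : (Real.pi : ℂ) ≠ 0 := by exact_mod_cast Real.pi_ne_zero
  have hr1 := hr.2 z₁ h1
  have hr0 : r z₁ ≠ 0 := fun h => hφ.deriv_ne_zero h1 (by rw [← hr1, h]; simp)
  have hω0 := hg.1 z₁ h1
  have hrc : starRingEnd ℂ (r z₁) ≠ 0 := by simpa using hr0
  have hωc : starRingEnd ℂ (ω z₁) ≠ 0 := by simpa using hω0
  have hI := I_ne_zero
  have e := fun η => hg.2 η z₁ h1 _ (hf η (φ z₁) (hφ.bijOn.mapsTo h1)) z₂ h2 hne
  have e1 := e 1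
  have eI := e I
  rw [← hr1] at e1 eI
  simp only [map_div₀, map_mul, map_one, map_pow, conj_I, conj_ofReal, map_neg, neg_neg] at e1 eI
  -- The coefficient is linear in the conjugate of η, so adding i times the solution for η = i
  -- doubles the term with K(z₂ − z₁) and kills the reflected one; subtracting it does the opposite.
  have P : f 1 (φ z₁) (φ z₂) + I * f I (φ z₁) (φ z₂) =
      2 / (Real.pi * I) * ellKernel b c (z₂ - z₁) * (ω z₂ / (r z₁ ^ 2 * ω z₁)) := by
    rw [e1, eI]
    field_simp
    linear_combination (-(ellKernel b c (z₂ - z₁)) * ω z₂ * starRingEnd ℂ (r z₁) ^ 2 *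
      starRingEnd ℂ (ω z₁) + ellKernel b c (z₂ - starRingEnd ℂ z₁) * ω z₂ * r z₁ ^ 2 * ω z₁) * I_sq
  have N : f 1 (φ z₁) (φ z₂) - I * f I (φ z₁) (φ z₂) =
      2 / (Real.pi * I) * ellKernel b c (z₂ - starRingEnd ℂ z₁) *
        (ω z₂ / starRingEnd ℂ (r z₁ ^ 2 * ω z₁)) := by
    rw [e1, eI, map_mul, map_pow]
    field_simp
    linear_combination (ellKernel b c (z₂ - z₁) * ω z₂ * starRingEnd ℂ (r z₁) ^ 2 *
      starRingEnd ℂ (ω z₁) - ellKernel b c (z₂ - starRingEnd ℂ z₁) * ω z₂ * r z₁ ^ 2 * ω z₁) * I_sq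
  cases s₁ <;> cases s₂ <;> simp only [pulledF, signedF, P, N, conjSign, boolSign, if_true,
    Bool.false_eq_true, if_false, map_mul, map_div₀, conj_ofReal, conj_I, ← ellKernel_conj hc,
    map_sub, conj_conj, map_ofNat, map_pow] <;> field_simp

theorem conjSign_sum (v : ℂ) : ∑ s : Bool, boolSign s * conjSign s v = 2 * I * v.im := by
  rw [Fintype.sum_bool]
  simp only [boolSign, conjSign, if_true, Bool.false_eq_true, if_false, one_mul, neg_mul]
  rw [← sub_eq_add_neg, sub_conj]
  push_cast
  ring

/-- With zero diagonal the determinant is the sum of the two 3-cycles, that is, τ up to a constant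
and the product of the signs, for every choice of signs. -/
theorem IsGauge.formA_three (hg : IsGauge Ω c b φ ω) (hc : 0 < c) (hφ : IsUniformization Ω c φ)
    (hr : IsSqrtDeriv φ r) (hf : ∀ η : ℂ, ∀ z₁ ∈ cylLift Ω, SolvesBVP Ω η z₁ (f η z₁)) {τ : ℝ}
    (hτ : ∀ x y : ℂ, x ∉ latticePts c → y ∉ latticePts c → x + y ∉ latticePts c →
      kernelTriple b c x y = τ) {z : Fin 3 → ℂ} (hz : ∀ k, z k ∈ openStrip)
    (hd : DistinctMod c z) (v : Fin 3 → ℂ) :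
    formA (pulledF f φ r) z v = ((τ / Real.pi ^ 3 * ∏ k, (v k).im : ℝ) : ℂ) := by
  have hpi : (Real.pi : ℂ) ≠ 0 := by exact_mod_cast Real.pi_ne_zero
  have hcl : ∀ k, z k ∈ closedStrip := fun k => ⟨(hz k).1.le, (hz k).2.le⟩
  have hI := I_ne_zero
  have hρ : ∀ k s, conjSign s (ω (z k) * r (z k)) ≠ 0 := fun k s => by
    refine conjSign_ne_zero (mul_ne_zero (hg.1 _ (hz k)) fun h => ?_)
    exact hφ.deriv_ne_zero (hz k) (by rw [← hr.2 _ (hz k), h]; simp)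
  have hdet : ∀ s : Fin 3 → Bool,
      (Matrix.of fun j k => if j = k then 0 else
        pulledF f φ r (s j) (s k) (z j) (z k)).det * ∏ k, conjSign (s k) (v k) =
      8 * I / Real.pi ^ 3 * τ * ∏ k, (boolSign (s k) * conjSign (s k) (v k)) := by
    intro s
    have hp : ∀ j k, j ≠ k → _ := fun j k hjk =>
      hg.pulledF_eq hc hφ hr hf (hz j) (hz k) (hd k j hjk.symm) (s j) (s k)
    have hl : ∀ j k, j ≠ k → conjSign (s k) (z k) - conjSign (s j) (z j) ∉ latticePts c :=
      fun j k hjk => conjSign_sub_not_mem_latticePts (hcl j) (hcl k) (hd k j hjk.symm) _ _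
    have ht := hτ _ _ (hl 0 1 (by decide)) (hl 1 2 (by decide)) (by
      rw [add_comm, sub_add_sub_cancel]; exact hl 0 2 (by decide))
    rw [kernelTriple] at ht
    set u := fun k => conjSign (s k) (z k) with hu
    rw [show -(conjSign (s 1) (z 1) - conjSign (s 0) (z 0)) -
        (conjSign (s 2) (z 2) - conjSign (s 1) (z 1)) =
        conjSign (s 0) (z 0) - conjSign (s 2) (z 2) by ring, neg_sub, neg_sub,
      show conjSign (s 1) (z 1) - conjSign (s 0) (z 0) +
        (conjSign (s 2) (z 2) - conjSign (s 1) (z 1)) =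
        conjSign (s 2) (z 2) - conjSign (s 0) (z 0) by ring] at ht
    rw [Matrix.det_fin_three]
    simp only [Matrix.of_apply, Fin.isValue, if_true]
    simp only [Fin.isValue, (by decide : (0 : Fin 3) ≠ 1), (by decide : (0 : Fin 3) ≠ 2),
      (by decide : (1 : Fin 3) ≠ 2), (by decide : (1 : Fin 3) ≠ 0), (by decide : (2 : Fin 3) ≠ 0),
      (by decide : (2 : Fin 3) ≠ 1), if_false, mul_zero, zero_mul, sub_zero, zero_add]
    rw [hp 0 1 (by decide), hp 1 2 (by decide), hp 2 0 (by decide), hp 0 2 (by decide),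
      hp 2 1 (by decide), hp 1 0 (by decide), ← ht]
    simp only [Fin.prod_univ_three]
    have h0 := hρ 0 (s 0)
    have h1 := hρ 1 (s 1)
    have h2 := hρ 2 (s 2)
    field_simp
    simp only [I_pow_four]
    ring
  rw [formA]
  simp only [hdet]
  rw [← Finset.mul_sum]
  -- Nothing but the signs depends on s, so the sum factors into the differences v_k − v̄_k.
  have : ∑ s : Fin 3 → Bool, ∏ k, (boolSign (s k) * conjSign (s k) (v k)) =
      ∏ k, (2 * I * ((v k).im : ℂ)) := by
    simp only [← conjSign_sum]
    rw [Finset.prod_univ_sum, Fintype.piFinset_univ]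
  rw [this]
  simp only [Fin.prod_univ_three]
  push_cast
  field_simp
  linear_combination (64 * τ * ((v 0).im * (v 1).im * (v 2).im : ℂ)) * I_pow_four

/-- The determinant is a single transposition, hence K(z)K(−z). Opposite choices of the two signs
give conjugate terms, which accounts for the real part. -/
theorem IsGauge.formA_two (hg : IsGauge Ω c b φ ω) (hc : 0 < c) (hφ : IsUniformization Ω c φ)
    (hr : IsSqrtDeriv φ r) (hf : ∀ η : ℂ, ∀ z₁ ∈ cylLift Ω, SolvesBVP Ω η z₁ (f η z₁)) {e : ℝ}
    (he : ∀ z ∉ latticePts c,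
      ellKernel b c z * ellKernel b c (-z) = thetaLogDeriv₂ c z + e)
    {z : Fin 2 → ℂ} (hz : ∀ k, z k ∈ openStrip)
    (hd : DistinctMod c z) (v : Fin 2 → ℂ) :
    formA (pulledF f φ r) z v = ((1 / (2 * Real.pi ^ 2) *
      (thetaLogDeriv₂ c (z 1 - z 0) * v 0 * v 1 -
        thetaLogDeriv₂ c (z 1 - starRingEnd ℂ (z 0)) * starRingEnd ℂ (v 0) * v 1).re -
      e / Real.pi ^ 2 * ((v 0).im * (v 1).im) : ℝ) : ℂ) := by
  have hpi : (Real.pi : ℂ) ≠ 0 := by exact_mod_cast Real.pi_ne_zero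
  have hcl : ∀ k, z k ∈ closedStrip := fun k => ⟨(hz k).1.le, (hz k).2.le⟩
  have hI := I_ne_zero
  have hρ : ∀ k s, conjSign s (ω (z k) * r (z k)) ≠ 0 := fun k s => by
    refine conjSign_ne_zero (mul_ne_zero (hg.1 _ (hz k)) fun h => ?_)
    exact hφ.deriv_ne_zero (hz k) (by rw [← hr.2 _ (hz k), h]; simp)
  have hdet : ∀ s : Fin 2 → Bool,
      (Matrix.of fun j k => if j = k then 0 else
        pulledF f φ r (s j) (s k) (z j) (z k)).det * ∏ k, conjSign (s k) (v k) =
      4 / Real.pi ^ 2 * (boolSign (s 0) * boolSign (s 1) *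
        (thetaLogDeriv₂ c (conjSign (s 1) (z 1) - conjSign (s 0) (z 0)) + e) *
        (conjSign (s 0) (v 0) * conjSign (s 1) (v 1))) := by
    intro s
    have ht := he _ (conjSign_sub_not_mem_latticePts (hcl 0) (hcl 1) (hd 1 0 (by decide))
      (s 0) (s 1))
    rw [neg_sub] at ht
    rw [Matrix.det_fin_two]
    simp only [Matrix.of_apply, Fin.isValue, if_true]
    simp only [Fin.isValue, (by decide : (0 : Fin 2) ≠ 1), (by decide : (1 : Fin 2) ≠ 0), if_false,
      mul_zero, zero_sub, Fin.prod_univ_two]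
    rw [hg.pulledF_eq hc hφ hr hf (hz 0) (hz 1) (hd 1 0 (by decide)) (s 0) (s 1),
      hg.pulledF_eq hc hφ hr hf (hz 1) (hz 0) (hd 0 1 (by decide)) (s 1) (s 0), ← ht]
    have h0 := hρ 0 (s 0)
    have h1 := hρ 1 (s 1)
    field_simp
    simp only [I_sq]
    ring
  rw [formA]
  simp only [hdet]
  rw [← Finset.mul_sum, ← (finTwoArrowEquiv Bool).symm.sum_comp, Fintype.sum_prod_type]
  simp only [Fintype.sum_bool, finTwoArrowEquiv_symm_apply, Matrix.cons_val_zero,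
    Matrix.cons_val_one, boolSign, conjSign, if_true, Bool.false_eq_true, if_false]
  have q1 := thetaLogDeriv₂_conj hc (z 1 - z 0)
  have q2 := thetaLogDeriv₂_conj hc (z 1 - starRingEnd ℂ (z 0))
  rw [map_sub] at q1 q2
  rw [conj_conj] at q2
  rw [q1, q2]
  set X := thetaLogDeriv₂ c (z 1 - z 0)
  set X' := thetaLogDeriv₂ c (z 1 - starRingEnd ℂ (z 0))
  push_cast
  simp only [re_eq_add_conj, im_eq_sub_conj, map_sub, map_mul, conj_conj]
  field_simp
  simp only [I_sq]
  ring

end forms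

/-! ### Primitives of the two-point form -/

section logarithmic

variable {c : ℝ}

/-- The logarithmic derivative of `cylTheta`. -/
noncomputable def thetaLogDeriv (c : ℝ) (z : ℂ) : ℂ := deriv (cylTheta c) z / cylTheta c z

theorem hasDerivAt_thetaLogDeriv (hc : 0 < c) {z : ℂ} (hz : z ∉ latticePts c) :
    HasDerivAt (thetaLogDeriv c) (thetaLogDeriv₂ c z) z := by
  have h0 := mt (cylTheta_eq_zero_iff hc z).mp hz
  have h := ((differentiable_deriv_cylTheta hc z).hasDerivAt).fun_div
    (differentiable_cylTheta hc z).hasDerivAt h0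
  refine h.congr_deriv ?_
  rw [thetaLogDeriv₂]
  ring

theorem hasDerivAt_log_norm {g : ℝ → ℂ} {g' : ℂ} {t : ℝ} (hg : HasDerivAt g g' t) (h0 : g t ≠ 0) :
    HasDerivAt (fun t => Real.log ‖g t‖) (g' / g t).re t := by
  have h1 : HasDerivAt (fun t => ‖g t‖ ^ 2) (2 * inner ℝ (g t) g') t := hg.norm_sq
  have hn : ‖g t‖ ^ 2 ≠ 0 := pow_ne_zero _ (norm_ne_zero_iff.mpr h0)
  have h2 := (h1.log hn).const_mul (1 / 2)
  have e : (fun t => Real.log ‖g t‖) = fun t => 1 / 2 * Real.log (‖g t‖ ^ 2) := by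
    ext t
    rw [Real.log_pow]
    push_cast
    ring
  rw [e]
  refine h2.congr_deriv ?_
  rw [div_re, Complex.inner, ← normSq_eq_norm_sq]
  simp only [mul_re, conj_re, conj_im]
  ring

theorem hasDerivAt_log_norm_cylTheta (hc : 0 < c) {u : ℝ → ℂ} {u' : ℂ} {t : ℝ}
    (hu : HasDerivAt u u' t) (h0 : u t ∉ latticePts c) :
    HasDerivAt (fun t => Real.log ‖cylTheta c (u t)‖) (thetaLogDeriv c (u t) * u').re t := by
  have h := hasDerivAt_log_norm ((differentiable_cylTheta hc (u t)).hasDerivAt.comp t hu)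
    (mt (cylTheta_eq_zero_iff hc _).mp h0)
  refine h.congr_deriv ?_
  simp only [Function.comp_apply, thetaLogDeriv]
  congr 1
  ring

end logarithmic

/-- Integration of a mixed second derivative over the square. -/
theorem integral_square_of_hasDerivAt {A C D : ℝ → ℝ → ℝ}
    (hA : ∀ s ∈ Icc (0 : ℝ) 1, ContinuousOn (A s) (Icc 0 1))
    (hC : ∀ s ∈ Icc (0 : ℝ) 1, ContinuousOn (C s) (Icc 0 1))
    (hCA : ∀ s ∈ Icc (0 : ℝ) 1, ∀ t ∈ Ioo (0 : ℝ) 1, HasDerivAt (C s) (A s t) t)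
    (hC' : ∀ t ∈ Icc (0 : ℝ) 1, ContinuousOn (fun s => C s t) (Icc 0 1))
    (hD : ∀ t ∈ Icc (0 : ℝ) 1, ContinuousOn (fun s => D s t) (Icc 0 1))
    (hDC : ∀ t ∈ Icc (0 : ℝ) 1, ∀ s ∈ Ioo (0 : ℝ) 1, HasDerivAt (fun s => D s t) (C s t) s) :
    ∫ s in Icc (0 : ℝ) 1, ∫ t in Icc (0 : ℝ) 1, A s t = D 1 1 - D 0 1 - (D 1 0 - D 0 0) := by
  have h01 : (0 : ℝ) ≤ 1 := zero_le_one
  have hint : ∀ {f : ℝ → ℝ}, ContinuousOn f (Icc 0 1) → IntervalIntegrable f volume 0 1 :=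
    fun hf => ContinuousOn.intervalIntegrable (by rwa [uIcc_of_le h01])
  have h1 : ∀ s ∈ Icc (0 : ℝ) 1, ∫ t in Icc (0 : ℝ) 1, A s t = C s 1 - C s 0 := fun s hs => by
    rw [integral_Icc_eq_integral_Ioc, ← intervalIntegral.integral_of_le h01]
    exact intervalIntegral.integral_eq_sub_of_hasDerivAt_of_le h01 (hC s hs) (hCA s hs)
      (hint (hA s hs))
  have h2 : ∀ t ∈ Icc (0 : ℝ) 1, ∫ s in (0 : ℝ)..1, C s t = D 1 t - D 0 t := fun t ht =>
    intervalIntegral.integral_eq_sub_of_hasDerivAt_of_le h01 (hD t ht) (hDC t ht)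
      (hint (hC' t ht))
  have m0 : (0 : ℝ) ∈ Icc (0 : ℝ) 1 := ⟨le_rfl, h01⟩
  have m1 : (1 : ℝ) ∈ Icc (0 : ℝ) 1 := ⟨h01, le_rfl⟩
  rw [setIntegral_congr_fun measurableSet_Icc h1, integral_Icc_eq_integral_Ioc,
    ← intervalIntegral.integral_of_le h01,
    intervalIntegral.integral_sub (hint (hC' 1 m1)) (hint (hC' 0 m0)), h2 1 m1, h2 0 m0]

/-! ### Integration along non-intersecting paths -/

section paths

variable {c : ℝ} {n : ℕ} {γ : Fin n → ℝ → ℂ} {z : Fin n → ℂ}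

theorem IsPathSystem.mem_closedStrip (h : IsPathSystem c γ z) (hz : ∀ k, z k ∈ closedStrip)
    (k : Fin n) {t : ℝ} (ht : t ∈ Icc (0 : ℝ) 1) : γ k t ∈ closedStrip := by
  rcases eq_or_lt_of_le ht.1 with rfl | h0
  · have := h.start k
    exact ⟨this.ge, this.le.trans Real.pi_pos.le⟩
  rcases eq_or_lt_of_le ht.2 with rfl | h1
  · rw [h.finish]
    exact hz k
  · have := h.inside k t ⟨h0, h1⟩
    exact ⟨this.1.le, this.2.le⟩

theorem IsPathSystem.continuousOn (h : IsPathSystem c γ z) (k : Fin n) :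
    ContinuousOn (γ k) (Icc 0 1) := (h.smooth k).continuousOn

theorem IsPathSystem.continuousOn_derivWithin (h : IsPathSystem c γ z) (k : Fin n) :
    ContinuousOn (derivWithin (γ k) (Icc 0 1)) (Icc 0 1) :=
  (h.smooth k).continuousOn_derivWithin (uniqueDiffOn_Icc zero_lt_one) le_rfl

theorem IsPathSystem.hasDerivAt (h : IsPathSystem c γ z) (k : Fin n) {t : ℝ}
    (ht : t ∈ Ioo (0 : ℝ) 1) : HasDerivAt (γ k) (derivWithin (γ k) (Icc 0 1) t) t := by
  have h1 := ((h.smooth k).differentiableOn one_ne_zero t (Ioo_subset_Icc_self ht)).hasDerivWithinAt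
  exact h1.hasDerivAt (Icc_mem_nhds ht.1 ht.2)

/-- The closed form of 𝒜ₙ holds where all paths are in the open strip, that is, on the open cube,
where also `deriv` and `derivWithin` agree. The faces are null, and continuity of `g` on the closed
cube gives absolute convergence. -/
theorem isCorrelation_of_forall {F : Bool → Bool → ℂ → ℂ → ℂ} {a : ℝ}
    (hex : ∃ γ, IsPathSystem c γ z)
    (h : ∀ γ, IsPathSystem c γ z → ∃ g : (Fin n → ℝ) → ℝ, ContinuousOn g (Icc 0 1) ∧
      (∀ t : Fin n → ℝ, (∀ k, t k ∈ Ioo (0 : ℝ) 1) →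
        formA F (fun k => γ k (t k)) (fun k => derivWithin (γ k) (Icc 0 1) (t k)) = g t) ∧
      ∫ t in Icc (0 : Fin n → ℝ) 1, g t = a) : IsCorrelation c F z a := by
  refine ⟨hex, fun γ hγ => ?_⟩
  obtain ⟨g, hg, hF, hi⟩ := h γ hγ
  have hae : ∀ᵐ t ∂(volume.restrict (Icc (0 : Fin n → ℝ) 1)), ((g t : ℝ) : ℂ) =
      formA F (fun k => γ k (t k)) (fun k => deriv (γ k) (t k)) := by
    have h1 : (univ.pi fun _ => Ioo (0 : ℝ) 1) =ᵐ[volume] Icc (0 : Fin n → ℝ) 1 :=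
      Measure.univ_pi_Ioo_ae_eq_Icc
    rw [← Measure.restrict_congr_set h1]
    rw [ae_restrict_iff' (MeasurableSet.univ_pi fun _ => measurableSet_Ioo)]
    refine Eventually.of_forall fun t ht => ?_
    have ht' : ∀ k, t k ∈ Ioo (0 : ℝ) 1 := fun k => ht k (mem_univ k)
    rw [← hF t ht']
    congr 1
    ext k
    exact ((hγ.hasDerivAt k (ht' k)).deriv).symm
  have hgi : IntegrableOn (fun t => ((g t : ℝ) : ℂ)) (Icc (0 : Fin n → ℝ) 1) :=
    (hg.integrableOn_compact isCompact_Icc).ofReal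
  exact ⟨hgi.congr hae, by rw [← integral_congr_ae hae, integral_complex_ofReal, hi]⟩

end paths

section integrals

variable {Ω : Set Cylinder} {c b : ℝ} {φ ω r : ℂ → ℂ} {f : ℂ → ℂ → ℂ → ℂ}

theorem IsPathSystem.distinctMod {n : ℕ} {γ : Fin n → ℝ → ℂ} {z : Fin n → ℂ}
    (h : IsPathSystem c γ z) {t : Fin n → ℝ} (ht : ∀ k, t k ∈ Icc (0 : ℝ) 1) :
    DistinctMod c fun k => γ k (t k) := fun j k hjk m =>
  h.disjoint j k hjk _ (ht j) _ (ht k) m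

/-- The integrand is a product of derivatives of the heights Im γ_k, so each factor integrates to
the final height. -/
theorem IsGauge.isCorrelation_three (hg : IsGauge Ω c b φ ω) (hc : 0 < c)
    (hφ : IsUniformization Ω c φ)
    (hr : IsSqrtDeriv φ r) (hf : ∀ η : ℂ, ∀ z₁ ∈ cylLift Ω, SolvesBVP Ω η z₁ (f η z₁)) {τ : ℝ}
    (hτ : ∀ x y : ℂ, x ∉ latticePts c → y ∉ latticePts c → x + y ∉ latticePts c →
      kernelTriple b c x y = τ) {z : Fin 3 → ℂ}
    (hex : ∃ γ, IsPathSystem c γ z) :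
    IsCorrelation c (pulledF f φ r) z (τ / Real.pi ^ 3 * ∏ k, (z k).im) := by
  refine isCorrelation_of_forall hex fun γ hγ => ⟨fun t =>
    τ / Real.pi ^ 3 * ∏ k, (derivWithin (γ k) (Icc 0 1) (t k)).im, ?_, fun t ht => ?_, ?_⟩
  · refine continuousOn_const.mul (continuousOn_finsetProd _ fun k _ => ?_)
    exact continuous_im.comp_continuousOn ((hγ.continuousOn_derivWithin k).comp
      (continuous_apply k).continuousOn fun t ht => ⟨ht.1 k, ht.2 k⟩)
  · exact hg.formA_three hc hφ hr hf hτ (fun k => hγ.inside k _ (ht k))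
      (hγ.distinctMod fun k => Ioo_subset_Icc_self (ht k)) _
  · rw [integral_const_mul]
    congr 1
    have e : Icc (0 : Fin 3 → ℝ) 1 = univ.pi fun _ => Icc (0 : ℝ) 1 := by
      rw [pi_univ_Icc]; rfl
    rw [e, volume_pi, Measure.restrict_pi_pi,
      integral_fintype_prod_eq_prod (fun k t => (derivWithin (γ k) (Icc 0 1) t).im)]
    refine Finset.prod_congr rfl fun k _ => ?_
    rw [integral_Icc_eq_integral_Ioc, ← intervalIntegral.integral_of_le zero_le_one]
    have hci : ContinuousOn (fun t => (derivWithin (γ k) (Icc 0 1) t).im) (uIcc 0 1) := by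
      rw [uIcc_of_le zero_le_one]
      exact continuous_im.comp_continuousOn (hγ.continuousOn_derivWithin k)
    rw [intervalIntegral.integral_eq_sub_of_hasDerivAt_of_le (f := fun t => (γ k t).im)
      (f' := fun t => (derivWithin (γ k) (Icc 0 1) t).im) zero_le_one
      (continuous_im.comp_continuousOn (hγ.continuousOn k))
      (fun t ht => imCLM.hasFDerivAt.comp_hasDerivAt t (hγ.hasDerivAt k ht))
      hci.intervalIntegrable, hγ.start, hγ.finish, sub_zero]

/-- The logarithmic potential which is a multiple of the Green's function. -/
noncomputable def logPotential (c : ℝ) (w₀ w₁ : ℂ) : ℝ :=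
  Real.log ‖cylTheta c (w₁ - w₀)‖ - Real.log ‖cylTheta c (w₁ - starRingEnd ℂ w₀)‖

theorem logPotential_eq_zero_left {w₀ w₁ : ℂ} (h : w₀.im = 0) : logPotential c w₀ w₁ = 0 := by
  rw [logPotential, conj_eq_iff_im.mpr h, sub_self]

theorem logPotential_eq_zero_right (hc : 0 < c) {w₀ w₁ : ℂ} (h : w₁.im = 0) :
    logPotential c w₀ w₁ = 0 := by
  have : w₁ - starRingEnd ℂ w₀ = starRingEnd ℂ (w₁ - w₀) := by
    rw [map_sub, conj_eq_iff_im.mpr h]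
  rw [logPotential, this, cylTheta_conj hc, RCLike.norm_conj, sub_self]

/-- On the top the two arguments are conjugate up to the antiperiod 2πi, so the two moduli are
equal. -/
theorem logPotential_eq_zero_top (hc : 0 < c) {w₀ w₁ : ℂ} (h : w₁.im = Real.pi) :
    logPotential c w₀ w₁ = 0 := by
  have : w₁ - starRingEnd ℂ w₀ = starRingEnd ℂ (w₁ - w₀) + 2 * Real.pi * I := by
    apply Complex.ext
    · simp
    · simp [h]; ring
  rw [logPotential, this, cylTheta_add_two_pi_I, norm_neg, cylTheta_conj hc, RCLike.norm_conj,
    sub_self]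

/-- The claimed value, evaluated along the paths, is a double primitive of the integrand.
Disjointness of the paths up to the endpoints keeps all arguments off the lattice on the closed
square. -/
theorem IsGauge.isCorrelation_two (hg : IsGauge Ω c b φ ω) (hc : 0 < c)
    (hφ : IsUniformization Ω c φ)
    (hr : IsSqrtDeriv φ r) (hf : ∀ η : ℂ, ∀ z₁ ∈ cylLift Ω, SolvesBVP Ω η z₁ (f η z₁)) {e : ℝ}
    (he : ∀ z ∉ latticePts c,
      ellKernel b c z * ellKernel b c (-z) = thetaLogDeriv₂ c z + e) {z : Fin 2 → ℂ}
    (hz : ∀ k, z k ∈ closedStrip) (hex : ∃ γ, IsPathSystem c γ z) :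
    IsCorrelation c (pulledF f φ r) z (-(1 / (2 * Real.pi ^ 2)) * logPotential c (z 0) (z 1) -
      e / Real.pi ^ 2 * ((z 0).im * (z 1).im)) := by
  refine isCorrelation_of_forall hex fun γ hγ => ?_
  set v : Fin 2 → ℝ → ℂ := fun k => derivWithin (γ k) (Icc 0 1) with hv
  have hl : ∀ s ∈ Icc (0 : ℝ) 1, ∀ t ∈ Icc (0 : ℝ) 1, γ 1 t - γ 0 s ∉ latticePts c ∧
      γ 1 t - starRingEnd ℂ (γ 0 s) ∉ latticePts c := fun s hs t ht => by
    have := conjSign_sub_not_mem_latticePts (hγ.mem_closedStrip hz 0 hs)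
      (hγ.mem_closedStrip hz 1 ht) (hγ.disjoint 1 0 (by decide) t ht s hs)
    exact ⟨this true true, this false true⟩
  have hγc := hγ.continuousOn
  have hvc : ∀ k, ContinuousOn (v k) (Icc 0 1) := hγ.continuousOn_derivWithin
  have cP : ∀ w ∉ latticePts c, ContinuousAt (thetaLogDeriv₂ c) w := fun w hw =>
    (differentiableAt_thetaLogDeriv₂ hc hw).continuousAt
  have cJ : ∀ w ∉ latticePts c, ContinuousAt (thetaLogDeriv c) w := fun w hw =>
    (hasDerivAt_thetaLogDeriv hc hw).continuousAt
  have cL : ∀ w ∉ latticePts c, ContinuousAt (fun w => Real.log ‖cylTheta c w‖) w := fun w hw =>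
    ((differentiable_cylTheta hc).continuous.norm.continuousAt).log
      (norm_ne_zero_iff.mpr (mt (cylTheta_eq_zero_iff hc w).mp hw))
  -- A is the integrand, C its primitive in t, and D the primitive of C in s.
  set A : ℝ → ℝ → ℝ := fun s t => 1 / (2 * Real.pi ^ 2) *
      (thetaLogDeriv₂ c (γ 1 t - γ 0 s) * v 0 s * v 1 t -
        thetaLogDeriv₂ c (γ 1 t - starRingEnd ℂ (γ 0 s)) * starRingEnd ℂ (v 0 s) * v 1 t).re -
      e / Real.pi ^ 2 * ((v 0 s).im * (v 1 t).im) with hA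
  set C : ℝ → ℝ → ℝ := fun s t => 1 / (2 * Real.pi ^ 2) *
      (thetaLogDeriv c (γ 1 t - γ 0 s) * v 0 s -
        thetaLogDeriv c (γ 1 t - starRingEnd ℂ (γ 0 s)) * starRingEnd ℂ (v 0 s)).re -
      e / Real.pi ^ 2 * ((v 0 s).im * (γ 1 t).im) with hC
  set D : ℝ → ℝ → ℝ := fun s t => -(1 / (2 * Real.pi ^ 2)) * logPotential c (γ 0 s) (γ 1 t) -
      e / Real.pi ^ 2 * ((γ 0 s).im * (γ 1 t).im) with hD
  set Q : Set (ℝ × ℝ) := Icc 0 1 ×ˢ Icc 0 1 with hQ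
  have g0 : ContinuousOn (fun p : ℝ × ℝ => γ 0 p.1) Q :=
    (hγc 0).comp continuousOn_fst fun p hp => hp.1
  have g1 : ContinuousOn (fun p : ℝ × ℝ => γ 1 p.2) Q :=
    (hγc 1).comp continuousOn_snd fun p hp => hp.2
  have v0 : ContinuousOn (fun p : ℝ × ℝ => v 0 p.1) Q :=
    (hvc 0).comp continuousOn_fst fun p hp => hp.1
  have v1 : ContinuousOn (fun p : ℝ × ℝ => v 1 p.2) Q :=
    (hvc 1).comp continuousOn_snd fun p hp => hp.2
  have g0' := continuous_conj.comp_continuousOn g0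
  have v0' := continuous_conj.comp_continuousOn v0
  have gen : ∀ {E : Type} [TopologicalSpace E] {k : ℂ → E},
      (∀ w ∉ latticePts c, ContinuousAt k w) →
      ContinuousOn (fun p : ℝ × ℝ => k (γ 1 p.2 - γ 0 p.1)) Q ∧
      ContinuousOn (fun p : ℝ × ℝ => k (γ 1 p.2 - starRingEnd ℂ (γ 0 p.1))) Q := by
    intro E _ k hk
    constructor <;> intro p hp
    · exact (hk _ (hl _ hp.1 _ hp.2).1).comp_continuousWithinAt
        (f := fun p : ℝ × ℝ => γ 1 p.2 - γ 0 p.1) ((g1.sub g0) p hp)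
    · exact (hk _ (hl _ hp.1 _ hp.2).2).comp_continuousWithinAt
        (f := fun p : ℝ × ℝ => γ 1 p.2 - starRingEnd ℂ (γ 0 p.1)) ((g1.sub g0') p hp)
  have hAc : ContinuousOn (fun p : ℝ × ℝ => A p.1 p.2) Q := by
    refine (continuousOn_const.mul (continuous_re.comp_continuousOn
      ((((gen cP).1.mul v0).mul v1).sub (((gen cP).2.mul v0').mul v1)))).sub
      (continuousOn_const.mul ((continuous_im.comp_continuousOn v0).mul
        (continuous_im.comp_continuousOn v1)))
  have hCc : ContinuousOn (fun p : ℝ × ℝ => C p.1 p.2) Q := by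
    refine (continuousOn_const.mul (continuous_re.comp_continuousOn
      (((gen cJ).1.mul v0).sub ((gen cJ).2.mul v0')))).sub
      (continuousOn_const.mul ((continuous_im.comp_continuousOn v0).mul
        (continuous_im.comp_continuousOn g1)))
  have hDc : ContinuousOn (fun p : ℝ × ℝ => D p.1 p.2) Q := by
    refine (continuousOn_const.mul ((gen cL).1.sub (gen cL).2)).sub
      (continuousOn_const.mul ((continuous_im.comp_continuousOn g0).mul
        (continuous_im.comp_continuousOn g1)))
  have sec1 : ∀ {k : ℝ → ℝ → ℝ}, ContinuousOn (fun p : ℝ × ℝ => k p.1 p.2) Q →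
      ∀ s ∈ Icc (0 : ℝ) 1, ContinuousOn (k s) (Icc 0 1) := fun {k} hk s hs =>
    hk.comp (f := fun t => (s, t)) (by fun_prop) fun t ht => ⟨hs, ht⟩
  have sec2 : ∀ {k : ℝ → ℝ → ℝ}, ContinuousOn (fun p : ℝ × ℝ => k p.1 p.2) Q →
      ∀ t ∈ Icc (0 : ℝ) 1, ContinuousOn (fun s => k s t) (Icc 0 1) := fun {k} hk t ht =>
    hk.comp (f := fun s => (s, t)) (by fun_prop) fun s hs => ⟨hs, ht⟩
  have him : ∀ {k : ℝ → ℂ} {k' : ℂ} {t : ℝ}, HasDerivAt k k' t →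
      HasDerivAt (fun t => (k t).im) k'.im t := fun h => imCLM.hasFDerivAt.comp_hasDerivAt _ h
  have hre : ∀ {k : ℝ → ℂ} {k' : ℂ} {t : ℝ}, HasDerivAt k k' t →
      HasDerivAt (fun t => (k t).re) k'.re t := fun h => reCLM.hasFDerivAt.comp_hasDerivAt _ h
  have hint := integral_square_of_hasDerivAt (A := A) (C := C) (D := D) (sec1 hAc) (sec1 hCc)
    (fun s hs t ht => by
      have h1 := hγ.hasDerivAt 1 ht
      obtain ⟨l1, l2⟩ := hl s hs t (Ioo_subset_Icc_self ht)
      have d1 := (HasDerivAt.comp t (hasDerivAt_thetaLogDeriv hc l1)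
        (h1.sub_const (γ 0 s))).mul_const (v 0 s)
      have d2 := (HasDerivAt.comp t (hasDerivAt_thetaLogDeriv hc l2)
        (h1.sub_const (starRingEnd ℂ (γ 0 s)))).mul_const (starRingEnd ℂ (v 0 s))
      refine (((hre (d1.fun_sub d2)).const_mul (1 / (2 * Real.pi ^ 2))).fun_sub
        (((him h1).const_mul (v 0 s).im).const_mul (e / Real.pi ^ 2))).congr_deriv ?_
      simp only [hA, hv]
      ring_nf) (sec2 hCc) (sec2 hDc)
    (fun t ht s hs => by
      have h0 := hγ.hasDerivAt 0 hs
      have h0' : HasDerivAt (fun s => starRingEnd ℂ (γ 0 s)) (starRingEnd ℂ (v 0 s)) s :=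
        conjCLE.toContinuousLinearMap.hasFDerivAt.comp_hasDerivAt s h0
      obtain ⟨l1, l2⟩ := hl s (Ioo_subset_Icc_self hs) t ht
      have d1 := hasDerivAt_log_norm_cylTheta hc (h0.const_sub (γ 1 t)) l1
      have d2 := hasDerivAt_log_norm_cylTheta hc (h0'.const_sub (γ 1 t)) l2
      refine (((d1.fun_sub d2).const_mul (-(1 / (2 * Real.pi ^ 2)))).fun_sub
        (((him h0).mul_const (γ 1 t).im).const_mul (e / Real.pi ^ 2))).congr_deriv ?_
      simp only [hC, hv, mul_neg, neg_re, sub_re]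
      ring)
  refine ⟨fun t => A (t 0) (t 1), ?_, fun t ht => ?_, ?_⟩
  · exact hAc.comp (f := fun t : Fin 2 → ℝ => (t 0, t 1)) (by fun_prop) fun t ht =>
      ⟨⟨ht.1 0, ht.2 0⟩, ⟨ht.1 1, ht.2 1⟩⟩
  · exact hg.formA_two hc hφ hr hf he (fun k => hγ.inside k _ (ht k))
      (hγ.distinctMod fun k => Ioo_subset_Icc_self (ht k)) _
  · have hpre : Icc (0 : Fin 2 → ℝ) 1 = MeasurableEquiv.finTwoArrow ⁻¹' Q := by
      ext t
      simp only [mem_Icc, Pi.le_def, Fin.forall_fin_two, hQ, mem_preimage, mem_prod,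
        MeasurableEquiv.finTwoArrow_apply, Pi.zero_apply, Pi.one_apply]
      tauto
    have hmp := (volume_preserving_finTwoArrow ℝ).setIntegral_preimage_emb
      (MeasurableEquiv.measurableEmbedding _) (fun p => A p.1 p.2) Q
    rw [← hpre] at hmp
    refine hmp.trans ?_
    rw [hQ, Measure.volume_eq_prod, setIntegral_prod _ (by
      rw [← Measure.volume_eq_prod]
      exact hAc.integrableOn_compact (isCompact_Icc.prod isCompact_Icc)), hint]
    -- Three of the four corner terms vanish, because at least one path is at its starting point on
    -- the bottom.
    have s0 := hγ.start 0
    have s1 := hγ.start 1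
    simp only [hD, hγ.finish, logPotential_eq_zero_left s0, logPotential_eq_zero_right hc s1, s0,
      s1]
    ring

end integrals

/-- Only countably many slopes are forbidden. -/
theorem exists_slope_not_mem {n : ℕ} (c : ℝ) (z : Fin n → ℂ) :
    ∃ θ : ℝ, ∀ j k, ∀ m : ℤ, (z j).im ≠ (z k).im →
      (z j).re - (z k).re - m * c ≠ θ * ((z j).im - (z k).im) := by
  have hcount : (range fun p : Fin n × Fin n × ℤ =>
      ((z p.1).re - (z p.2.1).re - p.2.2 * c) / ((z p.1).im - (z p.2.1).im)).Countable :=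
    countable_range _
  obtain ⟨θ, hθ⟩ := (hcount.dense_compl ℝ).nonempty
  refine ⟨θ, fun j k m hne h => hθ ⟨(j, k, m), ?_⟩⟩
  simp only
  rw [h, mul_div_cancel_right₀ _ (sub_ne_zero.mpr hne)]

/-- Non-intersecting paths exist. -/
theorem exists_isPathSystem {n : ℕ} {c : ℝ} {z : Fin n → ℂ} (hz : ∀ k, z k ∈ closedStrip)
    (hd : DistinctMod c z) : ∃ γ, IsPathSystem c γ z := by
  have hpi : 1 < Real.pi := by linarith [Real.pi_gt_three]
  obtain ⟨θ, hθ⟩ := exists_slope_not_mem c z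
  -- The height goes from 0 to Im z_k; the term t(1 − t) lifts the path off the bottom even if z_k
  -- lies there, and is small enough to stay below π.
  set p : Fin n → ℝ → ℝ := fun k t => (z k).im * t + t * (1 - t) with hp
  -- All paths move along parallel lines of direction θ + i. Two of them could meet only on a common
  -- line modulo c, which the choice of θ excludes for endpoints of different heights and
  -- distinctness excludes for equal heights.
  set γ : Fin n → ℝ → ℂ := fun k t => z k + (θ + I) * ((p k t - (z k).im : ℝ) : ℂ) with hγ
  have him : ∀ k t, (γ k t).im = p k t := fun k t => by simp [hγ]
  have hre : ∀ k t, (γ k t).re = (z k).re + θ * (p k t - (z k).im) := fun k t => by simp [hγ]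
  refine ⟨γ, fun k => ?_, fun k => ?_, fun k t ht => ?_, fun k => ?_, fun j k hjk s _ t _ m h => ?_⟩
  · have h1 : ContDiff ℝ 1 fun t => p k t - (z k).im := by fun_prop
    exact (contDiff_const.add (contDiff_const.mul (ofRealCLM.contDiff.comp h1))).contDiffOn
  · simp [him, hp]
  · obtain ⟨h0, h1⟩ := ht
    obtain ⟨hz0, hz1⟩ := hz k
    refine ⟨?_, ?_⟩
    · rw [him]
      have := mul_pos h0 (sub_pos.mpr h1)
      have := mul_nonneg hz0 h0.le
      simp only [hp]
      linarith
    · rw [him]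
      simp only [hp]
      nlinarith [mul_nonneg (sub_nonneg.mpr hz1) h0.le,
        mul_pos (sub_pos.mpr h1) (show 0 < Real.pi - t by linarith)]
  · simp [hγ, hp]
  · have e1 : p j s = p k t := by
      have := congrArg im h
      simpa [him] using this
    have e2 : (γ j s).re = (γ k t + m * c).re := congrArg re h
    rw [hre, add_re, hre, e1] at e2
    have e3 : ((m : ℂ) * c).re = m * c := by simp
    rw [e3] at e2
    by_cases hne : (z j).im = (z k).im
    · refine hd j k hjk m (Complex.ext ?_ ?_)
      · rw [add_re, e3]
        rw [hne] at e2
        linarith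
      · simpa using hne
    · exact hθ j k m hne (by linarith)

/-! ### The Green's function as a logarithmic potential -/

section green

variable {c : ℝ}

/-- Locally v = Re F with F holomorphic, and the maximum modulus principle applies to e^F. -/
theorem eventually_eq_of_isLocalMax_harmonic {v : ℂ → ℝ} {w : ℂ}
    (hv : InnerProductSpace.HarmonicAt v w) (hm : IsLocalMax v w) : ∀ᶠ x in 𝓝 w, v x = v w := by
  obtain ⟨R, hR, hball⟩ := Metric.eventually_nhds_iff_ball.mp hv.eventually
  obtain ⟨F, hF, hre⟩ := InnerProductSpace.HarmonicOnNhd.exists_analyticOnNhd_ball_re_eq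
    (f := v) (z := w) (R := R) hball
  have hnb := Metric.ball_mem_nhds w hR
  have hn : ∀ x ∈ Metric.ball w R, ‖exp (F x)‖ = Real.exp (v x) := fun x hx => by
    rw [norm_exp, ← hre hx]
  have hw := Metric.mem_ball_self (x := w) hR
  have h1 : IsLocalMax (norm ∘ fun x => exp (F x)) w := by
    filter_upwards [hm, hnb] with x hx hxb
    simp only [Function.comp_apply, hn x hxb, hn w hw]
    exact Real.exp_le_exp.mpr hx
  have h2 := Complex.eventually_eq_of_isLocalMax_norm (f := fun x => exp (F x)) (by
    filter_upwards [hnb] with x hx using (hF x hx).differentiableAt.cexp) h1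
  filter_upwards [h2, hnb] with x hx hxb
  have := congrArg norm hx
  rw [hn x hxb, hn w hw] at this
  exact Real.exp_injective this

/-- The orbit of a point under the translations by multiples of the period. -/
def periodOrbit (c : ℝ) (z₀ : ℂ) : Set ℂ := {z | ∃ m : ℤ, z = z₀ + m * c}

theorem add_int_mem_openStrip {z : ℂ} (hz : z ∈ openStrip) (m : ℤ) : z + m * c ∈ openStrip := by
  have := add_ofReal_mem_openStrip hz (m * c)
  push_cast at this
  exact this

theorem add_int_mem_periodOrbit {z z₀ : ℂ} (m : ℤ) :
    z + m * c ∈ periodOrbit c z₀ ↔ z ∈ periodOrbit c z₀ := by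
  constructor
  · rintro ⟨k, hk⟩
    exact ⟨k - m, by push_cast; linear_combination hk⟩
  · rintro ⟨k, rfl⟩
    exact ⟨k + m, by push_cast; ring⟩

theorem mem_periodOrbit_of_sub_mem_latticePts {z z₀ : ℂ} (hz : z ∈ openStrip)
    (hz₀ : z₀ ∈ openStrip) (h : z - z₀ ∈ latticePts c) : z ∈ periodOrbit c z₀ := by
  obtain ⟨h1, h2⟩ := hz
  obtain ⟨h3, h4⟩ := hz₀
  obtain ⟨m, hm⟩ := mem_latticePts_of_abs_im_lt h (by
    rw [sub_im, abs_lt]; constructor <;> linarith)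
  exact ⟨m, by linear_combination hm⟩

theorem isOpen_openStrip_diff_periodOrbit (hc : 0 < c) {z₀ : ℂ} (hz₀ : z₀ ∈ openStrip) :
    IsOpen (openStrip \ periodOrbit c z₀) := by
  have : openStrip \ periodOrbit c z₀ = openStrip ∩ {z : ℂ | z - z₀ ∈ (latticePts c)ᶜ} := by
    ext z
    constructor
    · rintro ⟨h1, h2⟩
      exact ⟨h1, fun h => h2 (mem_periodOrbit_of_sub_mem_latticePts h1 hz₀ h)⟩
    · rintro ⟨h1, h2⟩
      refine ⟨h1, ?_⟩
      rintro ⟨m, rfl⟩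
      exact h2 ⟨m, 0, by simp⟩
  rw [this]
  exact isOpen_openStrip.inter
    ((isClosed_latticePts hc).isOpen_compl.preimage (continuous_sub_right z₀))

/-- Maximum principle in the cylinder for functions with a negative pole. -/
theorem nonpos_of_harmonic (hc : 0 < c) {z₀ : ℂ} (hz₀ : z₀ ∈ openStrip) {v : ℂ → ℝ}
    (hper : ∀ w ∈ openStrip \ periodOrbit c z₀, v (w + c) = v w)
    (hh : InnerProductSpace.HarmonicOnNhd v (openStrip \ periodOrbit c z₀))
    (hbd : ∀ w : ℂ, w.im = 0 ∨ w.im = Real.pi → Tendsto v (𝓝[openStrip] w) (𝓝 0))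
    (hpole : Tendsto v (𝓝[≠] z₀) atBot) :
    ∀ w ∈ openStrip \ periodOrbit c z₀, v w ≤ 0 := by
  set U := openStrip \ periodOrbit c z₀ with hU
  have hUo : IsOpen U := isOpen_openStrip_diff_periodOrbit hc hz₀
  have hUm : ∀ w ∈ U, ∀ m : ℤ, w + m * c ∈ U := fun w hw m =>
    ⟨add_int_mem_openStrip hw.1 m, mt (add_int_mem_periodOrbit m).mp hw.2⟩
  have hperm : ∀ w ∈ U, ∀ m : ℤ, v (w + m * c) = v w := by
    intro w hw m
    induction m with
    | zero => simp
    | succ k ih =>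
      rw [← ih, ← hper _ (hUm w hw k)]
      push_cast
      ring_nf
    | pred k ih =>
      rw [← ih, ← hper _ (hUm w hw (-k - 1))]
      push_cast
      ring_nf
  by_contra! hcon
  obtain ⟨w₀, hw₀, hpos⟩ := hcon
  set a := v w₀ with ha
  have hcont : ContinuousOn v U := hh.continuousOn
  set K : Set ℂ := Icc 0 c ×ℂ Icc 0 Real.pi with hK
  have hKc : IsCompact K := isCompact_Icc.reProdIm isCompact_Icc
  -- On one period, the superlevel set of a positive value stays away from the edges and the poles,
  -- so it is compact and the maximum is attained.
  set K' : Set ℂ := {w | w ∈ K ∧ w ∈ U ∧ a ≤ v w} with hK'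
  have hK'c : IsCompact K' := by
    refine hKc.of_isClosed_subset (isClosed_of_closure_subset fun w hw => ?_) fun w hw => hw.1
    have hwK : w ∈ K := closure_minimal (fun w hw => hw.1) hKc.isClosed hw
    rw [mem_closure_iff_frequently] at hw
    have hbdry : ¬(w.im = 0 ∨ w.im = Real.pi) := fun h => by
      have h1 := (hbd w h).eventually (gt_mem_nhds hpos)
      rw [eventually_nhdsWithin_iff] at h1
      obtain ⟨x, hx, hx2⟩ := (hw.and_eventually h1).exists
      exact absurd (hx2 hx.2.1.1) (not_lt.mpr hx.2.2)
    push Not at hbdry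
    have hws : w ∈ openStrip :=
      ⟨lt_of_le_of_ne hwK.2.1 (Ne.symm hbdry.1), lt_of_le_of_ne hwK.2.2 hbdry.2⟩
    have hwo : w ∉ periodOrbit c z₀ := by
      rintro ⟨m, rfl⟩
      have h1 := hpole.eventually (eventually_lt_atBot a)
      have h2 := (tendsto_sub_nhdsNE z₀ (m * c)).eventually h1
      rw [eventually_nhdsWithin_iff] at h2
      obtain ⟨x, hx, hx2⟩ := (hw.and_eventually h2).exists
      have hne : x ≠ z₀ + m * c := fun h => hx.2.1.2 ⟨m, h⟩
      have h3 := hx2 hne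
      have h4 := hperm x hx.2.1 (-m)
      push_cast at h4
      rw [neg_mul, ← sub_eq_add_neg] at h4
      rw [h4] at h3
      exact absurd h3 (not_lt.mpr hx.2.2)
    refine ⟨hwK, ⟨hws, hwo⟩, ?_⟩
    by_contra! hlt
    have h1 := (hcont.continuousAt (hUo.mem_nhds ⟨hws, hwo⟩)).eventually (gt_mem_nhds hlt)
    obtain ⟨x, hx, hx2⟩ := (hw.and_eventually h1).exists
    exact absurd hx2 (not_lt.mpr hx.2.2)
  have hshift : ∀ w ∈ U, ∃ m : ℤ, w + m * c ∈ K := fun w hw => by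
    refine ⟨-⌊w.re / c⌋, ?_, ?_⟩
    · have h3 := Int.floor_le (w.re / c)
      have h4 := Int.lt_floor_add_one (w.re / c)
      rw [le_div_iff₀ hc] at h3
      rw [div_lt_iff₀ hc] at h4
      have e : (w + ((-⌊w.re / c⌋ : ℤ) : ℂ) * c).re = w.re - ⌊w.re / c⌋ * c := by simp; ring
      rw [mem_preimage, e]
      exact ⟨by linarith, by linarith⟩
    · have e : (w + ((-⌊w.re / c⌋ : ℤ) : ℂ) * c).im = w.im := by simp
      rw [mem_preimage, e]
      exact ⟨hw.1.1.le, hw.1.2.le⟩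
  have hmem : ∀ w ∈ U, a ≤ v w → ∃ m : ℤ, w + m * c ∈ K' := fun w hw h => by
    obtain ⟨m, hm⟩ := hshift w hw
    exact ⟨m, hm, hUm w hw m, by rwa [hperm w hw]⟩
  have hK'ne : K'.Nonempty := by
    obtain ⟨m, hm⟩ := hmem w₀ hw₀ le_rfl
    exact ⟨_, hm⟩
  have hcK' : ContinuousOn v K' := hcont.mono fun w hw => hw.2.1
  obtain ⟨p, hp, hpmax⟩ := hK'c.exists_isMaxOn hK'ne hcK'
  have hmax : ∀ w ∈ U, v w ≤ v p := fun w hw => by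
    by_cases h : a ≤ v w
    · obtain ⟨m, hm⟩ := hmem w hw h
      rw [← hperm w hw m]
      exact hpmax hm
    · exact (not_le.mp h).le.trans hp.2.2
  have hK''c : IsCompact (K' ∩ v ⁻¹' {v p}) :=
    hK'c.of_isClosed_subset (hcK'.preimage_isClosed_of_isClosed hK'c.isClosed isClosed_singleton)
      inter_subset_left
  -- Among the maximum points on one period take a highest one: local constancy would produce a
  -- higher one just above it. This avoids an argument about connectedness.
  obtain ⟨q, ⟨hq, hqv⟩, hqmax⟩ := hK''c.exists_isMaxOn ⟨p, hp, rfl⟩ continuous_im.continuousOn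
  have hqv : v q = v p := hqv
  have hloc := eventually_eq_of_isLocalMax_harmonic (hh q hq.2.1) (by
    filter_upwards [hUo.mem_nhds hq.2.1] with w hw
    rw [hqv]
    exact hmax w hw)
  have hline : Tendsto (fun t : ℝ => q + t * I) (𝓝[>] 0) (𝓝 q) := by
    have : Continuous fun t : ℝ => q + t * I := by fun_prop
    simpa using (this.tendsto 0).mono_left (nhdsWithin_le_nhds (s := Ioi (0 : ℝ)))
  obtain ⟨t, ht1, ht2, ht3⟩ := ((hline.eventually hloc).and
    ((hline.eventually (hUo.mem_nhds hq.2.1)).and self_mem_nhdsWithin)).exists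
  have ht3 : 0 < t := ht3
  have hqt : q + t * I ∈ K' ∩ v ⁻¹' {v p} := by
    refine ⟨⟨⟨?_, ?_⟩, ht2, ?_⟩, ?_⟩
    · have : (q + t * I).re = q.re := by simp
      rw [mem_preimage, this]
      exact hq.1.1
    · exact ⟨ht2.1.1.le, ht2.1.2.le⟩
    · rw [ht1]
      exact hq.2.2
    · rw [mem_preimage, ht1, hqv]
      rfl
  have := hqmax hqt
  simp at this
  linarith

/-- The multipliers of the two thetas have equal modulus, since w − z₀ and w − z̄₀ have the same
real part. -/
theorem logPotential_add_period (hc : 0 < c) {z₀ w : ℂ} (h1 : w - z₀ ∉ latticePts c)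
    (h2 : w - starRingEnd ℂ z₀ ∉ latticePts c) :
    logPotential c z₀ (w + c) = logPotential c z₀ w := by
  have h1' := norm_ne_zero_iff.mpr (mt (cylTheta_eq_zero_iff hc _).mp h1)
  have h2' := norm_ne_zero_iff.mpr (mt (cylTheta_eq_zero_iff hc _).mp h2)
  rw [logPotential, logPotential, show w + c - z₀ = w - z₀ + c by ring,
    show w + c - starRingEnd ℂ z₀ = w - starRingEnd ℂ z₀ + c by ring, cylTheta_add_period hc,
    cylTheta_add_period hc, norm_mul, norm_mul, norm_neg, norm_neg, norm_exp, norm_exp,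
    Real.log_mul (Real.exp_ne_zero _) h1', Real.log_mul (Real.exp_ne_zero _) h2', Real.log_exp,
    Real.log_exp]
  simp

theorem continuousAt_log_norm_cylTheta_sub (hc : 0 < c) {a w : ℂ} (h : w - a ∉ latticePts c) :
    ContinuousAt (fun w => Real.log ‖cylTheta c (w - a)‖) w := by
  have : Continuous fun w => ‖cylTheta c (w - a)‖ :=
    ((differentiable_cylTheta hc).continuous.comp (continuous_sub_right a)).norm
  exact this.continuousAt.log (norm_ne_zero_iff.mpr (mt (cylTheta_eq_zero_iff hc _).mp h))

theorem harmonicAt_log_norm_cylTheta_sub (hc : 0 < c) {a w : ℂ} (h : w - a ∉ latticePts c) :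
    InnerProductSpace.HarmonicAt (fun w => Real.log ‖cylTheta c (w - a)‖) w := by
  have hd : Differentiable ℂ fun w => cylTheta c (w - a) :=
    (differentiable_cylTheta hc).comp (differentiable_id.sub_const a)
  exact (hd.analyticAt w).harmonicAt_log_norm (mt (cylTheta_eq_zero_iff hc _).mp h)

theorem IsDirichletGreen.eq_logPotential (hc : 0 < c) {G : ℂ → ℂ → ℝ} (hG : IsDirichletGreen c G)
    {z₀ : ℂ} (hz₀ : z₀ ∈ openStrip) :
    ∀ w ∈ openStrip \ periodOrbit c z₀, G z₀ w = -(1 / (2 * Real.pi)) * logPotential c z₀ w := by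
  have hpi := Real.pi_pos
  have hcl : z₀ ∈ closedStrip := ⟨hz₀.1.le, hz₀.2.le⟩
  set LP := logPotential c z₀ with hLP
  have hl1 : ∀ w ∈ openStrip \ periodOrbit c z₀, w - z₀ ∉ latticePts c := fun w hw h =>
    hw.2 (mem_periodOrbit_of_sub_mem_latticePts hw.1 hz₀ h)
  have hl2 : ∀ w ∈ closedStrip, w - starRingEnd ℂ z₀ ∉ latticePts c := fun w hw => by
    obtain ⟨h1, h2⟩ := hw
    obtain ⟨h3, h4⟩ := hz₀
    refine not_mem_latticePts_of_im_lt ?_ ?_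
    · simp only [sub_im, conj_im]; intro h; linarith
    · simp only [sub_im, conj_im]; rw [abs_lt]; constructor <;> linarith
  have hop : ∀ w ∈ openStrip, w ∈ closedStrip := fun w hw => ⟨hw.1.le, hw.2.le⟩
  have hLPper : ∀ w ∈ openStrip \ periodOrbit c z₀, LP (w + c) = LP w := fun w hw =>
    logPotential_add_period hc (hl1 w hw) (hl2 w (hop w hw.1))
  have hLPh : InnerProductSpace.HarmonicOnNhd LP (openStrip \ periodOrbit c z₀) := fun w hw =>
    (harmonicAt_log_norm_cylTheta_sub hc (hl1 w hw)).sub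
      (harmonicAt_log_norm_cylTheta_sub hc (hl2 w (hop w hw.1)))
  have hLPbd : ∀ w : ℂ, w.im = 0 ∨ w.im = Real.pi → Tendsto LP (𝓝[openStrip] w) (𝓝 0) := by
    intro w hw
    have hwc : w ∈ closedStrip := by
      rcases hw with h | h <;> constructor <;> linarith
    have hw1 : w - z₀ ∉ latticePts c := by
      obtain ⟨h1, h2⟩ := hwc
      obtain ⟨h3, h4⟩ := hz₀
      refine not_mem_latticePts_of_im_lt ?_ ?_
      · rw [sub_im]; intro h; rcases hw with h' | h' <;> linarith
      · rw [sub_im, abs_lt]; constructor <;> linarith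
    have hcont : ContinuousAt LP w := (continuousAt_log_norm_cylTheta_sub hc hw1).sub
      (continuousAt_log_norm_cylTheta_sub hc (hl2 w hwc))
    have h0 : LP w = 0 := by
      rcases hw with h | h
      · exact logPotential_eq_zero_right hc h
      · exact logPotential_eq_zero_top hc h
    have := hcont.tendsto
    rw [h0] at this
    exact this.mono_left nhdsWithin_le_nhds
  have hz₀2 := continuousAt_log_norm_cylTheta_sub hc (hl2 z₀ hcl)
  have hLPpole : Tendsto LP (𝓝[≠] z₀) atBot := by
    have h1 : Tendsto (fun w => ‖cylTheta c (w - z₀)‖) (𝓝[≠] z₀) (𝓝[≠] 0) := by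
      refine tendsto_nhdsWithin_iff.mpr ⟨?_, ?_⟩
      · have : Continuous fun w => ‖cylTheta c (w - z₀)‖ :=
          ((differentiable_cylTheta hc).continuous.comp (continuous_sub_right z₀)).norm
        have h := this.tendsto z₀
        rw [sub_self, cylTheta_zero, norm_zero] at h
        exact h.mono_left nhdsWithin_le_nhds
      · have h := tendsto_sub_nhdsNE 0 z₀
        rw [zero_add] at h
        filter_upwards [h.eventually (cylTheta_eventually_ne hc 0)] with w hw
        exact norm_ne_zero_iff.mpr hw
    exact (Real.tendsto_log_nhdsNE_zero.comp h1).atBot_add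
      (hz₀2.tendsto.mono_left nhdsWithin_le_nhds).neg |>.congr fun w => (sub_eq_add_neg _ _).symm
  set u : ℂ → ℝ := fun w => G z₀ w + 1 / (2 * Real.pi) * LP w with hu
  -- The logarithmic singularities cancel: dividing one factor w − z₀ out of θ leaves a function
  -- that does not vanish at the pole.
  have huO : u =O[𝓝[≠] z₀] fun _ => (1 : ℝ) := by
    have hd : Differentiable ℂ (dslope (cylTheta c) 0) := by
      rw [← differentiableOn_univ, differentiableOn_dslope univ_mem]
      exact (differentiable_cylTheta hc).differentiableOn
    have h1 : ContinuousAt (fun w => Real.log ‖dslope (cylTheta c) 0 (w - z₀)‖ -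
        Real.log ‖cylTheta c (w - starRingEnd ℂ z₀)‖) z₀ := by
      refine ContinuousAt.sub (ContinuousAt.log ?_ ?_) hz₀2
      · exact (hd.continuous.comp (continuous_sub_right z₀)).norm.continuousAt
      · rw [sub_self, dslope_same]
        exact norm_ne_zero_iff.mpr (deriv_cylTheta_zero_ne hc)
    have h2 := ((h1.tendsto.mono_left (nhdsWithin_le_nhds (s := {z₀}ᶜ))).isBigO_one ℝ).const_mul_left
      (1 / (2 * Real.pi))
    refine ((hG.singularity z₀ hz₀).add h2).congr' ?_ EventuallyEq.rfl
    have h := tendsto_sub_nhdsNE 0 z₀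
    rw [zero_add] at h
    filter_upwards [self_mem_nhdsWithin, h.eventually (cylTheta_eventually_ne hc 0)] with w hw hw2
    have e := cylTheta_eq_mul_dslope (c := c) (w - z₀)
    have hne : w - z₀ ≠ 0 := sub_ne_zero.mpr hw
    have hne2 : dslope (cylTheta c) 0 (w - z₀) ≠ 0 := fun h => hw2 (by rw [e, h, mul_zero])
    simp only [hu, hLP, logPotential, e, norm_mul]
    rw [Real.log_mul (norm_ne_zero_iff.mpr hne) (norm_ne_zero_iff.mpr hne2)]
    ring
  have huper : ∀ w ∈ openStrip \ periodOrbit c z₀, u (w + c) = u w := fun w hw => by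
    simp only [hu, hLPper w hw, hG.periodic z₀ hz₀ w hw.1]
  have huh : InnerProductSpace.HarmonicOnNhd u (openStrip \ periodOrbit c z₀) :=
    (hG.harmonic z₀ hz₀).add (hLPh.const_smul (c := 1 / (2 * Real.pi)))
  have hubd : ∀ w : ℂ, w.im = 0 ∨ w.im = Real.pi → Tendsto u (𝓝[openStrip] w) (𝓝 0) :=
    fun w hw => by
      have := (hG.boundary z₀ hz₀ w hw).add ((hLPbd w hw).const_mul (1 / (2 * Real.pi)))
      rwa [mul_zero, add_zero] at this
  -- Only boundedness of u at the pole is known. Adding ε times the potential, which tends to −∞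
  -- there, makes the maximum principle applicable; then ε → 0. The signs σ = ±1 give u = 0.
  have key : ∀ σ : ℝ, ∀ w ∈ openStrip \ periodOrbit c z₀, σ * u w ≤ 0 := by
    intro σ w hw
    have hε : ∀ ε > (0 : ℝ), σ * u w + ε * LP w ≤ 0 := fun ε hε => by
      refine nonpos_of_harmonic hc hz₀ (v := fun w => σ * u w + ε * LP w) (fun w hw => ?_)
        ((huh.const_smul (c := σ)).add (hLPh.const_smul (c := ε))) (fun w hw => ?_) ?_ w hw
      · simp only [huper w hw, hLPper w hw]
      · have := ((hubd w hw).const_mul σ).add ((hLPbd w hw).const_mul ε)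
        rwa [mul_zero, mul_zero, add_zero] at this
      · obtain ⟨B, hB⟩ := (huO.const_mul_left σ).bound
        refine tendsto_atBot_mono' _ ?_ (tendsto_atBot_add_const_left _ B (hLPpole.const_mul_atBot hε))
        filter_upwards [hB] with x hx
        have := (le_abs_self _).trans hx
        rw [norm_one, mul_one] at this
        linarith
    have hlim : Tendsto (fun ε : ℝ => σ * u w + ε * LP w) (𝓝[>] 0) (𝓝 (σ * u w + 0 * LP w)) :=
      ((by fun_prop : Continuous fun ε : ℝ => σ * u w + ε * LP w).tendsto 0).mono_left
        nhdsWithin_le_nhds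
    rw [zero_mul, add_zero] at hlim
    exact le_of_tendsto hlim (by filter_upwards [self_mem_nhdsWithin] with ε h using hε ε h)
  intro w hw
  have h1 := key 1 w hw
  have h2 := key (-1) w hw
  have h0 : u w = 0 := by linarith
  simp only [hu] at h0
  linarith

end green

/-! ### Assembly of the proposition -/

theorem proposition3p2 (Ω : Set Cylinder) (hΩ : IsCylindricalDomain Ω)
    (c : ℝ) (hc : 0 < c) (φ : ℂ → ℂ) (hφ : IsUniformization Ω c φ)
    (r : ℂ → ℂ) (hr : IsSqrtDeriv φ r)
    (f : ℂ → ℂ → ℂ → ℂ) (hf : ∀ η : ℂ, ∀ z₁ ∈ cylLift Ω, SolvesBVP Ω η z₁ (f η z₁))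
    (G : ℂ → ℂ → ℝ) (hG : IsDirichletGreen c G) :
    ∃ (h₂ : (Fin 2 → ℂ) → ℝ) (h₃ : (Fin 3 → ℂ) → ℝ) (M₂ M₃ : ℝ),
      (∀ z : Fin 2 → ℂ, (∀ k, z k ∈ closedStrip) → DistinctMod c z →
        IsCorrelation c (pulledF f φ r) z (h₂ z)) ∧
      (∀ z : Fin 3 → ℂ, (∀ k, z k ∈ closedStrip) → DistinctMod c z →
        IsCorrelation c (pulledF f φ r) z (h₃ z)) ∧
      (∀ z : Fin 2 → ℂ, (∀ k, (z k).im = Real.pi) → DistinctMod c z → h₂ z = M₂) ∧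
      (∀ z : Fin 3 → ℂ, (∀ k, (z k).im = Real.pi) → DistinctMod c z → h₃ z = M₃) ∧
      (∀ z : Fin 2 → ℂ, (∀ k, z k ∈ openStrip) → DistinctMod c z →
        h₂ z = Real.pi⁻¹ * G (z 0) (z 1) + M₂ * hmTop (z 0) * hmTop (z 1)) ∧
      (∀ z : Fin 3 → ℂ, (∀ k, z k ∈ openStrip) → DistinctMod c z →
        h₃ z = M₃ * hmTop (z 0) * hmTop (z 1) * hmTop (z 2)) := by
  have hpi : Real.pi ≠ 0 := Real.pi_ne_zero
  obtain ⟨b, ω, hg⟩ := exists_isGauge hΩ hφ hc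
  obtain ⟨e, he⟩ := ellKernel_mul_neg b hc
  obtain ⟨τ, hτ⟩ := exists_kernelTriple_eq b hc
  -- The constants M₂ = −e and M₃ = τ absorb the powers of π: each factor Im z_k is π times the
  -- harmonic measure.
  refine ⟨fun z => -(1 / (2 * Real.pi ^ 2)) * logPotential c (z 0) (z 1) -
      e / Real.pi ^ 2 * ((z 0).im * (z 1).im), fun z => τ / Real.pi ^ 3 * ∏ k, (z k).im, -e, τ,
    fun z hz hd => hg.isCorrelation_two hc hφ hr hf he hz (exists_isPathSystem hz hd),
    fun z hz hd => hg.isCorrelation_three hc hφ hr hf hτ (exists_isPathSystem hz hd),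
    fun z hz _ => ?_, fun z hz _ => ?_, fun z hz hd => ?_, fun z _ _ => ?_⟩
  · simp only [logPotential_eq_zero_top hc (hz 1), hz 0, hz 1]
    field_simp
    ring
  · simp only [hz, Fin.prod_univ_three]
    field_simp
  · simp only
    rw [hG.eq_logPotential hc (hz 0) (z 1) ⟨hz 1, fun ⟨m, hm⟩ => hd 1 0 (by decide) m hm⟩, hmTop,
      hmTop]
    field_simp
    ring
  · simp only [Fin.prod_univ_three, hmTop]
    field_simp
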